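/- Let $\nu$ be a probability measure on $\mathbb C$, invariant under rotations about $0$, with $\int_{\mathbb C} |\log|z||\,d\nu(z)<\infty$ (in particular $\nu(\{0\})=0$), and let $V^\nu(z)=\int_{\mathbb C}\log|z-w|\,d\nu(w)$. Let $(a_k)_{k\ge 0}$ be i.i.d. complex random variables such that $a_0\neq 0$ almost surely, $a_0$ is not almost surely constant, and $\mathbb E\log(1+|a_0|)<\infty$. For $n\ge 1$ let \[ P_n(z)=\sum_{k=0}^n a_k\,\frac{z^k}{\sqrt{\langle X^k,X^k\rangle_{n,\nu}}},\qquad \langle P,Q\rangle_{n,\nu}=\int_{\mathbb C}P(z)\overline{Q(z)}\,e^{-2nV^\nu(z)}\,d\nu(z), \] and let $z_1,\dots,z_n$ be the zeros of $P_n$ counted with multiplicity. For $\alpha,\lambda>0$ let \[ f_{\alpha,\lambda}(z)=\sum_{k=0}^\infty \frac{a_k}{\Gamma(1+\frac{2k}{\alpha})^{1/2}}\left(\frac{2\lambda}{\alpha}\right)^{k/\alpha}z^k , \] which is almost surely an entire function. Point processes on $X$ are random elements of the space of locally finite integer-valued measures on $X$ with the vague topology (tested on continuous compactly supported functions), zeros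 are counted with multiplicity, and $D_r$ is the open disk of radius $r$ centred at $0$. (i) At the origin. If $\lim_{r\to0^+}\nu(D_r)/r^\alpha=\lambda$, then the point process $\{n^{1/\alpha}z_1,\dots,n^{1/\alpha}z_n\}$ on $\mathbb C$ converges almost surely, as $n\to\infty$, to the point process of the zeros of $f_{\alpha,\lambda}$. (ii) At infinity. If $\lim_{r\to\infty}r^\alpha\,\nu(\mathbb C\setminus D_r)=\lambda$, then the point process $\{n^{-1/\alpha}z_1,\dots,n^{-1/\alpha}z_n\}$, seen on $\mathbb C\setminus\{0\}$, converges in law to the point process of the inverses of the zeros of $f_{\alpha,\lambda}$. (iii) Maximum. Under the hypothesis of (ii), the maximum $\max\{|z| : z\in\mathbb C\setminus\{0\},\ f_{\alpha,\lambda}(1/z)=0\}$ almost surely exists, and \[ \frac1{n^{1/\alpha}}\max_{1\le k\le n}|z_k|\ \longrightarrow\ \max\{|z| : z\in\mathbb C\setminus\{0\},\ f_{\alpha,\lambda}(1/z)=0\}\quad\text{in law.} \] -/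

import Mathlib

open MeasureTheory ProbabilityTheory Filter Topology

noncomputable section

/-! ### Point configurations and the vague topology -/

/-- Locally finite measures all of whose values are non-negative integers or infinity. -/
def IsPointMeasure {X : Type*} [TopologicalSpace X] [MeasurableSpace X] (μ : Measure X) : Prop :=
  IsLocallyFiniteMeasure μ ∧ ∀ A : Set X, MeasurableSet A → ∃ m : ℕ∞, μ A = (m : ENNReal)

/-- The space of point configurations (with multiplicities) on `X`. -/
structure PointConfig (X : Type*) [TopologicalSpace X] [MeasurableSpace X] where
  toMeasure : Measure X
  isPointMeasure : IsPointMeasure toMeasure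

/-- The vague topology: the smallest one making `P ↦ ∫ f dP` continuous for every continuous
compactly supported `f : X → ℝ`. -/
instance PointConfig.instTopologicalSpace (X : Type*) [TopologicalSpace X] [MeasurableSpace X] :
    TopologicalSpace (PointConfig X) :=
  TopologicalSpace.induced
    (fun (P : PointConfig X) (f : CompactlySupportedContinuousMap X ℝ) => ∫ x, f x ∂P.1)
    inferInstance

instance PointConfig.instMeasurableSpace (X : Type*) [TopologicalSpace X] [MeasurableSpace X] :
    MeasurableSpace (PointConfig X) := borel _

instance PointConfig.instBorelSpace (X : Type*) [TopologicalSpace X] [MeasurableSpace X] :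
    BorelSpace (PointConfig X) := ⟨rfl⟩

theorem isPointMeasure_zero {X : Type*} [TopologicalSpace X] [MeasurableSpace X] :
    IsPointMeasure (0 : Measure X) :=
  ⟨inferInstance, fun A _ => ⟨0, by simp⟩⟩

/-! ### Configurations given by finitely many points -/

/-- `∑ δ_x` over the points `x` of a multiset. -/
def multisetMeasure (s : Multiset ℂ) : Measure ℂ := (s.map Measure.dirac).sum

theorem isPointMeasure_multisetMeasure (s : Multiset ℂ) : IsPointMeasure (multisetMeasure s) := by
  induction s using Multiset.induction with
  | empty => simpa [multisetMeasure] using isPointMeasure_zero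
  | cons a s ih =>
    have h : multisetMeasure (a ::ₘ s) = Measure.dirac a + multisetMeasure s := by
      simp [multisetMeasure]
    rw [h]
    obtain ⟨h1, h2⟩ := ih
    refine ⟨⟨fun x => ?_⟩, fun A hA => ?_⟩
    · obtain ⟨U, hU, hU'⟩ := h1.finiteAtNhds x
      refine ⟨U, hU, ?_⟩
      rw [Measure.add_apply]
      exact ENNReal.add_lt_top.mpr ⟨measure_lt_top _ _, hU'⟩
    · obtain ⟨m, hm⟩ := h2 A hA
      by_cases ha : a ∈ A
      · exact ⟨1 + m, by simp [hm, Measure.dirac_apply' a hA, ha]⟩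
      · exact ⟨m, by simp [hm, Measure.dirac_apply' a hA, ha]⟩

/-- The configuration formed by the points of a finite multiset. -/
def PointConfig.ofMultiset (s : Multiset ℂ) : PointConfig ℂ :=
  ⟨multisetMeasure s, isPointMeasure_multisetMeasure s⟩

/-! ### Zeros of an entire function -/

/-- `∑ δ_z` over the zeros `z` of `f`, repeated according to multiplicity. -/
def zeroMeasure (f : ℂ → ℂ) : Measure ℂ :=
  Measure.sum fun z : ℂ => analyticOrderNatAt f z • Measure.dirac z

theorem exists_enat_tsum {ι : Type*} (g : ι → ENNReal) (hg : ∀ i, ∃ m : ℕ, g i = m) :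
    ∃ m : ℕ∞, ∑' i, g i = (m : ENNReal) := by
  classical
  choose m hm using hg
  by_cases h : (Function.support m).Finite
  · refine ⟨((∑ i ∈ h.toFinset, m i : ℕ) : ℕ∞), ?_⟩
    rw [tsum_eq_sum (s := h.toFinset)]
    · rw [ENat.toENNReal_coe, Nat.cast_sum]
      exact Finset.sum_congr rfl fun i _ => hm i
    · intro i hi
      have : m i = 0 := by simpa using hi
      simp [hm, this]
  · refine ⟨⊤, ?_⟩
    have hinf : Infinite (Function.support m) := Set.infinite_coe_iff.mpr h
    rw [ENat.toENNReal_top, eq_top_iff]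
    calc (⊤ : ENNReal) = ∑' _ : Function.support m, (1 : ENNReal) :=
          (ENNReal.tsum_const_eq_top_of_ne_zero one_ne_zero).symm
      _ ≤ ∑' i : Function.support m, g i := by
          refine ENNReal.tsum_le_tsum fun i => ?_
          rw [hm]
          exact_mod_cast Nat.one_le_iff_ne_zero.mpr i.2
      _ ≤ ∑' i, g i := ENNReal.tsum_comp_le_tsum_of_injective Subtype.val_injective g

theorem isPointMeasure_zeroMeasure {f : ℂ → ℂ} (hf : Differentiable ℂ f) :
    IsPointMeasure (zeroMeasure f) := by
  have han : ∀ z, AnalyticAt ℂ f z := fun z => hf.analyticAt z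
  have key : ∀ A, MeasurableSet A → zeroMeasure f A =
      ∑' z, (analyticOrderNatAt f z : ENNReal) * A.indicator 1 z := by
    intro A hA
    simp [zeroMeasure, Measure.sum_apply _ hA, Measure.dirac_apply' _ hA, nsmul_eq_mul]
  refine ⟨⟨fun x => ?_⟩, fun A hA => ?_⟩
  · rcases (han x).eventually_eq_zero_or_eventually_ne_zero with h | h
    · refine ⟨Set.univ, univ_mem, ?_⟩
      have h0 : f = 0 := by
        have := AnalyticOnNhd.eq_of_eventuallyEq (f := f) (g := 0) (z₀ := x)
          (fun z _ => han z) (fun z _ => analyticAt_const) h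
        exact this
      have : ∀ z, analyticOrderNatAt f z = 0 := by
        intro z
        have : analyticOrderAt f z = ⊤ := by
          rw [analyticOrderAt_eq_top, h0]; simp
        simp [analyticOrderNatAt, this]
      simp [key _ MeasurableSet.univ, this]
    · obtain ⟨U, hU, hUo, hx⟩ := eventually_nhds_iff.mp (eventually_nhdsWithin_iff.mp h)
      refine ⟨U, hUo.mem_nhds hx, ?_⟩
      rw [key U hUo.measurableSet, tsum_eq_single x]
      · simp [hx]
      · intro z hz
        by_cases hzU : z ∈ U
        · have : f z ≠ 0 := hU z hzU hz
          have h0 : analyticOrderAt f z = 0 := (han z).analyticOrderAt_eq_zero.mpr this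
          simp [analyticOrderNatAt, h0]
        · simp [hzU]
  · rw [key A hA]
    refine exists_enat_tsum _ fun z => ?_
    by_cases hz : z ∈ A
    · exact ⟨analyticOrderNatAt f z, by simp [hz]⟩
    · exact ⟨0, by simp [hz]⟩

open Classical in
/-- The configuration of the zeros of the entire function `f`, with multiplicity
(the empty configuration when `f` is not entire). -/
def PointConfig.zeros (f : ℂ → ℂ) : PointConfig ℂ :=
  if hf : Differentiable ℂ f then ⟨zeroMeasure f, isPointMeasure_zeroMeasure hf⟩
  else ⟨0, isPointMeasure_zero⟩

/-! ### Configurations in the punctured plane -/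

/-- The punctured plane. -/
abbrev PuncturedPlane : Type := {z : ℂ // z ≠ 0}

/-- Inversion `z ↦ 1 / z` of the punctured plane. -/
def PuncturedPlane.inversion : PuncturedPlane ≃ₜ PuncturedPlane where
  toFun z := ⟨z.1⁻¹, inv_ne_zero z.2⟩
  invFun z := ⟨z.1⁻¹, inv_ne_zero z.2⟩
  left_inv z := by simp
  right_inv z := by simp
  continuous_toFun :=
    (continuous_subtype_val.inv₀ fun z : PuncturedPlane => z.2).subtype_mk _
  continuous_invFun :=
    (continuous_subtype_val.inv₀ fun z : PuncturedPlane => z.2).subtype_mk _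

theorem isPointMeasure_comap_punctured {μ : Measure ℂ} (hμ : IsPointMeasure μ) :
    IsPointMeasure (μ.comap (Subtype.val : PuncturedPlane → ℂ)) := by
  have he : MeasurableEmbedding (Subtype.val : PuncturedPlane → ℂ) :=
    MeasurableEmbedding.subtype_coe (measurableSet_singleton (0 : ℂ)).compl
  obtain ⟨h1, h2⟩ := hμ
  refine ⟨⟨fun x => ?_⟩, fun A hA => ?_⟩
  · obtain ⟨U, hU, hU'⟩ := h1.finiteAtNhds x.1
    refine ⟨Subtype.val ⁻¹' U, continuous_subtype_val.continuousAt.preimage_mem_nhds hU, ?_⟩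
    rw [he.comap_apply]
    exact (measure_mono (Set.image_preimage_subset _ _)).trans_lt hU'
  · rw [he.comap_apply]
    exact h2 _ (he.measurableSet_image.mpr hA)

/-- The restriction of a configuration to the punctured plane. -/
def PointConfig.punctured (P : PointConfig ℂ) : PointConfig PuncturedPlane :=
  ⟨P.1.comap Subtype.val, isPointMeasure_comap_punctured P.2⟩

theorem isPointMeasure_map_inversion {μ : Measure PuncturedPlane} (hμ : IsPointMeasure μ) :
    IsPointMeasure (μ.map PuncturedPlane.inversion) := by
  have hm : Measurable PuncturedPlane.inversion := PuncturedPlane.inversion.continuous.measurable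
  obtain ⟨h1, h2⟩ := hμ
  refine ⟨⟨fun x => ?_⟩, fun A hA => ?_⟩
  · obtain ⟨U, hU, hUo, hUf⟩ := Measure.exists_isOpen_measure_lt_top μ
      (PuncturedPlane.inversion.symm x)
    refine ⟨PuncturedPlane.inversion.symm ⁻¹' U,
      (hUo.preimage PuncturedPlane.inversion.symm.continuous).mem_nhds hU, ?_⟩
    rw [Measure.map_apply hm
      (hUo.preimage PuncturedPlane.inversion.symm.continuous).measurableSet]
    simpa [← Set.preimage_comp] using hUf
  · rw [Measure.map_apply hm hA]
    exact h2 _ (hm hA)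

/-- The configuration of the inverses `1 / z` of the points `z` of a configuration. -/
def PointConfig.inverted (P : PointConfig PuncturedPlane) : PointConfig PuncturedPlane :=
  ⟨P.1.map PuncturedPlane.inversion, isPointMeasure_map_inversion P.2⟩

/-! ### The model -/

/-- A rotationally invariant measure with `∫ |log |z|| dν < ∞`. As `Real.log 0 = 0`, the fact
that the integrand is infinite at the origin is recorded by `ν {0} = 0`. -/
structure IsAdmissibleBackground (ν : Measure ℂ) : Prop where
  rotation_invariant : ∀ c : ℂ, ‖c‖ = 1 → ν.map (fun z => c * z) = ν
  no_atom_zero : ν {0} = 0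
  integrable_log : Integrable (fun z : ℂ => Real.log ‖z‖) ν

/-- The logarithmic potential `V^ν`. -/
def logPotential (ν : Measure ℂ) (z : ℂ) : ℝ := ∫ w, Real.log ‖z - w‖ ∂ν

/-- The inner product `⟨P, Q⟩ = ∫ P \overline{Q} e^{-2nV^ν} dν`. -/
def weightedInner (ν : Measure ℂ) (n : ℕ) (P Q : Polynomial ℂ) : ℂ :=
  ∫ z, P.eval z * (starRingEnd ℂ) (Q.eval z)
    * (Real.exp (-2 * (n : ℝ) * logPotential ν z) : ℂ) ∂ν

/-- The normalized monomial `z^k / √⟨X^k, X^k⟩`. -/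
def normalizedMonomial (ν : Measure ℂ) (n k : ℕ) : Polynomial ℂ :=
  Polynomial.C
      (((Real.sqrt (weightedInner ν n (Polynomial.X ^ k) (Polynomial.X ^ k)).re)⁻¹ : ℝ) : ℂ)
    * Polynomial.X ^ k

/-- The polynomial `∑_{k ≤ n} a_k R_{k,n}`. -/
def randomPoly (ν : Measure ℂ) (a : ℕ → ℂ) (n : ℕ) : Polynomial ℂ :=
  ∑ k ∈ Finset.range (n + 1), Polynomial.C (a k) * normalizedMonomial ν n k

/-- The sequence `a` is i.i.d., `a_0 ≠ 0` almost surely, `a_0` is not deterministic, and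
`E log (1 + |a_0|) < ∞`. -/
structure IsAdmissibleCoefficients {Ω : Type*} [MeasurableSpace Ω] (μ : Measure Ω)
    (a : ℕ → Ω → ℂ) : Prop where
  measurable : ∀ k, Measurable (a k)
  indep : iIndepFun a μ
  identDistrib : ∀ k, IdentDistrib (a k) (a 0) μ μ
  ne_zero : ∀ᵐ ω ∂μ, a 0 ω ≠ 0
  not_deterministic : ¬ ∃ c : ℂ, ∀ᵐ ω ∂μ, a 0 ω = c
  integrable_log : Integrable (fun ω => Real.log (1 + ‖a 0 ω‖)) μ

/-- The `k`-th term of the series defining the Mittag-Leffler random function. -/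
def mittagLefflerTerm (α lam : ℝ) (a : ℕ → ℂ) (z : ℂ) (k : ℕ) : ℂ :=
  a k / (Real.sqrt (Real.Gamma (1 + 2 * (k : ℝ) / α)) : ℂ)
    * (((2 * lam / α) ^ ((k : ℝ) / α) : ℝ) : ℂ) * z ^ k

/-- The function `z ↦ ∑_k a_k (2λ/α)^{k/α} z^k / Γ(1 + 2k/α)^{1/2}`. -/
def mittagLefflerFun (α lam : ℝ) (a : ℕ → ℂ) (z : ℂ) : ℂ :=
  ∑' k : ℕ, mittagLefflerTerm α lam a z k

/-- The maximum modulus of the points of a finite multiset. -/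
def maxModulus (s : Multiset ℂ) : ℝ := sSup ((fun z : ℂ => ‖z‖) '' {z | z ∈ s})

/-- The set of the moduli `|z|` of the `z ≠ 0` such that `f (1/z) = 0`. -/
def invZeroModuli (f : ℂ → ℂ) : Set ℝ := (fun z : ℂ => ‖z‖) '' {z | z ≠ 0 ∧ f z⁻¹ = 0}

end

/-!
The proof compares the zeros of `P_n`, after rescaling, with those of the entire function
`f_{α, λ}`. By rotation invariance the potential `V^ν` is radial and, up to a constant, equals
`∫_0^{|z|} ν(D_s) / s ds`. If `ν(D_r) ~ λ r^α` at the origin, Laplace's method therefore gives the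
limit of the squared norms of the monomials in the variable `n^{1/α} z`: relative to the norm of
the constant `1`, it is `Γ(1 + 2k/α) (2λ/α)^{-2k/α}`. Together with a bound uniform in `n` on the
coefficients, this makes the rescaled polynomials converge to `f_{α, λ}` locally uniformly, as
soon as `|a_k|` grows at most exponentially; the logarithmic moment ensures this almost surely.
Hurwitz's theorem turns locally uniform convergence into vague convergence of the zeros.

The change of variable `z ↦ 1 / z` exchanges infinity and the origin, and reverses the order of the
coefficients. Reversal preserves their joint law but not their realisation, which is why the
convergence at infinity holds only in law.

For the maximum one needs `f_{α, λ}` to have a zero. It has finite order, so if it had none it would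
be the exponential of a polynomial. All but finitely many coefficients of its logarithmic derivative
would then vanish, and each of these equations determines one `a_k` from the preceding ones. Since
the `a_k` are independent and not deterministic, this has probability zero.
-/

/-! ### Zeros of entire functions -/

section ZeroMeasure

variable {f g : ℂ → ℂ}

lemma zeroMeasure_apply (f : ℂ → ℂ) {A : Set ℂ} (hA : MeasurableSet A) :
    zeroMeasure f A = ∑' z, (analyticOrderNatAt f z : ENNReal) * A.indicator 1 z := by
  simp [zeroMeasure, Measure.sum_apply _ hA, Measure.dirac_apply' _ hA, nsmul_eq_mul]

lemma isLocallyFiniteMeasure_zeroMeasure (hf : Differentiable ℂ f) :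
    IsLocallyFiniteMeasure (zeroMeasure f) := (isPointMeasure_zeroMeasure hf).1

lemma analyticOrderAt_ne_top_of_differentiable (hf : Differentiable ℂ f) (hf0 : f ≠ 0) (z : ℂ) :
    analyticOrderAt f z ≠ ⊤ := fun h =>
  hf0 ((AnalyticOnNhd.analyticOrderAt_eq_top_iff_eq_zero z fun w => hf.analyticAt w).mp h)

lemma analyticOrderNatAt_sub_mul (hg : Differentiable ℂ g) (hg0 : g ≠ 0) (c z : ℂ) :
    analyticOrderNatAt (fun w => (w - c) * g w) z
      = (if z = c then 1 else 0) + analyticOrderNatAt g z := by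
  have hlinear : analyticOrderAt (fun w : ℂ => w - c) z = ((if z = c then 1 else 0 : ℕ) : ℕ∞) := by
    split_ifs with h
    · subst h; simp
    · simp [h]
  change analyticOrderNatAt ((fun w : ℂ => w - c) * g) z = _
  rw [analyticOrderNatAt_mul (by fun_prop) (hg.analyticAt z)
    (by rw [hlinear]; exact ENat.natCast_ne_top _)
    (analyticOrderAt_ne_top_of_differentiable hg hg0 z), analyticOrderNatAt, hlinear,
    ENat.toNat_natCast]

lemma zeroMeasure_sub_mul (hg : Differentiable ℂ g) (hg0 : g ≠ 0) (c : ℂ) :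
    zeroMeasure (fun z => (z - c) * g z) = Measure.dirac c + zeroMeasure g := by
  ext A hA
  rw [Measure.add_apply, zeroMeasure_apply _ hA, zeroMeasure_apply _ hA, Measure.dirac_apply' _ hA]
  simp_rw [analyticOrderNatAt_sub_mul hg hg0, Nat.cast_add, add_mul]
  rw [ENNReal.tsum_add, tsum_eq_single c fun z hz => by simp [hz]]
  simp

lemma zeroMeasure_apply_eq_zero_iff (hf : Differentiable ℂ f) (hf0 : f ≠ 0) {A : Set ℂ}
    (hA : MeasurableSet A) : zeroMeasure f A = 0 ↔ ∀ z ∈ A, f z ≠ 0 := by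
  rw [zeroMeasure_apply f hA, ENNReal.tsum_eq_zero]
  refine forall_congr' fun z => ?_
  by_cases hz : z ∈ A
  · simp only [hz, Set.indicator_of_mem, Pi.one_apply, mul_one, Nat.cast_eq_zero, true_imp_iff]
    rw [← (hf.analyticAt z).analyticOrderAt_eq_zero,
      ← Nat.cast_analyticOrderNatAt (analyticOrderAt_ne_top_of_differentiable hf hf0 z)]
    simp
  · simp [hz]

lemma zeroMeasure_const {c : ℂ} (hc : c ≠ 0) : zeroMeasure (fun _ => c) = 0 :=
  Measure.measure_univ_eq_zero.mp <|
    (zeroMeasure_apply_eq_zero_iff (differentiable_const c) (fun h => hc (congrFun h 0))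
      MeasurableSet.univ).mpr fun _ _ => hc

lemma multisetMeasure_cons (c : ℂ) (s : Multiset ℂ) :
    multisetMeasure (c ::ₘ s) = Measure.dirac c + multisetMeasure s := by
  simp [multisetMeasure]

theorem zeroMeasure_eval {p : Polynomial ℂ} (hp : p ≠ 0) :
    zeroMeasure (fun z => p.eval z) = multisetMeasure p.roots := by
  obtain ⟨c, hc, hfactor⟩ : ∃ c, c ≠ 0 ∧
      p = Polynomial.C c * (p.roots.map fun w => Polynomial.X - Polynomial.C w).prod :=
    ⟨_, Polynomial.leadingCoeff_ne_zero.mpr hp, (IsAlgClosed.splits p).eq_prod_roots⟩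
  rw [hfactor, Polynomial.roots_C_mul _ hc, Polynomial.roots_multiset_prod_X_sub_C]
  generalize p.roots = s
  induction s using Multiset.induction with
  | empty => simp [zeroMeasure_const hc, multisetMeasure]
  | cons w s ih =>
    set q := Polynomial.C c * (s.map fun w => Polynomial.X - Polynomial.C w).prod with hq
    have hq0 : q ≠ 0 := mul_ne_zero (Polynomial.C_ne_zero.mpr hc)
      (Polynomial.monic_multiset_prod_of_monic _ _ fun w _ => Polynomial.monic_X_sub_C w).ne_zero
    have heval : (fun z => (Polynomial.C c *
        ((w ::ₘ s).map fun w => Polynomial.X - Polynomial.C w).prod).eval z)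
        = fun z => (z - w) * q.eval z := by
      ext z; simp [hq]; ring
    rw [heval, zeroMeasure_sub_mul q.differentiable
      (fun h => hq0 (Polynomial.funext fun z => by simpa using congrFun h z)) w, ih,
      multisetMeasure_cons]

end ZeroMeasure

section DSlope

variable {f : ℂ → ℂ} {c : ℂ}

lemma differentiable_dslope (hf : Differentiable ℂ f) (c : ℂ) : Differentiable ℂ (dslope f c) :=
  differentiableOn_univ.mp ((Complex.differentiableOn_dslope univ_mem).mpr hf.differentiableOn)

lemma sub_mul_dslope (hc : f c = 0) : (fun z => (z - c) * dslope f c z) = f := by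
  ext z
  simpa [hc] using sub_smul_dslope f c z

lemma dslope_ne_zero (hf0 : f ≠ 0) (hc : f c = 0) : dslope f c ≠ 0 := by
  rintro h
  refine hf0 ?_
  rw [← sub_mul_dslope hc, h]
  ext z; simp

lemma zeroMeasure_eq_dirac_add_dslope (hf : Differentiable ℂ f) (hf0 : f ≠ 0) (hc : f c = 0) :
    zeroMeasure f = Measure.dirac c + zeroMeasure (dslope f c) := by
  rw [← zeroMeasure_sub_mul (differentiable_dslope hf c) (dslope_ne_zero hf0 hc),
    sub_mul_dslope hc]

end DSlope

/-! ### Hurwitz's theorem -/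

section Hurwitz

lemma eventually_forall_ne_zero_of_tendstoUniformlyOn {ι X E : Type*} [TopologicalSpace X]
    [NormedAddCommGroup E] {F : ι → X → E} {f : X → E} {l : Filter ι} {K : Set X}
    (h : TendstoUniformlyOn F f l K) (hK : IsCompact K) (hf : ContinuousOn f K)
    (hf0 : ∀ x ∈ K, f x ≠ 0) : ∀ᶠ n in l, ∀ x ∈ K, F n x ≠ 0 := by
  rcases K.eq_empty_or_nonempty with rfl | hne
  · simp
  obtain ⟨w, hw, hmin⟩ := hK.exists_isMinOn hne hf.norm
  filter_upwards [Metric.tendstoUniformlyOn_iff.mp h _ (norm_pos_iff.mpr (hf0 w hw))] with n hn x hx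
    hFx
  have hlt : ‖f x‖ < ‖f w‖ := by simpa [hFx] using hn x hx
  exact hlt.not_ge (hmin hx)

/- Otherwise `1 / F` would violate the maximum principle. -/
lemma exists_eq_zero_of_norm_lt_sphere {F : ℂ → ℂ} {c : ℂ} {r δ : ℝ} (hr : 0 < r)
    (hF : DiffContOnCl ℂ F (Metric.ball c r)) (hsphere : ∀ z ∈ Metric.sphere c r, δ ≤ ‖F z‖)
    (hc : ‖F c‖ < δ) : ∃ z ∈ Metric.closedBall c r, F z = 0 := by
  by_contra! hne
  have hinv : DiffContOnCl ℂ (fun z => (F z)⁻¹) (Metric.ball c r) :=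
    hF.inv (by rwa [closure_ball c hr.ne'])
  have hδ : 0 < δ := (norm_nonneg _).trans_lt hc
  have hle : ‖(F c)⁻¹‖ ≤ δ⁻¹ :=
    Complex.norm_le_of_forall_mem_frontier_norm_le Metric.isBounded_ball hinv
      (fun z hz => by
        rw [frontier_ball c hr.ne'] at hz
        rw [norm_inv]
        exact inv_anti₀ hδ (hsphere z hz)) (subset_closure (Metric.mem_ball_self hr))
  rw [norm_inv] at hle
  have hpos : 0 < ‖F c‖ := norm_pos_iff.mpr (hne c (Metric.mem_closedBall_self hr.le))
  exact hc.not_ge ((inv_le_inv₀ hpos hδ).mp hle)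

lemma exists_sphere_forall_ne_zero {f : ℂ → ℂ} (hf : Differentiable ℂ f) (hf0 : f ≠ 0) (c : ℂ)
    {ε : ℝ} (hε : 0 < ε) : ∃ r, 0 < r ∧ r < ε ∧ ∀ z ∈ Metric.sphere c r, f z ≠ 0 := by
  rcases (hf.analyticAt c).eventually_eq_zero_or_eventually_ne_zero with h | h
  · exact absurd (analyticOrderAt_eq_top.mpr h) (analyticOrderAt_ne_top_of_differentiable hf hf0 c)
  obtain ⟨s, hs, hne⟩ := Metric.eventually_nhds_iff.mp (eventually_nhdsWithin_iff.mp h)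
  have hr : 0 < min s ε / 2 := by positivity
  refine ⟨min s ε / 2, hr, by linarith [min_le_right s ε], fun z hz => ?_⟩
  rw [Metric.mem_sphere] at hz
  refine hne ?_ ?_
  · rw [hz]; linarith [min_le_left s ε]
  · rintro rfl
    rw [dist_self] at hz
    exact hr.ne hz

lemma exists_tendsto_mem_of_eventually_inter_ball_nonempty {ι X : Type*} [PseudoMetricSpace X]
    [ProperSpace X] {l : Filter ι} {A : ι → Set X} (hA : ∀ n, IsClosed (A n)) {x : X}
    (h : ∀ ε > 0, ∀ᶠ n in l, (A n ∩ Metric.ball x ε).Nonempty) :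
    ∃ y : ι → X, Tendsto y l (𝓝 x) ∧ ∀ᶠ n in l, y n ∈ A n := by
  have hnearest : ∀ n, ∃ y, (A n).Nonempty → y ∈ A n ∧ Metric.infDist x (A n) = dist x y := by
    intro n
    by_cases hne : (A n).Nonempty
    · obtain ⟨y, hy⟩ := (hA n).exists_infDist_eq_dist hne x
      exact ⟨y, fun _ => hy⟩
    · exact ⟨x, fun h => absurd h hne⟩
  choose y hy using hnearest
  refine ⟨y, Metric.tendsto_nhds.mpr fun ε hε => ?_, ?_⟩
  · filter_upwards [h ε hε] with n ⟨w, hwA, hwx⟩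
    calc dist (y n) x = Metric.infDist x (A n) := by rw [dist_comm, (hy n ⟨w, hwA⟩).2]
      _ ≤ dist x w := Metric.infDist_le_dist_of_mem hwA
      _ < ε := by rwa [dist_comm]
  · filter_upwards [h 1 one_pos] with n ⟨w, hwA, _⟩
    exact (hy n ⟨w, hwA⟩).1

variable {ι : Type*} {F : ι → ℂ → ℂ} {f : ℂ → ℂ} {l : Filter ι}

lemma eventually_ne_zero_of_tendstoLocallyUniformly (h : TendstoLocallyUniformly F f l)
    (hf0 : f ≠ 0) : ∀ᶠ n in l, F n ≠ 0 := by
  obtain ⟨z, hz⟩ := Function.ne_iff.mp hf0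
  have htendsto := (h.tendstoLocallyUniformlyOn (s := Set.univ)).tendsto_at (Set.mem_univ z)
  filter_upwards [htendsto.eventually_ne hz] with n hn
  exact Function.ne_iff.mpr ⟨z, hn⟩

theorem exists_zeros_tendsto_of_tendstoLocallyUniformly (h : TendstoLocallyUniformly F f l)
    (hF : ∀ n, Differentiable ℂ (F n)) (hf : Differentiable ℂ f) (hf0 : f ≠ 0) {c : ℂ}
    (hc : f c = 0) : ∃ z : ι → ℂ, Tendsto z l (𝓝 c) ∧ ∀ᶠ n in l, F n (z n) = 0 := by
  refine exists_tendsto_mem_of_eventually_inter_ball_nonempty (A := fun n => {z | F n z = 0})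
    (fun n => isClosed_eq (hF n).continuous continuous_const) fun ε hε => ?_
  obtain ⟨r, hr, hrε, hsphere⟩ := exists_sphere_forall_ne_zero hf hf0 c hε
  obtain ⟨w, hw, hmin⟩ := (isCompact_sphere c r).exists_isMinOn
    (NormedSpace.sphere_nonempty.mpr hr.le) hf.continuous.norm.continuousOn
  have hpos : 0 < ‖f w‖ := norm_pos_iff.mpr (hsphere w hw)
  have hunif := tendstoLocallyUniformly_iff_forall_isCompact.mp h _ (isCompact_closedBall c r)
  filter_upwards [Metric.tendstoUniformlyOn_iff.mp hunif _ (half_pos hpos)] with n hn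
  obtain ⟨z, hz, hz0⟩ := exists_eq_zero_of_norm_lt_sphere (δ := ‖f w‖ / 2) hr
    (hF n).diffContOnCl
    (fun z hz => by
      have hclose := hn z (Metric.sphere_subset_closedBall hz)
      have hlarge : ‖f w‖ ≤ ‖f z‖ := hmin hz
      rw [dist_eq_norm] at hclose
      linarith [norm_sub_norm_le (f z) (F n z)])
    (by simpa [hc] using hn c (Metric.mem_closedBall_self hr.le))
  exact ⟨z, hz0, Metric.closedBall_subset_ball hrε hz⟩

lemma tendstoUniformlyOn_closedBall_of_sphere {c : ℂ} {r : ℝ} (hr : 0 < r)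
    (hF : ∀ n, DiffContOnCl ℂ (F n) (Metric.ball c r)) (hf : DiffContOnCl ℂ f (Metric.ball c r))
    (h : TendstoUniformlyOn F f l (Metric.sphere c r)) :
    TendstoUniformlyOn F f l (Metric.closedBall c r) := by
  rw [Metric.tendstoUniformlyOn_iff] at h ⊢
  intro ε hε
  filter_upwards [h (ε / 2) (half_pos hε)] with n hn z hz
  rw [dist_eq_norm]
  refine (Complex.norm_le_of_forall_mem_frontier_norm_le Metric.isBounded_ball
    (hf.sub (hF n)) (fun w hw => ?_)
    (by rwa [closure_ball c hr.ne'])).trans_lt (half_lt_self hε)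
  rw [frontier_ball c hr.ne'] at hw
  simpa [dist_eq_norm] using (hn w hw).le

lemma tendstoLocallyUniformly_dslope (h : TendstoLocallyUniformly F f l)
    (hF : ∀ n, Differentiable ℂ (F n)) (hf : Differentiable ℂ f) {z : ι → ℂ} {c : ℂ}
    (hz : Tendsto z l (𝓝 c)) (hc : f c = 0) (hFz : ∀ᶠ n in l, F n (z n) = 0) :
    TendstoLocallyUniformly (fun n => dslope (F n) (z n)) (dslope f c) l := by
  refine tendstoLocallyUniformly_iff_forall_isCompact.mpr fun K hK => ?_
  obtain ⟨r, hcr, hKr⟩ : ∃ r > 0, K ⊆ Metric.closedBall c r := by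
    obtain ⟨r, hr⟩ := hK.isBounded.subset_closedBall c
    exact ⟨max r 1, by positivity,
      hr.trans (Metric.closedBall_subset_closedBall (le_max_left _ _))⟩
  -- On a circle around `c` the divided differences are honest quotients.
  have hne : ∀ w ∈ Metric.sphere c r, w - c ≠ 0 := fun w hw =>
    sub_ne_zero.mpr (Metric.ne_of_mem_sphere hw hcr.ne')
  have hden : TendstoLocallyUniformlyOn (fun n w => w - z n) (fun w => w - c) l
      (Metric.sphere c r) := by
    refine TendstoUniformlyOn.tendstoLocallyUniformlyOn (Metric.tendstoUniformlyOn_iff.mpr ?_)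
    intro ε hε
    filter_upwards [Metric.tendsto_nhds.mp hz ε hε] with n hn w _
    rwa [dist_sub_left, dist_comm]
  have hquot := (tendstoLocallyUniformlyOn_iff_tendstoUniformlyOn_of_compact
    (isCompact_sphere c r)).mp ((h.tendstoLocallyUniformlyOn (s := Metric.sphere c r)).fun_div₀
      hden hf.continuous.continuousOn (by fun_prop) hne)
  have hsphere : TendstoUniformlyOn (fun n => dslope (F n) (z n)) (dslope f c) l
      (Metric.sphere c r) := by
    refine (hquot.congr ?_).congr_right fun w hw => ?_
    · filter_upwards [hFz, Metric.tendsto_nhds.mp hz r hcr] with n hn hnr w hw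
      have hwz : w ≠ z n := by
        rintro rfl
        exact (Metric.mem_sphere.mp hw ▸ hnr).false
      simp [dslope_of_ne _ hwz, slope_def_field, hn]
    · simp [dslope_of_ne _ (sub_ne_zero.mp (hne w hw)), slope_def_field, hc]
  exact (tendstoUniformlyOn_closedBall_of_sphere hcr
    (fun n => (differentiable_dslope (hF n) (z n)).diffContOnCl)
    (differentiable_dslope hf c).diffContOnCl hsphere).mono hKr

section Integral

variable {χ : ℂ → ℝ} {K : Set ℂ}

lemma integral_zeroMeasure_eq_zero (hf : Differentiable ℂ f) (hf0 : f ≠ 0) (hK : MeasurableSet K)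
    (hfK : ∀ z ∈ K, f z ≠ 0) (hχ : ∀ z ∉ K, χ z = 0) : ∫ z, χ z ∂(zeroMeasure f) = 0 := by
  refine integral_eq_zero_of_ae ?_
  filter_upwards [compl_mem_ae_iff.mpr ((zeroMeasure_apply_eq_zero_iff hf hf0 hK).mpr hfK)]
    with z hz using hχ z hz

lemma integral_zeroMeasure_eq_add_dslope (hf : Differentiable ℂ f) (hf0 : f ≠ 0) {c : ℂ}
    (hc : f c = 0) (hχ : Continuous χ) (hχc : HasCompactSupport χ) :
    ∫ z, χ z ∂(zeroMeasure f) = χ c + ∫ z, χ z ∂(zeroMeasure (dslope f c)) := by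
  have := isLocallyFiniteMeasure_zeroMeasure (differentiable_dslope hf c)
  rw [zeroMeasure_eq_dirac_add_dslope hf hf0 hc,
    integral_add_measure (hχ.integrable_of_hasCompactSupport hχc)
      (hχ.integrable_of_hasCompactSupport hχc), integral_dirac]

lemma exists_zeroMeasure_eq_natCast (hf : Differentiable ℂ f) (hK : IsCompact K) :
    ∃ m : ℕ, zeroMeasure f K = m := by
  have := isLocallyFiniteMeasure_zeroMeasure hf
  obtain ⟨m, hm⟩ := (isPointMeasure_zeroMeasure hf).2 K hK.measurableSet
  lift m to ℕ using fun htop => hK.measure_lt_top.ne (by rw [hm, htop, ENat.toENNReal_top])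
  exact ⟨m, by simpa using hm⟩

-- Induction on the number of zeros of `f` in the support of `χ`: each of them attracts a zero of
-- `F n`, and both are divided out.
theorem tendsto_integral_zeroMeasure (h : TendstoLocallyUniformly F f l)
    (hF : ∀ n, Differentiable ℂ (F n)) (hf : Differentiable ℂ f) (hf0 : f ≠ 0)
    (hχ : Continuous χ) (hχc : HasCompactSupport χ) :
    Tendsto (fun n => ∫ z, χ z ∂(zeroMeasure (F n))) l (𝓝 (∫ z, χ z ∂(zeroMeasure f))) := by
  have hK : IsCompact (tsupport χ) := hχc
  obtain ⟨m, hm⟩ := exists_zeroMeasure_eq_natCast hf hK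
  induction m generalizing F f with
  | zero =>
    have hne := (zeroMeasure_apply_eq_zero_iff hf hf0 hK.measurableSet).mp (by simpa using hm)
    have hχ0 : ∀ z ∉ tsupport χ, χ z = 0 := fun z => image_eq_zero_of_notMem_tsupport
    rw [integral_zeroMeasure_eq_zero hf hf0 hK.measurableSet hne hχ0]
    refine tendsto_const_nhds.congr' ?_
    filter_upwards [eventually_forall_ne_zero_of_tendstoUniformlyOn
      (tendstoLocallyUniformly_iff_forall_isCompact.mp h _ hK) hK hf.continuous.continuousOn hne,
      eventually_ne_zero_of_tendstoLocallyUniformly h hf0] with n hn hn0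
    exact (integral_zeroMeasure_eq_zero (hF n) hn0 hK.measurableSet hn hχ0).symm
  | succ m ih =>
    obtain ⟨c, hcK, hc⟩ : ∃ c ∈ tsupport χ, f c = 0 := by
      by_contra! hne
      rw [(zeroMeasure_apply_eq_zero_iff hf hf0 hK.measurableSet).mpr hne] at hm
      exact absurd hm.symm (by simp)
    obtain ⟨z, hz, hFz⟩ := exists_zeros_tendsto_of_tendstoLocallyUniformly h hF hf hf0 hc
    have hm' : zeroMeasure (dslope f c) (tsupport χ) = m := by
      rw [zeroMeasure_eq_dirac_add_dslope hf hf0 hc, Measure.add_apply,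
        Measure.dirac_apply_of_mem hcK, Nat.cast_succ, add_comm] at hm
      exact (ENNReal.add_left_inj ENNReal.one_ne_top).mp hm
    have hlim := ih (tendstoLocallyUniformly_dslope h hF hf hz hc hFz)
      (fun n => differentiable_dslope (hF n) (z n)) (differentiable_dslope hf c)
      (dslope_ne_zero hf0 hc) hm'
    rw [integral_zeroMeasure_eq_add_dslope hf hf0 hc hχ hχc]
    refine (((hχ.tendsto c).comp hz).add hlim).congr' ?_
    filter_upwards [hFz, eventually_ne_zero_of_tendstoLocallyUniformly h hf0] with n hn hn0
    exact (integral_zeroMeasure_eq_add_dslope (hF n) hn0 hn hχ hχc).symm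

end Integral

theorem tendsto_infDist_zeros (h : TendstoLocallyUniformly F f l)
    (hF : ∀ n, Differentiable ℂ (F n)) (hf : Differentiable ℂ f) (hf0 : f ≠ 0)
    (hzero : ∃ z, f z = 0) (x : ℂ) :
    Tendsto (fun n => Metric.infDist x {z | F n z = 0}) l (𝓝 (Metric.infDist x {z | f z = 0})) := by
  obtain ⟨c, hc, hmin⟩ :=
    (isClosed_eq hf.continuous continuous_const).exists_infDist_eq_dist hzero x
  obtain ⟨z, hz, hFz⟩ := exists_zeros_tendsto_of_tendstoLocallyUniformly h hF hf hf0 hc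
  refine tendsto_order.mpr ⟨fun ρ hρ => ?_, fun ρ hρ => ?_⟩
  · obtain ⟨ρ', hρρ', hρ'⟩ := exists_between hρ
    have hne : ∀ w ∈ Metric.closedBall x ρ', f w ≠ 0 := fun w hw hfw =>
      (((Metric.infDist_le_dist_of_mem (s := {z | f z = 0}) hfw).trans
        (Metric.mem_closedBall'.mp hw)).trans_lt hρ').false
    filter_upwards [hFz, eventually_forall_ne_zero_of_tendstoUniformlyOn
      (tendstoLocallyUniformly_iff_forall_isCompact.mp h _ (isCompact_closedBall x ρ'))
      (isCompact_closedBall x ρ') hf.continuous.continuousOn hne] with n hn hnρ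
    refine hρρ'.trans_le ((Metric.le_infDist ⟨z n, hn⟩).mpr fun w hw => ?_)
    by_contra! hlt
    exact hnρ w (Metric.mem_closedBall'.mpr hlt.le) hw
  · rw [hmin] at hρ
    filter_upwards [hFz, (tendsto_const_nhds.dist hz).eventually (gt_mem_nhds hρ)] with n hn hlt
    exact (Metric.infDist_le_dist_of_mem (s := {z | F n z = 0}) hn).trans_lt hlt

end Hurwitz

/-! ### The vague topology -/

section CompactlySupported

variable (X : Type*) [TopologicalSpace X]

lemma exists_cutoff_of_isCompact [R1Space X] [LocallyCompactSpace X] {K : Set X}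
    (hK : IsCompact K) :
    ∃ g : CompactlySupportedContinuousMap X ℝ, (∀ x, 0 ≤ g x) ∧ ∀ x ∈ K, g x = 1 := by
  obtain ⟨g, hg1, hgc, -, hg⟩ :=
    exists_continuousMap_one_of_isCompact_subset_isOpen hK isOpen_univ K.subset_univ
  exact ⟨⟨g, hgc⟩, fun x => (hg x).1, hg1⟩

lemma exists_countable_dense_of_eqOn_zero_compl [LocallyCompactSpace X]
    [SecondCountableTopology X] [R1Space X] {K : Set X} (hK : IsCompact K) :
    ∃ S : Set (CompactlySupportedContinuousMap X ℝ), S.Countable ∧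
      (∀ h ∈ S, Set.EqOn h 0 Kᶜ) ∧
      ∀ f : CompactlySupportedContinuousMap X ℝ, Set.EqOn f 0 Kᶜ →
        ∀ δ > 0, ∃ h ∈ S, ∀ x ∈ K, |f x - h x| < δ := by
  let E : Set C(X, ℝ) := {f | Set.EqOn f 0 Kᶜ}
  let toCc : E → CompactlySupportedContinuousMap X ℝ := fun f =>
    ⟨f.1, HasCompactSupport.intro hK fun _ hx => f.2 hx⟩
  obtain ⟨T, hTc, hTd⟩ := TopologicalSpace.exists_countable_dense E
  refine ⟨toCc '' T, hTc.image _, ?_, fun f hf δ hδ => ?_⟩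
  · rintro _ ⟨h, -, rfl⟩
    exact h.2
  have hnhds : ∀ᶠ h in 𝓝 (⟨f.toContinuousMap, hf⟩ : E), ∀ x ∈ K, dist (f x) (h.1 x) < δ :=
    continuous_subtype_val.continuousAt.eventually <| Metric.tendstoUniformlyOn_iff.mp
      (ContinuousMap.tendsto_iff_forall_isCompact_tendstoUniformlyOn.mp tendsto_id K hK) δ hδ
  obtain ⟨h, hhT, hh⟩ := hTd.inter_nhds_nonempty hnhds
  exact ⟨toCc h, ⟨h, hhT, rfl⟩, hh⟩

theorem exists_countable_dense_compactlySupported [LocallyCompactSpace X]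
    [SecondCountableTopology X] [R1Space X] :
    ∃ S : Set (CompactlySupportedContinuousMap X ℝ), S.Countable ∧
      ∀ f : CompactlySupportedContinuousMap X ℝ, ∃ g ∈ S, (∀ x, 0 ≤ g x) ∧
        ∀ δ > 0, ∃ h ∈ S, ∀ x, |f x - h x| ≤ δ * g x := by
  let K := CompactExhaustion.choice X
  choose g hg0 hg1 using fun m => exists_cutoff_of_isCompact X (K.isCompact m)
  choose S hSc hS0 hSd using fun m => exists_countable_dense_of_eqOn_zero_compl X (K.isCompact m)
  refine ⟨(⋃ m, S m) ∪ Set.range g, (Set.countable_iUnion hSc).union (Set.countable_range g),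
    fun f => ?_⟩
  obtain ⟨m, hm⟩ := K.exists_superset_of_isCompact f.hasCompactSupport
  have hf : Set.EqOn f 0 (K m)ᶜ := fun x hx =>
    image_eq_zero_of_notMem_tsupport fun hx' => hx (hm hx')
  refine ⟨g m, Or.inr ⟨m, rfl⟩, hg0 m, fun δ hδ => ?_⟩
  obtain ⟨h, hhS, hh⟩ := hSd m f hf δ hδ
  refine ⟨h, Or.inl (Set.mem_iUnion.mpr ⟨m, hhS⟩), fun x => ?_⟩
  by_cases hx : x ∈ K m
  · rw [hg1 m x hx, mul_one]
    exact (hh x hx).le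
  · rw [hf hx, hS0 m h hhS hx]
    simpa using mul_nonneg hδ.le (hg0 m x)

end CompactlySupported

namespace PointConfig

variable {X Y ι : Type*} [TopologicalSpace X] [MeasurableSpace X]

@[ext]
lemma ext {P Q : PointConfig X} (h : P.1 = Q.1) : P = Q := by
  cases P; cases Q; cases h; rfl

lemma isInducing_integral (X : Type*) [TopologicalSpace X] [MeasurableSpace X] :
    IsInducing (fun (P : PointConfig X) (f : CompactlySupportedContinuousMap X ℝ) =>
      ∫ x, f x ∂P.1) := ⟨rfl⟩

lemma tendsto_iff {l : Filter ι} {P : ι → PointConfig X} {Q : PointConfig X} :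
    Tendsto P l (𝓝 Q) ↔ ∀ f : CompactlySupportedContinuousMap X ℝ,
      Tendsto (fun i => ∫ x, f x ∂(P i).1) l (𝓝 (∫ x, f x ∂Q.1)) := by
  rw [(isInducing_integral X).tendsto_nhds_iff, tendsto_pi_nhds]
  rfl

lemma continuous_integral (f : CompactlySupportedContinuousMap X ℝ) :
    Continuous (fun P : PointConfig X => ∫ x, f x ∂P.1) :=
  continuous_iff_continuousAt.mpr fun _ => tendsto_iff.mp tendsto_id f

lemma continuous_of_integral [TopologicalSpace Y] {T : Y → PointConfig X}
    (h : ∀ f : CompactlySupportedContinuousMap X ℝ, Continuous (fun y => ∫ x, f x ∂(T y).1)) :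
    Continuous T :=
  continuous_iff_continuousAt.mpr fun _ => tendsto_iff.mpr fun f => (h f).continuousAt.tendsto

lemma integrable [OpensMeasurableSpace X] (P : PointConfig X)
    (f : CompactlySupportedContinuousMap X ℝ) : Integrable f P.1 := by
  have := P.2.1
  exact f.continuous.integrable_of_hasCompactSupport f.hasCompactSupport

lemma abs_integral_sub_le [OpensMeasurableSpace X] (P : PointConfig X)
    {f g h : CompactlySupportedContinuousMap X ℝ} {δ : ℝ} (H : ∀ x, |f x - h x| ≤ δ * g x) :
    |∫ x, f x ∂P.1 - ∫ x, h x ∂P.1| ≤ δ * ∫ x, g x ∂P.1 := by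
  rw [← integral_sub (P.integrable f) (P.integrable h), ← integral_const_mul]
  exact abs_integral_le_integral_abs.trans <| integral_mono_of_nonneg
    (Eventually.of_forall fun _ => abs_nonneg _) ((P.integrable g).const_mul δ)
    (Eventually.of_forall H)

lemma tendsto_integral_of_dense [OpensMeasurableSpace X]
    {S : Set (CompactlySupportedContinuousMap X ℝ)} {l : Filter ι}
    {P : ι → PointConfig X} {Q : PointConfig X}
    (hP : ∀ f ∈ S, Tendsto (fun i => ∫ x, f x ∂(P i).1) l (𝓝 (∫ x, f x ∂Q.1)))
    {f g : CompactlySupportedContinuousMap X ℝ} (hgS : g ∈ S) (hg0 : ∀ x, 0 ≤ g x)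
    (hf : ∀ δ > 0, ∃ h ∈ S, ∀ x, |f x - h x| ≤ δ * g x) :
    Tendsto (fun i => ∫ x, f x ∂(P i).1) l (𝓝 (∫ x, f x ∂Q.1)) := by
  rw [Metric.tendsto_nhds]
  intro ε hε
  set A := ∫ x, g x ∂Q.1
  have hA : 0 ≤ A := integral_nonneg hg0
  set δ := ε / (4 * (A + 1))
  have hδ : 0 < δ := by positivity
  have hδA : δ * (A + 1) = ε / 4 := by simp only [δ]; field_simp
  obtain ⟨h, hhS, hh⟩ := hf δ hδ
  filter_upwards [Metric.tendsto_nhds.mp (hP h hhS) (ε / 4) (by positivity),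
    (hP g hgS).eventually (gt_mem_nhds (lt_add_one A))] with i hclose hcut
  have hPi := (P i).abs_integral_sub_le hh
  have hQ := Q.abs_integral_sub_le hh
  have hPi' : δ * ∫ x, g x ∂(P i).1 ≤ ε / 4 := hδA ▸ by gcongr
  have hQ' : δ * A ≤ ε / 4 := hδA ▸ by gcongr; linarith
  rw [Real.dist_eq, abs_lt] at hclose ⊢
  rw [abs_le] at hPi hQ
  constructor <;> linarith [hPi.1, hPi.2, hQ.1, hQ.2, hclose.1, hclose.2]

instance [OpensMeasurableSpace X] [LocallyCompactSpace X] [SecondCountableTopology X]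
    [R1Space X] : TopologicalSpace.PseudoMetrizableSpace (PointConfig X) := by
  obtain ⟨S, hSc, hSd⟩ := exists_countable_dense_compactlySupported X
  have := hSc.to_subtype
  have hind : IsInducing (fun (P : PointConfig X) (f : S) => ∫ x, f.1 x ∂P.1) := by
    refine isInducing_iff_nhds.mpr fun P => le_antisymm ?_ ?_
    · rw [← tendsto_iff_comap, tendsto_pi_nhds]
      exact fun f => (continuous_integral f.1).continuousAt
    · set T := fun (P : PointConfig X) (f : S) => ∫ x, f.1 x ∂P.1
      have hT : Tendsto T (comap T (𝓝 (T P))) (𝓝 (T P)) := tendsto_comap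
      refine tendsto_id'.mp (tendsto_iff.mpr fun f => ?_)
      obtain ⟨g, hgS, hg0, hf⟩ := hSd f
      exact tendsto_integral_of_dense
        (fun h hh => tendsto_pi_nhds.mp hT ⟨h, hh⟩) hgS hg0 hf
  exact hind.pseudoMetrizableSpace

/-- Extension by zero of a test function from the punctured plane. -/
noncomputable def extendPunctured (f : CompactlySupportedContinuousMap PuncturedPlane ℝ) :
    CompactlySupportedContinuousMap ℂ ℝ where
  toFun := Function.extend Subtype.val f 0
  continuous_toFun := HasCompactSupport.continuous_extend_zero (U := {z : ℂ | z ≠ 0})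
    isOpen_ne f.continuous f.hasCompactSupport
  hasCompactSupport' := f.hasCompactSupport.extend_zero continuous_subtype_val

lemma integral_punctured (P : PointConfig ℂ)
    (f : CompactlySupportedContinuousMap PuncturedPlane ℝ) :
    ∫ x, f x ∂P.punctured.1 = ∫ z, extendPunctured f z ∂P.1 := by
  have hext : ∀ x : PuncturedPlane, f x = extendPunctured f x.1 := fun x =>
    (Subtype.val_injective.extend_apply f 0 x).symm
  calc ∫ x, f x ∂P.punctured.1
      = ∫ x : {z : ℂ | z ≠ 0}, extendPunctured f x ∂(P.1.comap Subtype.val) := by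
        simp_rw [hext]; rfl
    _ = ∫ z in {z : ℂ | z ≠ 0}, extendPunctured f z ∂P.1 :=
        integral_subtype_comap isOpen_ne.measurableSet _
    _ = ∫ z, extendPunctured f z ∂P.1 :=
        setIntegral_eq_integral_of_forall_compl_eq_zero fun z hz =>
          Function.extend_apply' _ _ _ (by rintro ⟨w, rfl⟩; exact hz w.2)

lemma continuous_punctured : Continuous punctured :=
  continuous_of_integral fun f => by
    simp_rw [integral_punctured]
    exact continuous_integral _

lemma continuous_inverted : Continuous inverted :=
  continuous_of_integral fun f => by
    have hmap : ∀ P : PointConfig PuncturedPlane,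
        ∫ x, f x ∂P.inverted.1 = ∫ x, f (PuncturedPlane.inversion x) ∂P.1 := fun P =>
      integral_map PuncturedPlane.inversion.continuous.measurable.aemeasurable
        f.continuous.aestronglyMeasurable
    simp_rw [hmap]
    exact continuous_integral (X := PuncturedPlane)
      ⟨⟨fun x => f (PuncturedPlane.inversion x),
        f.continuous.comp PuncturedPlane.inversion.continuous⟩,
        f.hasCompactSupport.comp_homeomorph PuncturedPlane.inversion⟩

theorem tendsto_zeros {F : ι → ℂ → ℂ} {f : ℂ → ℂ} {l : Filter ι}
    (h : TendstoLocallyUniformly F f l) (hF : ∀ n, Differentiable ℂ (F n))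
    (hf : Differentiable ℂ f) (hf0 : f ≠ 0) :
    Tendsto (fun n => zeros (F n)) l (𝓝 (zeros f)) := by
  refine tendsto_iff.mpr fun χ => ?_
  simp only [zeros, hF, hf, dif_pos]
  exact tendsto_integral_zeroMeasure h hF hf hf0 χ.continuous χ.hasCompactSupport

end PointConfig

/-! ### Quantile functions -/

/-- The quantile function of a measure on the line, that is the generalized inverse of its
distribution function; it is meaningful on `(0, 1)` only. -/
noncomputable def quantile (m : Measure ℝ) (p : ℝ) : ℝ := sInf {r | p ≤ cdf m r}

section Quantile

variable (m : Measure ℝ)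

lemma quantile_le_iff {p : ℝ} (hp : p ∈ Set.Ioo (0 : ℝ) 1) (r : ℝ) :
    quantile m p ≤ r ↔ p ≤ cdf m r := by
  have hne : {r | p ≤ cdf m r}.Nonempty :=
    ((tendsto_cdf_atTop m).eventually_const_le hp.2).exists
  have hbdd : BddBelow {r | p ≤ cdf m r} := by
    obtain ⟨r, hr⟩ := ((tendsto_cdf_atBot m).eventually_lt_const hp.1).exists
    exact ⟨r, fun s hs => le_of_not_gt fun hlt =>
      (hs.trans (monotone_cdf m hlt.le)).not_gt hr⟩
  refine ⟨fun h => ?_, fun h => csInf_le hbdd h⟩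
  have hgt : ∀ s, quantile m p < s → p ≤ cdf m s := fun s hs => by
    obtain ⟨t, ht, hts⟩ := exists_lt_of_csInf_lt hne hs
    exact ht.out.trans (monotone_cdf m hts.le)
  have hright : Tendsto (cdf m) (𝓝[>] (quantile m p)) (𝓝 (cdf m (quantile m p))) :=
    ((cdf m).right_continuous (quantile m p)).mono Set.Ioi_subset_Ici_self
  exact (ge_of_tendsto hright (eventually_mem_nhdsWithin.mono hgt)).trans (monotone_cdf m h)

lemma monotoneOn_quantile : MonotoneOn (quantile m) (Set.Ioo 0 1) := fun _ hp _ hq hpq =>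
  (quantile_le_iff m hp _).mpr (hpq.trans ((quantile_le_iff m hq _).mp le_rfl))

lemma aemeasurable_quantile :
    AEMeasurable (quantile m) (volume.restrict (Set.Ioo 0 1)) :=
  aemeasurable_restrict_of_monotoneOn measurableSet_Ioo (monotoneOn_quantile m)

theorem map_quantile [IsProbabilityMeasure m] :
    (volume.restrict (Set.Ioo (0 : ℝ) 1)).map (quantile m) = m := by
  refine Measure.ext_of_Iic _ _ fun r => ?_
  have hpre : quantile m ⁻¹' Set.Iic r ∩ Set.Ioo 0 1 = Set.Iic (cdf m r) ∩ Set.Ioo 0 1 := by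
    ext p
    exact and_congr_left fun hp => quantile_le_iff m hp r
  rw [Measure.map_apply_of_aemeasurable (aemeasurable_quantile m) measurableSet_Iic,
    Measure.restrict_apply' measurableSet_Ioo, ← ofReal_cdf, hpre]
  have hlower : Set.Ioo 0 (cdf m r) ⊆ Set.Iic (cdf m r) ∩ Set.Ioo 0 1 := fun p hp =>
    ⟨hp.2.le, hp.1, hp.2.trans_le (cdf_le_one m r)⟩
  have hupper : Set.Iic (cdf m r) ∩ Set.Ioo 0 1 ⊆ Set.Ioc 0 (cdf m r) := fun p hp =>
    ⟨hp.2.1, hp.1⟩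
  exact le_antisymm ((measure_mono hupper).trans (by simp))
    (le_trans (by simp) (measure_mono hlower))

lemma integral_quantile [IsProbabilityMeasure m] {g : ℝ → ℝ} (hg : Measurable g) :
    ∫ r, g r ∂m = ∫ p in Set.Ioo (0 : ℝ) 1, g (quantile m p) := by
  conv_lhs => rw [← map_quantile m]
  exact integral_map (aemeasurable_quantile m) hg.aestronglyMeasurable

variable {m} in
lemma quantile_pos [IsProbabilityMeasure m] (h0 : m (Set.Iic 0) = 0) {p : ℝ}
    (hp : p ∈ Set.Ioo (0 : ℝ) 1) : 0 < quantile m p := by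
  by_contra! h
  rw [quantile_le_iff m hp, cdf_eq_real, measureReal_def, h0, ENNReal.toReal_zero] at h
  exact hp.1.not_ge h

lemma tendsto_const_mul_rpow_nhdsGT_zero {c b : ℝ} (hc : 0 < c) (hb : 0 < b) :
    Tendsto (fun p : ℝ => c * p ^ b) (𝓝[>] 0) (𝓝[>] 0) := by
  refine tendsto_nhdsWithin_iff.mpr ⟨?_, ?_⟩
  · have hcont := ((Real.continuousAt_rpow_const 0 b (Or.inr hb.le)).tendsto).const_mul c
    rw [Real.zero_rpow hb.ne', mul_zero] at hcont
    exact hcont.mono_left nhdsWithin_le_nhds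
  · filter_upwards [self_mem_nhdsWithin] with p hp
    exact mul_pos hc (Real.rpow_pos_of_pos hp _)

lemma tendsto_comp_const_mul_rpow_div {F : ℝ → ℝ} {α lam : ℝ} (hα : 0 < α)
    (hF : Tendsto (fun r : ℝ => F r / r ^ α) (𝓝[>] 0) (𝓝 lam)) {c : ℝ} (hc : 0 < c) :
    Tendsto (fun p : ℝ => F (c * p ^ (1 / α)) / p) (𝓝[>] 0) (𝓝 (lam * c ^ α)) := by
  refine ((hF.comp (tendsto_const_mul_rpow_nhdsGT_zero hc (one_div_pos.mpr hα))).mul_const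
    (c ^ α)).congr' ?_
  filter_upwards [self_mem_nhdsWithin] with p (hp : 0 < p)
  have hpow : (c * p ^ (1 / α)) ^ α = c ^ α * p := by
    rw [Real.mul_rpow hc.le (by positivity), one_div, Real.rpow_inv_rpow hp.le hα.ne']
  have := Real.rpow_pos_of_pos hc α
  simp only [Function.comp_apply, hpow]
  field_simp

theorem tendsto_quantile_div_rpow [IsProbabilityMeasure m] (h0 : m (Set.Iic 0) = 0) {α lam : ℝ}
    (hα : 0 < α) (hlam : 0 < lam)
    (hF : Tendsto (fun r : ℝ => cdf m r / r ^ α) (𝓝[>] 0) (𝓝 lam)) :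
    Tendsto (fun p => quantile m p / p ^ (1 / α)) (𝓝[>] 0) (𝓝 (lam ^ (-(1 / α)))) := by
  have hIoo : ∀ᶠ p in 𝓝[>] (0 : ℝ), p ∈ Set.Ioo (0 : ℝ) 1 := Ioo_mem_nhdsGT one_pos
  have hnormalized : lam * (lam ^ (-(1 / α))) ^ α = 1 := by
    rw [Real.rpow_neg hlam.le, Real.inv_rpow (by positivity), one_div,
      Real.rpow_inv_rpow hlam.le hα.ne', mul_inv_cancel₀ hlam.ne']
  have hL : 0 < lam ^ (-(1 / α)) := by positivity
  refine tendsto_order.mpr ⟨fun c hc => ?_, fun c hc => ?_⟩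
  · rcases le_or_gt c 0 with hc0 | hc0
    · filter_upwards [hIoo] with p hp
      exact hc0.trans_lt (div_pos (quantile_pos h0 hp) (Real.rpow_pos_of_pos hp.1 _))
    · have hlt : lam * c ^ α < 1 := hnormalized ▸ by gcongr
      filter_upwards [hIoo, (tendsto_comp_const_mul_rpow_div hα hF hc0).eventually_lt_const hlt]
        with p hp hcdf
      rw [div_lt_one hp.1] at hcdf
      rw [lt_div_iff₀ (Real.rpow_pos_of_pos hp.1 _), ← not_le, quantile_le_iff m hp, not_le]
      exact hcdf
  · obtain ⟨c', hc1, hc2⟩ := exists_between hc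
    have hgt : 1 < lam * c' ^ α := hnormalized ▸ by gcongr
    filter_upwards [hIoo, (tendsto_comp_const_mul_rpow_div hα hF
      (hL.trans hc1)).eventually_const_lt hgt] with p hp hcdf
    rw [one_lt_div hp.1] at hcdf
    refine lt_of_le_of_lt ?_ hc2
    rw [div_le_iff₀ (Real.rpow_pos_of_pos hp.1 _)]
    exact (quantile_le_iff m hp _).mpr hcdf.le

end Quantile

/-! ### Comparison with powers near the origin -/

section PowerComparison

variable {f g : ℝ → ℝ} {L c : ℝ}

lemma eventually_mul_le_of_tendsto_div {X : Type*} {l : Filter X} {f g : X → ℝ}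
    (hg : ∀ᶠ x in l, 0 < g x) (h : Tendsto (fun x => f x / g x) l (𝓝 L)) (hc : c < L) :
    ∀ᶠ x in l, c * g x ≤ f x := by
  filter_upwards [hg, h.eventually_const_lt hc] with x hx hlt
  exact ((lt_div_iff₀ hx).mp hlt).le

lemma eventually_le_mul_of_tendsto_div {X : Type*} {l : Filter X} {f g : X → ℝ}
    (hg : ∀ᶠ x in l, 0 < g x) (h : Tendsto (fun x => f x / g x) l (𝓝 L)) (hc : L < c) :
    ∀ᶠ x in l, f x ≤ c * g x := by
  filter_upwards [hg, h.eventually_lt_const hc] with x hx hlt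
  exact ((div_lt_iff₀ hx).mp hlt).le

lemma eventually_nhdsGT_zero_forall_Ioc {P : ℝ → Prop} (h : ∀ᶠ p in 𝓝[>] 0, P p) :
    ∃ p₀ ∈ Set.Ioo (0 : ℝ) 1, ∀ p ∈ Set.Ioc 0 p₀, P p := by
  obtain ⟨p₀, hp₀, hsub⟩ := mem_nhdsGT_iff_exists_Ioc_subset.mp (h.and (Ioo_mem_nhdsGT one_pos))
  exact ⟨p₀, (hsub ⟨hp₀, le_rfl⟩).2, fun p hp => (hsub hp).1⟩

lemma exists_forall_Ioo_mul_le (hf : MonotoneOn f (Set.Ioo 0 1))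
    (hg : ∀ p ∈ Set.Ioo (0 : ℝ) 1, 0 < g p ∧ g p ≤ 1) (hc : 0 < c)
    (h : ∀ᶠ p in 𝓝[>] 0, c * g p ≤ f p) :
    ∃ c' > 0, ∀ p ∈ Set.Ioo (0 : ℝ) 1, c' * g p ≤ f p := by
  obtain ⟨p₀, hp₀, hle⟩ := eventually_nhdsGT_zero_forall_Ioc h
  have hg₀ := (hg p₀ hp₀).1
  refine ⟨c * g p₀, by positivity, fun p hp => ?_⟩
  rcases le_total p p₀ with hpp | hpp
  · refine le_trans ?_ (hle p ⟨hp.1, hpp⟩)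
    exact mul_le_mul_of_nonneg_right (mul_le_of_le_one_right hc.le (hg p₀ hp₀).2) (hg p hp).1.le
  · refine le_trans ?_ ((hle p₀ ⟨hp₀.1, le_rfl⟩).trans (hf hp₀ hp hpp))
    exact mul_le_of_le_one_right (by positivity) (hg p hp).2

lemma exists_forall_Ioo_le_mul (hg : MonotoneOn g (Set.Ioo 0 1))
    (hg0 : ∀ p ∈ Set.Ioo (0 : ℝ) 1, 0 < g p) {B : ℝ} (hB : 0 < B)
    (hfB : ∀ p ∈ Set.Ioo (0 : ℝ) 1, f p ≤ B) (h : ∀ᶠ p in 𝓝[>] 0, f p ≤ c * g p) :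
    ∃ C > 0, ∀ p ∈ Set.Ioo (0 : ℝ) 1, f p ≤ C * g p := by
  obtain ⟨p₀, hp₀, hle⟩ := eventually_nhdsGT_zero_forall_Ioc h
  have hg₀ := hg0 p₀ hp₀
  refine ⟨max c (B / g p₀), lt_max_of_lt_right (by positivity), fun p hp => ?_⟩
  have hgp := hg0 p hp
  rcases le_total p p₀ with hpp | hpp
  · exact (hle p ⟨hp.1, hpp⟩).trans (by gcongr; exact le_max_left _ _)
  · calc f p ≤ B / g p₀ * g p₀ := by rw [div_mul_cancel₀ _ hg₀.ne']; exact hfB p hp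
      _ ≤ max c (B / g p₀) * g p := by
        gcongr
        · exact le_max_right _ _
        · exact hg hp₀ hp hpp

end PowerComparison

/-! ### Radial potentials -/

/-- The logarithmic potential, on the circle of radius `r`, of a rotation invariant measure whose
modulus has the law `m`, normalized to vanish at the origin. -/
noncomputable def radialPotential (m : Measure ℝ) (r : ℝ) : ℝ := ∫ s, Real.posLog (r / s) ∂m

/-- The laws on the open half-line for which the radial potential is defined: those with an
integrable logarithm. They are the laws of the modulus under an admissible background. -/
structure IsRadialLaw (m : Measure ℝ) : Prop where
  isProbabilityMeasure : IsProbabilityMeasure m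
  Iic_zero : m (Set.Iic 0) = 0
  integrable_log : Integrable Real.log m

lemma measurable_posLog_div : Measurable (Function.uncurry fun r s : ℝ => Real.posLog (r / s)) :=
  Real.continuous_posLog.measurable.comp (measurable_fst.div measurable_snd)

lemma radialPotential_nonneg (m : Measure ℝ) (r : ℝ) : 0 ≤ radialPotential m r :=
  integral_nonneg fun _ => Real.posLog_nonneg

lemma measurable_radialPotential (m : Measure ℝ) [SFinite m] :
    Measurable (radialPotential m) :=
  measurable_posLog_div.stronglyMeasurable.integral_prod_right.measurable

namespace IsRadialLaw

variable {m : Measure ℝ} {r r' : ℝ}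

lemma ae_pos (hm : IsRadialLaw m) : ∀ᵐ s ∂m, 0 < s := by
  filter_upwards [compl_mem_ae_iff.mpr hm.Iic_zero] with s hs
  simpa using hs

lemma integrable_posLog (hm : IsRadialLaw m) (hr : 0 < r) :
    Integrable (fun s => Real.posLog (r / s)) m := by
  have := hm.isProbabilityMeasure
  have habs : Integrable (fun s => |Real.log r - Real.log s|) m :=
    ((integrable_const _).sub hm.integrable_log).abs
  refine habs.mono' measurable_posLog_div.of_uncurry_left.aestronglyMeasurable ?_
  filter_upwards [hm.ae_pos] with s hs
  rw [Real.norm_of_nonneg Real.posLog_nonneg, Real.posLog_apply, Real.log_div hr.ne' hs.ne']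
  exact max_le (abs_nonneg _) (le_abs_self _)

lemma radialPotential_mono (hm : IsRadialLaw m) (hr : 0 < r) (hrr : r ≤ r') :
    radialPotential m r ≤ radialPotential m r' := by
  refine integral_mono_ae (hm.integrable_posLog hr) (hm.integrable_posLog (hr.trans_le hrr)) ?_
  filter_upwards [hm.ae_pos] with s hs
  exact Real.posLog_le_posLog (by positivity) (by gcongr)

lemma log_le_radialPotential (hm : IsRadialLaw m) (hr : 0 < r) :
    Real.log r ≤ radialPotential m r + ∫ s, Real.log s ∂m := by
  have := hm.isProbabilityMeasure
  calc Real.log r = ∫ _, Real.log r ∂m := by simp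
    _ ≤ ∫ s, (Real.posLog (r / s) + Real.log s) ∂m := by
        refine integral_mono_ae (integrable_const _)
          ((hm.integrable_posLog hr).add hm.integrable_log) ?_
        filter_upwards [hm.ae_pos] with s hs
        have hle := le_max_right 0 (Real.log (r / s))
        rw [← Real.posLog_apply, Real.log_div hr.ne' hs.ne'] at hle
        linarith
    _ = radialPotential m r + ∫ s, Real.log s ∂m :=
        integral_add (hm.integrable_posLog hr) hm.integrable_log

lemma mul_exp_neg_radialPotential_le (hm : IsRadialLaw m) (hr : 0 < r) :
    r * Real.exp (-radialPotential m r) ≤ Real.exp (∫ s, Real.log s ∂m) := by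
  rw [← Real.exp_log hr, ← Real.exp_add, Real.exp_le_exp, Real.exp_log hr]
  linarith [hm.log_le_radialPotential hr]

lemma radialPotential_quantile (hm : IsRadialLaw m) {p : ℝ} (hp : p ∈ Set.Ioo (0 : ℝ) 1) :
    radialPotential m (quantile m p) / p
      = ∫ t in Set.Ioo (0 : ℝ) 1, Real.posLog (quantile m p / quantile m (p * t)) := by
  have := hm.isProbabilityMeasure
  set φ : ℝ → ℝ := fun q => Real.posLog (quantile m p / quantile m q)
  have hvanish : ∀ q ∈ Set.Ioo (0 : ℝ) 1 \ Set.Ioc 0 p, φ q = 0 := fun q ⟨hq, hqp⟩ => by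
    have hpq : p < q := lt_of_not_ge fun h => hqp ⟨hq.1, h⟩
    have hp0 := quantile_pos hm.Iic_zero hp
    have hq0 := quantile_pos hm.Iic_zero hq
    rw [Real.posLog_eq_zero_iff, abs_of_pos (by positivity), div_le_one hq0]
    exact monotoneOn_quantile m hp hq hpq.le
  have hpotential : radialPotential m (quantile m p) = ∫ q in (0 : ℝ)..p, φ q := by
    rw [radialPotential, integral_quantile m measurable_posLog_div.of_uncurry_left,
      intervalIntegral.integral_of_le hp.1.le]
    exact setIntegral_eq_of_subset_of_forall_sdiff_eq_zero measurableSet_Ioo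
      (fun q hq => ⟨hq.1, hq.2.trans_lt hp.2⟩) hvanish
  have hrescale : ∫ t in (0 : ℝ)..1, φ (p * t) = p⁻¹ * ∫ q in (0 : ℝ)..p, φ q := by
    simpa using intervalIntegral.integral_comp_mul_left (a := 0) (b := 1) φ hp.1.ne'
  rw [← integral_Ioc_eq_integral_Ioo, ← intervalIntegral.integral_of_le zero_le_one, hrescale,
    hpotential, div_eq_inv_mul]

end IsRadialLaw

section PosLogRatio

variable {Q : ℝ → ℝ} {b L p t : ℝ}

lemma aestronglyMeasurable_posLog_div_comp_mul (hQ : MonotoneOn Q (Set.Ioo 0 1))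
    (hp : p ∈ Set.Ioo (0 : ℝ) 1) :
    AEStronglyMeasurable (fun t => Real.posLog (Q p / Q (p * t)))
      (volume.restrict (Set.Ioo 0 1)) := by
  have hmem : ∀ t ∈ Set.Ioo (0 : ℝ) 1, p * t ∈ Set.Ioo (0 : ℝ) 1 := fun t ht =>
    ⟨mul_pos hp.1 ht.1, mul_lt_one_of_nonneg_of_lt_one_left hp.1.le hp.2 ht.2.le⟩
  have hmono : MonotoneOn (fun t => Q (p * t)) (Set.Ioo 0 1) := fun s hs t ht hst =>
    hQ (hmem s hs) (hmem t ht) (mul_le_mul_of_nonneg_left hst hp.1.le)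
  exact (Real.continuous_posLog.measurable.comp_aemeasurable (aemeasurable_const.div
    (aemeasurable_restrict_of_monotoneOn measurableSet_Ioo hmono))).aestronglyMeasurable

lemma posLog_div_comp_mul_le (hb : 0 < b) (hL : 0 < L) (hp : 0 < p) (ht : t ∈ Set.Ioo (0 : ℝ) 1)
    (hupper : Q p ≤ 2 * L * p ^ b) (hlower : L / 2 * (p * t) ^ b ≤ Q (p * t)) (hQp : 0 < Q p) :
    Real.posLog (Q p / Q (p * t)) ≤ Real.log 4 + b * |Real.log t| := by
  have ht0 := ht.1
  have hQpt : 0 < Q (p * t) := lt_of_lt_of_le (by positivity) hlower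
  have hratio : Q p / Q (p * t) ≤ 4 * t ^ (-b) := by
    rw [div_le_iff₀ hQpt]
    calc Q p ≤ 2 * L * p ^ b := hupper
      _ = 4 * t ^ (-b) * (L / 2 * (p * t) ^ b) := by
          rw [Real.mul_rpow hp.le ht0.le, Real.rpow_neg ht0.le]
          field_simp
          ring
      _ ≤ 4 * t ^ (-b) * Q (p * t) := by gcongr
  rw [Real.posLog_apply]
  refine max_le (add_nonneg (Real.log_nonneg (by norm_num)) (by positivity)) ?_
  calc Real.log (Q p / Q (p * t)) ≤ Real.log (4 * t ^ (-b)) :=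
        Real.log_le_log (by positivity) hratio
    _ = Real.log 4 + b * -Real.log t := by
        rw [Real.log_mul (by norm_num) (by positivity), Real.log_rpow ht0, neg_mul, mul_neg]
    _ ≤ Real.log 4 + b * |Real.log t| := by gcongr; exact neg_le_abs _

lemma tendsto_posLog_div_comp_mul (hb : 0 < b) (hL : 0 < L)
    (hQ : Tendsto (fun p => Q p / p ^ b) (𝓝[>] 0) (𝓝 L)) (ht : t ∈ Set.Ioo (0 : ℝ) 1) :
    Tendsto (fun p => Real.posLog (Q p / Q (p * t))) (𝓝[>] 0) (𝓝 (-b * Real.log t)) := by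
  have ht0 := ht.1
  have hone : 1 ≤ t ^ (-b) :=
    Real.one_le_rpow_of_pos_of_le_one_of_nonpos ht0 ht.2.le (neg_nonpos.mpr hb.le)
  have hlim : -b * Real.log t = Real.posLog (L / L * t ^ (-b)) := by
    rw [div_self hL.ne', one_mul, Real.posLog_eq_log (by rwa [abs_of_pos (by positivity)]),
      Real.log_rpow ht0]
  rw [hlim]
  refine (Real.continuous_posLog.tendsto _).comp ?_
  have hpt : Tendsto (fun p : ℝ => p * t) (𝓝[>] 0) (𝓝[>] 0) := by
    simpa [mul_comm t] using tendsto_const_mul_rpow_nhdsGT_zero ht0 one_pos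
  refine ((hQ.div (hQ.comp hpt) hL.ne').mul_const (t ^ (-b))).congr' ?_
  filter_upwards [self_mem_nhdsWithin] with p (hp : 0 < p)
  simp only [Function.comp_apply, Pi.div_apply]
  rw [Real.mul_rpow hp.le ht0.le, Real.rpow_neg ht0.le]
  field_simp

lemma integral_neg_mul_log_Ioo_zero_one (b : ℝ) :
    ∫ t in Set.Ioo (0 : ℝ) 1, -b * Real.log t = b := by
  rw [integral_const_mul, ← integral_Ioc_eq_integral_Ioo,
    ← intervalIntegral.integral_of_le zero_le_one, integral_log_from_zero_of_pos one_pos]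
  simp

/- The ratio tends to `t ^ (-b)`, and `∫₀¹ log (t ^ (-b)) = b`. -/
theorem tendsto_integral_posLog_div_comp_mul (hmono : MonotoneOn Q (Set.Ioo 0 1)) (hb : 0 < b)
    (hL : 0 < L) (hQ : Tendsto (fun p => Q p / p ^ b) (𝓝[>] 0) (𝓝 L)) :
    Tendsto (fun p => ∫ t in Set.Ioo (0 : ℝ) 1, Real.posLog (Q p / Q (p * t))) (𝓝[>] 0)
      (𝓝 b) := by
  have hpow : ∀ᶠ p : ℝ in 𝓝[>] 0, 0 < p ^ b :=
    eventually_mem_nhdsWithin.mono fun p hp => Real.rpow_pos_of_pos hp b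
  obtain ⟨p₀, hp₀, hbounds⟩ := eventually_nhdsGT_zero_forall_Ioc
    ((eventually_mul_le_of_tendsto_div hpow hQ (half_lt_self hL)).and
      (eventually_le_mul_of_tendsto_div hpow hQ (by linarith : L < 2 * L)))
  have hlog : IntegrableOn Real.log (Set.Ioo (0 : ℝ) 1) :=
    (intervalIntegral.intervalIntegrable_log' (a := 0) (b := 1)).1.mono_set
      Set.Ioo_subset_Ioc_self
  have hlim : 𝓝 b = 𝓝 (∫ t in Set.Ioo (0 : ℝ) 1, -b * Real.log t) := by
    rw [integral_neg_mul_log_Ioo_zero_one]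
  rw [hlim]
  refine tendsto_integral_filter_of_dominated_convergence
    (fun t => Real.log 4 + b * |Real.log t|) ?_ ?_
    ((integrable_const _).add (hlog.abs.const_mul _)) ?_
  · filter_upwards [Ioo_mem_nhdsGT one_pos] with p hp
    exact aestronglyMeasurable_posLog_div_comp_mul hmono hp
  · filter_upwards [Ioc_mem_nhdsGT hp₀.1] with p hp
    filter_upwards [ae_restrict_mem measurableSet_Ioo] with t ht
    have hp0 := hp.1
    obtain ⟨hlower, hupper⟩ := hbounds p hp
    have hpt := hbounds (p * t) ⟨mul_pos hp0 ht.1,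
      (mul_le_of_le_one_right hp0.le ht.2.le).trans hp.2⟩
    rw [Real.norm_of_nonneg Real.posLog_nonneg]
    exact posLog_div_comp_mul_le hb hL hp0 ht hupper hpt.1 (lt_of_lt_of_le (by positivity) hlower)
  · filter_upwards [ae_restrict_mem measurableSet_Ioo] with t ht
    exact tendsto_posLog_div_comp_mul hb hL hQ ht

end PosLogRatio

/-! ### Moments along a radial profile -/

/-- The properties, shared by the behaviours at the origin and at infinity, of the quantile
function `Q` of the modulus and of the potential `W` along it: they are comparable with
`p ^ (1 / α)` and with `p`. -/
structure IsRadialProfile (Q W : ℝ → ℝ) (α lam : ℝ) : Prop where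
  monotoneOn_quantile : MonotoneOn Q (Set.Ioo 0 1)
  monotoneOn_potential : MonotoneOn W (Set.Ioo 0 1)
  tendsto_quantile : Tendsto (fun p => Q p / p ^ (1 / α)) (𝓝[>] 0) (𝓝 (lam ^ (-(1 / α))))
  tendsto_potential : Tendsto (fun p => W p / p) (𝓝[>] 0) (𝓝 (1 / α))
  quantile_lower : ∃ c > 0, ∀ p ∈ Set.Ioo (0 : ℝ) 1, c * p ^ (1 / α) ≤ Q p
  potential_lower : ∃ c > 0, ∀ p ∈ Set.Ioo (0 : ℝ) 1, c * p ≤ W p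
  upper : ∃ C > 0, ∀ p ∈ Set.Ioo (0 : ℝ) 1, Q p * Real.exp (-W p) ≤ C * p ^ (1 / α)

/-- The squared norm of the monomial of degree `k` in the Hilbert space with weight
`exp (-2 n V)`, for a law `m` of the modulus with potential `V`. -/
noncomputable def radialMoment (m : Measure ℝ) (k n : ℕ) : ℝ :=
  ∫ r, r ^ (2 * k) * Real.exp (-2 * (n : ℝ) * radialPotential m r) ∂m

/-- The moment `radialMoment`, written in terms of the quantile function `Q` of the law and of
the potential `W = V ∘ Q`. -/
noncomputable def profileMoment (Q W : ℝ → ℝ) (k n : ℕ) : ℝ :=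
  ∫ p in Set.Ioo (0 : ℝ) 1, Q p ^ (2 * k) * Real.exp (-2 * (n : ℝ) * W p)

lemma radialMoment_eq_profileMoment (m : Measure ℝ) [IsProbabilityMeasure m] (k n : ℕ) :
    radialMoment m k n
      = profileMoment (quantile m) (fun p => radialPotential m (quantile m p)) k n := by
  have := measurable_radialPotential m
  exact integral_quantile m (by fun_prop)

theorem IsRadialLaw.isRadialProfile {m : Measure ℝ} (hm : IsRadialLaw m) {α lam : ℝ}
    (hα : 0 < α) (hlam : 0 < lam)
    (hF : Tendsto (fun r : ℝ => cdf m r / r ^ α) (𝓝[>] 0) (𝓝 lam)) :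
    IsRadialProfile (quantile m) (fun p => radialPotential m (quantile m p)) α lam := by
  have := hm.isProbabilityMeasure
  have hα' : 0 < 1 / α := by positivity
  have hL : 0 < lam ^ (-(1 / α)) := by positivity
  have hpos : ∀ p ∈ Set.Ioo (0 : ℝ) 1, 0 < quantile m p := fun p => quantile_pos hm.Iic_zero
  have hQmono := monotoneOn_quantile m
  have hWmono : MonotoneOn (fun p => radialPotential m (quantile m p)) (Set.Ioo 0 1) :=
    fun p hp q hq hpq => hm.radialPotential_mono (hpos p hp) (hQmono hp hq hpq)
  have hQ := tendsto_quantile_div_rpow m hm.Iic_zero hα hlam hF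
  have hW : Tendsto (fun p => radialPotential m (quantile m p) / p) (𝓝[>] 0) (𝓝 (1 / α)) := by
    refine (tendsto_integral_posLog_div_comp_mul hQmono hα' hL hQ).congr' ?_
    filter_upwards [Ioo_mem_nhdsGT one_pos] with p hp
    exact (hm.radialPotential_quantile hp).symm
  have hid : ∀ᶠ p : ℝ in 𝓝[>] 0, 0 < p := self_mem_nhdsWithin
  have hpow : ∀ᶠ p : ℝ in 𝓝[>] 0, 0 < p ^ (1 / α) :=
    hid.mono fun p hp => Real.rpow_pos_of_pos hp _
  refine ⟨hQmono, hWmono, hQ, hW, ?_, ?_, ?_⟩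
  · exact exists_forall_Ioo_mul_le hQmono (fun p hp =>
      ⟨Real.rpow_pos_of_pos hp.1 _, Real.rpow_le_one hp.1.le hp.2.le hα'.le⟩) (half_pos hL)
      (eventually_mul_le_of_tendsto_div hpow hQ (half_lt_self hL))
  · exact exists_forall_Ioo_mul_le hWmono (fun p hp => ⟨hp.1, hp.2.le⟩) (half_pos hα')
      (eventually_mul_le_of_tendsto_div hid hW (half_lt_self hα'))
  · refine exists_forall_Ioo_le_mul (c := lam ^ (-(1 / α)) + 1)
      (fun p hp q _ hpq => Real.rpow_le_rpow hp.1.le hpq hα'.le)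
      (fun p hp => Real.rpow_pos_of_pos hp.1 _) (Real.exp_pos (∫ s, Real.log s ∂m))
      (fun p hp => hm.mul_exp_neg_radialPotential_le (hpos p hp)) ?_
    filter_upwards [Ioo_mem_nhdsGT one_pos,
      eventually_le_mul_of_tendsto_div hpow hQ (lt_add_one _)] with p hp hle
    refine (mul_le_of_le_one_right (hpos p hp).le ?_).trans hle
    exact Real.exp_le_one_iff.mpr (neg_nonpos.mpr (radialPotential_nonneg m _))
namespace IsRadialProfile

variable {Q W : ℝ → ℝ} {α lam : ℝ}

lemma quantile_pos (h : IsRadialProfile Q W α lam) {p : ℝ} (hp : p ∈ Set.Ioo (0 : ℝ) 1) :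
    0 < Q p := by
  obtain ⟨c, hc, hle⟩ := h.quantile_lower
  exact lt_of_lt_of_le (mul_pos hc (Real.rpow_pos_of_pos hp.1 _)) (hle p hp)

lemma aemeasurable_integrand (h : IsRadialProfile Q W α lam) (k n : ℕ) :
    AEMeasurable (fun p => Q p ^ (2 * k) * Real.exp (-2 * (n : ℝ) * W p))
      (volume.restrict (Set.Ioo 0 1)) := by
  have hQ := aemeasurable_restrict_of_monotoneOn (μ := volume) measurableSet_Ioo
    h.monotoneOn_quantile
  have hW := aemeasurable_restrict_of_monotoneOn (μ := volume) measurableSet_Ioo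
    h.monotoneOn_potential
  fun_prop

/- `Q ^ (2k) e ^ (-2nW) = (Q e ^ (-W)) ^ (2k) e ^ (-2(n-k)W)`, where both factors are controlled
on all of `(0, 1)`. -/
lemma exists_integrand_le (h : IsRadialProfile Q W α lam) :
    ∃ c > 0, ∃ C > 0, ∀ k n : ℕ, k ≤ n → ∀ p ∈ Set.Ioo (0 : ℝ) 1,
      Q p ^ (2 * k) * Real.exp (-2 * (n : ℝ) * W p)
        ≤ (C * p ^ (1 / α)) ^ (2 * k) * Real.exp (-2 * c * (n - k) * p) := by
  obtain ⟨c, hc, hlower⟩ := h.potential_lower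
  obtain ⟨C, hC, hupper⟩ := h.upper
  refine ⟨c, hc, C, hC, fun k n hkn p hp => ?_⟩
  have hkn' : (0 : ℝ) ≤ n - k := sub_nonneg.mpr (by exact_mod_cast hkn)
  have hQ := h.quantile_pos hp
  have hp0 := hp.1
  calc Q p ^ (2 * k) * Real.exp (-2 * (n : ℝ) * W p)
      = (Q p * Real.exp (-W p)) ^ (2 * k) * Real.exp (-2 * ((n : ℝ) - k) * W p) := by
        rw [mul_pow, ← Real.exp_nat_mul, mul_assoc (Q p ^ (2 * k)), ← Real.exp_add]
        congr 2
        push_cast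
        ring
    _ ≤ (C * p ^ (1 / α)) ^ (2 * k) * Real.exp (-2 * c * (n - k) * p) := by
        refine mul_le_mul (pow_le_pow_left₀ (by positivity) (hupper p hp) _)
          (Real.exp_le_exp.mpr ?_) (Real.exp_pos _).le (by positivity)
        linarith [mul_le_mul_of_nonneg_left (hlower p hp) hkn']

lemma integrableOn_integrand (h : IsRadialProfile Q W α lam) (hα : 0 < α) {k n : ℕ}
    (hkn : k ≤ n) :
    IntegrableOn (fun p => Q p ^ (2 * k) * Real.exp (-2 * (n : ℝ) * W p)) (Set.Ioo 0 1) := by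
  obtain ⟨c, hc, C, hC, hle⟩ := h.exists_integrand_le
  refine Integrable.mono' (g := fun _ => C ^ (2 * k)) (integrable_const _)
    (h.aemeasurable_integrand k n).aestronglyMeasurable ?_
  filter_upwards [ae_restrict_mem measurableSet_Ioo] with p hp
  have hkn' : (0 : ℝ) ≤ n - k := sub_nonneg.mpr (by exact_mod_cast hkn)
  have hp0 := hp.1
  have hexp : Real.exp (-2 * c * (n - k) * p) ≤ 1 := by
    rw [Real.exp_le_one_iff]
    linarith [show 0 ≤ c * (n - k) * p by positivity]
  have hpow : C * p ^ (1 / α) ≤ C :=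
    mul_le_of_le_one_right hC.le (Real.rpow_le_one hp0.le hp.2.le (by positivity))
  rw [Real.norm_of_nonneg (mul_nonneg (pow_nonneg (h.quantile_pos hp).le _) (Real.exp_pos _).le)]
  calc Q p ^ (2 * k) * Real.exp (-2 * (n : ℝ) * W p)
      ≤ (C * p ^ (1 / α)) ^ (2 * k) * Real.exp (-2 * c * (n - k) * p) := hle k n hkn p hp
    _ ≤ (C * p ^ (1 / α)) ^ (2 * k) * 1 := by gcongr
    _ ≤ C ^ (2 * k) := by rw [mul_one]; gcongr

lemma profileMoment_pos (h : IsRadialProfile Q W α lam) (hα : 0 < α) {k n : ℕ} (hkn : k ≤ n) :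
    0 < profileMoment Q W k n := by
  have hpos : ∀ p ∈ Set.Ioo (0 : ℝ) 1, 0 < Q p ^ (2 * k) * Real.exp (-2 * (n : ℝ) * W p) :=
    fun p hp => mul_pos (pow_pos (h.quantile_pos hp) _) (Real.exp_pos _)
  refine (setIntegral_pos_iff_support_of_nonneg_ae
    (ae_restrict_of_forall_mem measurableSet_Ioo fun p hp => (hpos p hp).le)
    (h.integrableOn_integrand hα hkn)).mpr ?_
  have hsub : Set.Ioo (0 : ℝ) 1 ⊆ Function.support
      (fun p => Q p ^ (2 * k) * Real.exp (-2 * (n : ℝ) * W p)) ∩ Set.Ioo 0 1 :=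
    fun p hp => ⟨(hpos p hp).ne', hp⟩
  exact lt_of_lt_of_le (by simp) (measure_mono hsub)

end IsRadialProfile

lemma rpow_one_div_pow {x : ℝ} (hx : 0 ≤ x) (α : ℝ) (k : ℕ) :
    (x ^ (1 / α)) ^ (2 * k) = x ^ (2 * (k : ℝ) / α) := by
  rw [← Real.rpow_natCast, ← Real.rpow_mul hx]
  congr 1
  push_cast
  ring

/-- The limit of the moments `profileMoment Q W k n` rescaled by `n ^ (1 + 2 k / α)`: the moment
obtained by replacing `Q` and `W` with their equivalents at `0`. -/
noncomputable def momentLimit (α lam : ℝ) (k : ℕ) : ℝ :=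
  α / 2 * (Real.Gamma (1 + 2 * (k : ℝ) / α) / ((2 * lam / α) ^ (2 * (k : ℝ) / α)))

lemma integral_Ioi_eq_momentLimit {α lam : ℝ} (hα : 0 < α) (hlam : 0 < lam) (k : ℕ) :
    ∫ q in Set.Ioi (0 : ℝ), (lam ^ (-(1 / α)) * q ^ (1 / α)) ^ (2 * k) * Real.exp (-(2 / α * q))
      = momentLimit α lam k := by
  have hgamma : ∀ q ∈ Set.Ioi (0 : ℝ),
      (lam ^ (-(1 / α)) * q ^ (1 / α)) ^ (2 * k) * Real.exp (-(2 / α * q))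
      = (lam ^ (2 * (k : ℝ) / α))⁻¹ *
        (q ^ ((1 + 2 * (k : ℝ) / α) - 1) * Real.exp (-(2 / α * q))) := by
    intro q hq
    rw [mul_pow, rpow_one_div_pow (le_of_lt hq), Real.rpow_neg hlam.le, inv_pow,
      rpow_one_div_pow hlam.le, add_sub_cancel_left, mul_assoc]
  rw [setIntegral_congr_fun measurableSet_Ioi hgamma, integral_const_mul,
    Real.integral_rpow_mul_exp_neg_mul_Ioi (by positivity) (by positivity), momentLimit,
    one_div_div, Real.rpow_add (by positivity), Real.rpow_one, Real.div_rpow (by positivity)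
    (by positivity), Real.div_rpow (by positivity) (by positivity),
    Real.mul_rpow (by positivity) (by positivity)]
  field_simp

/-- The integrand of `profileMoment Q W k n` after the substitution `p = q / n`, including the
factor `n ^ (2 k / α)`. -/
noncomputable def rescaledIntegrand (Q W : ℝ → ℝ) (α : ℝ) (k n : ℕ) : ℝ → ℝ :=
  (Set.Ioo (0 : ℝ) n).indicator fun q =>
    ((n : ℝ) ^ (1 / α) * Q (q / n)) ^ (2 * k) * Real.exp (-2 * (n : ℝ) * W (q / n))

lemma integral_rescaledIntegrand (Q W : ℝ → ℝ) (α : ℝ) (k : ℕ) {n : ℕ} (hn : n ≠ 0) :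
    ∫ q in Set.Ioi (0 : ℝ), rescaledIntegrand Q W α k n q
      = (n : ℝ) ^ (1 + 2 * (k : ℝ) / α) * profileMoment Q W k n := by
  have hn' : (0 : ℝ) < n := by positivity
  have hfactor : ∀ q : ℝ,
      ((n : ℝ) ^ (1 / α) * Q (q / n)) ^ (2 * k) * Real.exp (-2 * (n : ℝ) * W (q / n))
        = (n : ℝ) ^ (2 * (k : ℝ) / α) *
          (Q (q / n) ^ (2 * k) * Real.exp (-2 * (n : ℝ) * W (q / n))) := fun q => by
    rw [mul_pow, rpow_one_div_pow hn'.le, mul_assoc]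
  simp only [rescaledIntegrand, hfactor]
  rw [setIntegral_indicator measurableSet_Ioo,
    Set.inter_eq_right.mpr (Set.Ioo_subset_Ioi_self (a := (n : ℝ)) (b := 0)), integral_const_mul,
    ← integral_Ioc_eq_integral_Ioo, ← intervalIntegral.integral_of_le hn'.le,
    intervalIntegral.integral_comp_div
      (fun p => Q p ^ (2 * k) * Real.exp (-2 * (n : ℝ) * W p)) hn'.ne',
    zero_div, div_self hn'.ne', smul_eq_mul, intervalIntegral.integral_of_le zero_le_one,
    integral_Ioc_eq_integral_Ioo, Real.rpow_add hn', Real.rpow_one, profileMoment]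
  ring

namespace IsRadialProfile

variable {Q W : ℝ → ℝ} {α lam : ℝ}

lemma aestronglyMeasurable_rescaledIntegrand (h : IsRadialProfile Q W α lam) (k : ℕ) {n : ℕ}
    (hn : n ≠ 0) : AEStronglyMeasurable (rescaledIntegrand Q W α k n) volume := by
  have hn' : (0 : ℝ) < n := by positivity
  have hmaps : ∀ q ∈ Set.Ioo (0 : ℝ) n, q / n ∈ Set.Ioo (0 : ℝ) 1 := fun q hq =>
    ⟨div_pos hq.1 hn', (div_lt_one hn').mpr hq.2⟩
  have hQ : AEMeasurable (fun q => Q (q / n)) (volume.restrict (Set.Ioo 0 (n : ℝ))) :=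
    aemeasurable_restrict_of_monotoneOn measurableSet_Ioo fun q hq r hr hqr =>
      h.monotoneOn_quantile (hmaps q hq) (hmaps r hr) (by gcongr)
  have hW : AEMeasurable (fun q => W (q / n)) (volume.restrict (Set.Ioo 0 (n : ℝ))) :=
    aemeasurable_restrict_of_monotoneOn measurableSet_Ioo fun q hq r hr hqr =>
      h.monotoneOn_potential (hmaps q hq) (hmaps r hr) (by gcongr)
  refine AEMeasurable.aestronglyMeasurable ((aemeasurable_indicator_iff measurableSet_Ioo).mpr ?_)
  exact ((hQ.const_mul _).pow_const _).mul (Real.measurable_exp.comp_aemeasurable (hW.const_mul _))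

lemma exists_rescaledIntegrand_le (h : IsRadialProfile Q W α lam) :
    ∃ c > 0, ∃ C > 0, ∀ k n : ℕ, 2 * k + 1 ≤ n → ∀ q > 0, ‖rescaledIntegrand Q W α k n q‖
      ≤ C ^ (2 * k) * (q ^ (2 * (k : ℝ) / α) * Real.exp (-(2 * c / (2 * k + 1)) * q)) := by
  obtain ⟨c, hc, C, hC, hle⟩ := h.exists_integrand_le
  refine ⟨c, hc, C, hC, fun k n hkn q hq0 => ?_⟩
  have hn' : (0 : ℝ) < n := by exact_mod_cast (show 0 < n by omega)
  by_cases hq : q ∈ Set.Ioo (0 : ℝ) n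
  swap
  · rw [rescaledIntegrand, Set.indicator_of_notMem hq, norm_zero]
    positivity
  have hp : q / n ∈ Set.Ioo (0 : ℝ) 1 := ⟨div_pos hq.1 hn', (div_lt_one hn').mpr hq.2⟩
  have hQ := h.quantile_pos hp
  have hratio : 1 / (2 * (k : ℝ) + 1) ≤ (n - k) / n := by
    have hkn' : (2 * k + 1 : ℝ) ≤ n := by exact_mod_cast hkn
    rw [div_le_div_iff₀ (by positivity) hn']
    nlinarith [(Nat.cast_nonneg k : (0 : ℝ) ≤ k)]
  have hexp : -2 * c * (n - k) * (q / n) ≤ -(2 * c / (2 * k + 1)) * q := by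
    have := mul_le_mul_of_nonneg_left hratio (show 0 ≤ 2 * c * q by positivity)
    calc -2 * c * (n - k) * (q / n) = -(2 * c * q * ((n - k) / n)) := by ring
      _ ≤ -(2 * c * q * (1 / (2 * (k : ℝ) + 1))) := neg_le_neg this
      _ = -(2 * c / (2 * k + 1)) * q := by ring
  rw [rescaledIntegrand, Set.indicator_of_mem hq, Real.norm_of_nonneg (by positivity), mul_pow,
    mul_assoc]
  calc ((n : ℝ) ^ (1 / α)) ^ (2 * k) *
        (Q (q / n) ^ (2 * k) * Real.exp (-2 * (n : ℝ) * W (q / n)))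
      ≤ ((n : ℝ) ^ (1 / α)) ^ (2 * k) * ((C * (q / n) ^ (1 / α)) ^ (2 * k) *
          Real.exp (-2 * c * (n - k) * (q / n))) := by
        gcongr ?_ * ?_
        exact hle k n (by omega) _ hp
    _ = C ^ (2 * k) * (q ^ (2 * (k : ℝ) / α) * Real.exp (-2 * c * (n - k) * (q / n))) := by
        rw [Real.div_rpow hq0.le hn'.le, mul_pow, div_pow, rpow_one_div_pow hn'.le,
          rpow_one_div_pow hq0.le]
        field_simp
    _ ≤ C ^ (2 * k) * (q ^ (2 * (k : ℝ) / α) * Real.exp (-(2 * c / (2 * k + 1)) * q)) := by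
        gcongr

lemma tendsto_rescaledIntegrand (h : IsRadialProfile Q W α lam) (k : ℕ) {q : ℝ} (hq : 0 < q) :
    Tendsto (fun n => rescaledIntegrand Q W α k n q) atTop
      (𝓝 ((lam ^ (-(1 / α)) * q ^ (1 / α)) ^ (2 * k) * Real.exp (-(2 / α * q)))) := by
  have hdiv : Tendsto (fun n : ℕ => q / (n : ℝ)) atTop (𝓝[>] 0) := by
    refine tendsto_nhdsWithin_iff.mpr ⟨tendsto_const_div_atTop_nhds_zero_nat q, ?_⟩
    filter_upwards [eventually_gt_atTop 0] with n hn
    exact div_pos hq (by exact_mod_cast hn)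
  have hlim := (((h.tendsto_quantile.comp hdiv).mul_const (q ^ (1 / α))).pow (2 * k)).mul
    ((Real.continuous_exp.tendsto _).comp ((h.tendsto_potential.comp hdiv).const_mul (-2 * q)))
  rw [show -2 * q * (1 / α) = -(2 / α * q) by ring] at hlim
  refine hlim.congr' ?_
  filter_upwards [eventually_gt_atTop 0,
    tendsto_natCast_atTop_atTop.eventually_gt_atTop q] with n hn hnq
  have hn' : (0 : ℝ) < n := by exact_mod_cast hn
  rw [rescaledIntegrand, Set.indicator_of_mem (show q ∈ Set.Ioo (0 : ℝ) n from ⟨hq, hnq⟩)]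
  simp only [Function.comp_apply]
  rw [Real.div_rpow hq.le hn'.le]
  congr 2 <;> field_simp

theorem tendsto_profileMoment (h : IsRadialProfile Q W α lam) (hα : 0 < α) (hlam : 0 < lam)
    (k : ℕ) :
    Tendsto (fun n : ℕ => (n : ℝ) ^ (1 + 2 * (k : ℝ) / α) * profileMoment Q W k n) atTop
      (𝓝 (momentLimit α lam k)) := by
  obtain ⟨c, hc, C, -, hle⟩ := h.exists_rescaledIntegrand_le
  have hdom : IntegrableOn (fun q : ℝ => C ^ (2 * k) *
      (q ^ (2 * (k : ℝ) / α) * Real.exp (-(2 * c / (2 * k + 1)) * q))) (Set.Ioi 0) := by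
    simpa only [IntegrableOn, Real.rpow_one] using (integrableOn_rpow_mul_exp_neg_mul_rpow
      (neg_one_lt_zero.trans_le (by positivity : (0 : ℝ) ≤ 2 * (k : ℝ) / α)) one_pos
      (by positivity : 0 < 2 * c / (2 * (k : ℝ) + 1))).const_mul (C ^ (2 * k))
  have hlim : Tendsto (fun n : ℕ => ∫ q in Set.Ioi (0 : ℝ), rescaledIntegrand Q W α k n q) atTop
      (𝓝 (momentLimit α lam k)) := by
    rw [← integral_Ioi_eq_momentLimit hα hlam]
    refine tendsto_integral_filter_of_dominated_convergence _ ?_ ?_ hdom ?_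
    · filter_upwards [eventually_ne_atTop 0] with n hn
      exact (h.aestronglyMeasurable_rescaledIntegrand k hn).restrict
    · filter_upwards [eventually_ge_atTop (2 * k + 1)] with n hn
      exact ae_restrict_of_forall_mem measurableSet_Ioi fun q => hle k n hn q
    · exact ae_restrict_of_forall_mem measurableSet_Ioi fun q => h.tendsto_rescaledIntegrand k
  refine hlim.congr' ?_
  filter_upwards [eventually_ne_atTop 0] with n hn
  exact integral_rescaledIntegrand Q W α k hn

lemma sub_mul_le_profileMoment (h : IsRadialProfile Q W α lam) (hα : 0 < α) {k n : ℕ}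
    (hkn : k ≤ n) {a b v : ℝ} (hab : a ≤ b) (hsub : Set.Ioo a b ⊆ Set.Ioo 0 1)
    (hv : ∀ p ∈ Set.Ioo a b, v ≤ Q p ^ (2 * k) * Real.exp (-2 * (n : ℝ) * W p)) :
    (b - a) * v ≤ profileMoment Q W k n := by
  have hint := h.integrableOn_integrand hα hkn
  calc (b - a) * v = ∫ _ in Set.Ioo a b, v := by
        rw [setIntegral_const, Real.volume_real_Ioo_of_le hab, smul_eq_mul]
    _ ≤ ∫ p in Set.Ioo a b, Q p ^ (2 * k) * Real.exp (-2 * (n : ℝ) * W p) :=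
        setIntegral_mono_on (integrableOn_const (by simp)) (hint.mono_set hsub)
          measurableSet_Ioo hv
    _ ≤ profileMoment Q W k n := setIntegral_mono_set hint
        (ae_restrict_of_forall_mem measurableSet_Ioo fun p hp =>
          mul_nonneg (pow_nonneg (h.quantile_pos hp).le _) (Real.exp_pos _).le)
        hsub.eventuallyLE

lemma le_integrand_of_mem_Ioo (h : IsRadialProfile Q W α lam) (hα : 0 < α) {c C A p : ℝ}
    (hc : 0 < c) (hC : 0 < C) (hA : 0 < A) {k n : ℕ} (hn : n ≠ 0) (hp01 : p ∈ Set.Ioo (0 : ℝ) 1)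
    (hp : p ∈ Set.Ioo (A / n) (2 * A / n)) (hQ : c * p ^ (1 / α) ≤ Q p) (hW : W p ≤ C * p) :
    (c * A ^ (1 / α) / (n : ℝ) ^ (1 / α)) ^ (2 * k) * Real.exp (-4 * A * C)
      ≤ Q p ^ (2 * k) * Real.exp (-2 * (n : ℝ) * W p) := by
  have hn' : (0 : ℝ) < n := by positivity
  have hQp : c * A ^ (1 / α) / (n : ℝ) ^ (1 / α) ≤ Q p := by
    refine le_trans ?_ hQ
    rw [mul_div_assoc, ← Real.div_rpow hA.le hn'.le]
    gcongr
    exact hp.1.le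
  have hWp : n * W p ≤ 2 * A * C := by
    calc n * W p ≤ n * (C * p) := by gcongr
      _ = C * (p * n) := by ring
      _ ≤ C * (2 * A) := by
          gcongr ?_ * ?_
          exact ((lt_div_iff₀ hn').mp hp.2).le
      _ = 2 * A * C := mul_comm _ _
  exact mul_le_mul (pow_le_pow_left₀ (by positivity) hQp _)
    (Real.exp_le_exp.mpr (by linarith)) (Real.exp_pos _).le
    (pow_nonneg (h.quantile_pos hp01).le _)

/- Only `p` of order `A / n` is used, where `A` is such that `n ^ (1 / α) Q (A / n) ≥ R`. -/
theorem exists_profileMoment_ge (h : IsRadialProfile Q W α lam) (hα : 0 < α) {R : ℝ}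
    (hR : 0 < R) :
    ∃ δ > 0, ∀ᶠ n : ℕ in atTop, ∀ k ≤ n,
      δ * R ^ (2 * k) ≤ (n : ℝ) ^ (1 + 2 * (k : ℝ) / α) * profileMoment Q W k n := by
  obtain ⟨c, hc, hQ⟩ := h.quantile_lower
  obtain ⟨p₀, hp₀, hW⟩ := eventually_nhdsGT_zero_forall_Ioc
    (eventually_le_mul_of_tendsto_div self_mem_nhdsWithin h.tendsto_potential (lt_add_one _))
  obtain ⟨A, hA, hcA⟩ : ∃ A > 0, c * A ^ (1 / α) = R := by
    refine ⟨(R / c) ^ α, by positivity, ?_⟩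
    rw [← Real.rpow_mul (by positivity), mul_one_div_cancel hα.ne', Real.rpow_one]
    field_simp
  refine ⟨A * Real.exp (-4 * A * (1 / α + 1)), by positivity, ?_⟩
  filter_upwards [(tendsto_const_div_atTop_nhds_zero_nat (2 * A)).eventually_lt_const hp₀.1,
    eventually_ne_atTop 0] with n hn hn0 k hkn
  have hn' : (0 : ℝ) < n := by positivity
  have hsub : Set.Ioo (A / n) (2 * A / n) ⊆ Set.Ioo (0 : ℝ) p₀ :=
    Set.Ioo_subset_Ioo (by positivity) hn.le
  have hsub' := hsub.trans (Set.Ioo_subset_Ioo_right hp₀.2.le)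
  have hge := h.sub_mul_le_profileMoment hα hkn (by gcongr; linarith) hsub' fun p hp =>
    h.le_integrand_of_mem_Ioo hα hc (by positivity) hA hn0 (hsub' hp) hp (hQ p (hsub' hp))
      (hW p (Set.Ioo_subset_Ioc_self (hsub hp)))
  refine le_trans (le_of_eq ?_) (mul_le_mul_of_nonneg_left hge (by positivity))
  rw [hcA, Real.rpow_add hn', Real.rpow_one, div_pow, rpow_one_div_pow hn'.le]
  field_simp
  ring

end IsRadialProfile

/-! ### The potential of a rotationally invariant measure -/

lemma log_add_posLog_inv_mul {r s : ℝ} (hr : r ≠ 0) (hs : s ≠ 0) :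
    Real.log r + Real.posLog (r⁻¹ * s) = Real.log s + Real.posLog (r / s) := by
  have h := Real.posLog_sub_posLog_inv (x := r / s)
  rw [inv_div, Real.log_div hr hs] at h
  rw [inv_mul_eq_div]
  linarith

lemma abs_log_eq_two_mul_posLog_sub_log (x : ℝ) :
    |Real.log x| = 2 * Real.posLog x - Real.log x := by
  rw [← Real.half_mul_log_add_log_abs]
  ring

lemma integral_log_norm_circleMap_sub {r : ℝ} (hr : r ≠ 0) (w : ℂ) :
    ∫ θ in Set.Ioc 0 (2 * Real.pi), Real.log ‖circleMap 0 r θ - w‖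
      = 2 * Real.pi * (Real.log r + Real.posLog (r⁻¹ * ‖w‖)) := by
  have h := circleAverage_log_norm_sub_const_eq_log_radius_add_posLog (c := 0) (a := w) hr
  rw [Real.circleAverage_def, smul_eq_mul, zero_sub, norm_neg,
    intervalIntegral.integral_of_le Real.two_pi_pos.le] at h
  rw [← h]
  field_simp

/- Since `|log x| = 2 log⁺ x - log x`, the integral of `|log|` is bounded by means of the explicit
value of the integral of `log`. -/
lemma integral_norm_log_norm_circleMap_sub_le {r : ℝ} (hr : 0 < r) (w : ℂ) :
    ∫ θ in Set.Ioc 0 (2 * Real.pi), ‖Real.log ‖circleMap 0 r θ - w‖‖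
      ≤ 4 * Real.pi * (Real.log 2 + Real.posLog r + Real.posLog ‖w‖)
        + 2 * Real.pi * |Real.log r| := by
  have hint : IntegrableOn (fun θ : ℝ => Real.log ‖circleMap 0 r θ - w‖)
      (Set.Ioc 0 (2 * Real.pi)) := (circleIntegrable_log_norm_sub_const r).1
  set B := 2 * (Real.log 2 + Real.posLog r + Real.posLog ‖w‖) with hB
  have hptw : ∀ θ : ℝ, ‖Real.log ‖circleMap 0 r θ - w‖‖
      ≤ B - Real.log ‖circleMap 0 r θ - w‖ := fun θ => by
    have hnorm : ‖circleMap 0 r θ - w‖ ≤ r + ‖w‖ := by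
      simpa only [norm_circleMap_zero, abs_of_pos hr] using norm_sub_le (circleMap 0 r θ) w
    rw [Real.norm_eq_abs, abs_log_eq_two_mul_posLog_sub_log]
    linarith [(Real.posLog_le_posLog (norm_nonneg _) hnorm).trans Real.posLog_add]
  calc ∫ θ in Set.Ioc 0 (2 * Real.pi), ‖Real.log ‖circleMap 0 r θ - w‖‖
      ≤ ∫ θ in Set.Ioc 0 (2 * Real.pi), (B - Real.log ‖circleMap 0 r θ - w‖) :=
        integral_mono hint.norm ((integrable_const _).sub hint) hptw
    _ = 2 * Real.pi * (B - Real.log r - Real.posLog (r⁻¹ * ‖w‖)) := by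
        rw [integral_sub (integrable_const _) hint, integral_log_norm_circleMap_sub hr.ne',
          setIntegral_const, Real.volume_real_Ioc_of_le Real.two_pi_pos.le, smul_eq_mul]
        ring
    _ ≤ 2 * Real.pi * (B + |Real.log r|) := by
        gcongr
        linarith [neg_abs_le (Real.log r), Real.posLog_nonneg (x := r⁻¹ * ‖w‖)]
    _ = 4 * Real.pi * (Real.log 2 + Real.posLog r + Real.posLog ‖w‖)
        + 2 * Real.pi * |Real.log r| := by rw [hB]; ring

/-- The law of the modulus of a point with law `ν`. -/
noncomputable def modulusLaw (ν : Measure ℂ) : Measure ℝ := ν.map fun z => ‖z‖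

instance (ν : Measure ℂ) [IsProbabilityMeasure ν] : IsProbabilityMeasure (modulusLaw ν) :=
  Measure.isProbabilityMeasure_map (by fun_prop)

lemma integral_modulusLaw (ν : Measure ℂ) {g : ℝ → ℝ} (hg : Measurable g) :
    ∫ r, g r ∂(modulusLaw ν) = ∫ z, g ‖z‖ ∂ν :=
  integral_map (by fun_prop) hg.aestronglyMeasurable

namespace IsAdmissibleBackground

variable {ν : Measure ℂ}

lemma ae_ne_zero (hν : IsAdmissibleBackground ν) : ∀ᵐ w ∂ν, w ≠ 0 :=
  compl_mem_ae_iff.mpr hν.no_atom_zero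

lemma logPotential_mul (hν : IsAdmissibleBackground ν) {c : ℂ} (hc : ‖c‖ = 1) (z : ℂ) :
    logPotential ν (c * z) = logPotential ν z := by
  have hmeas : Measurable fun w : ℂ => Real.log ‖c * z - w‖ := by fun_prop
  rw [logPotential, logPotential]
  conv_lhs => rw [← hν.rotation_invariant c hc]
  rw [integral_map (by fun_prop) hmeas.aestronglyMeasurable]
  simp_rw [← mul_sub, norm_mul, hc, one_mul]

variable [IsProbabilityMeasure ν]

lemma integrable_log_norm_circleMap_sub (hν : IsAdmissibleBackground ν) {r : ℝ} (hr : 0 < r) :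
    Integrable (Function.uncurry fun (θ : ℝ) (w : ℂ) => Real.log ‖circleMap 0 r θ - w‖)
      ((volume.restrict (Set.Ioc 0 (2 * Real.pi))).prod ν) := by
  have hmeas : Measurable (Function.uncurry fun (θ : ℝ) (w : ℂ) =>
      Real.log ‖circleMap 0 r θ - w‖) :=
    Real.measurable_log.comp
      (((continuous_circleMap 0 r).measurable.comp measurable_fst).sub measurable_snd).norm
  have hposlog : Integrable (fun w : ℂ => Real.posLog ‖w‖) ν := by
    refine hν.integrable_log.abs.mono'
      (Real.continuous_posLog.measurable.comp measurable_norm).aestronglyMeasurable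
      (ae_of_all _ fun w => ?_)
    rw [Real.norm_of_nonneg Real.posLog_nonneg, Real.posLog_apply]
    exact max_le (abs_nonneg _) (le_abs_self _)
  rw [integrable_prod_iff' hmeas.aestronglyMeasurable]
  refine ⟨ae_of_all _ fun w => (circleIntegrable_log_norm_sub_const r).1, ?_⟩
  refine ((((integrable_const (Real.log 2 + Real.posLog r)).add hposlog).const_mul
    (4 * Real.pi)).add (integrable_const (2 * Real.pi * |Real.log r|))).mono'
    hmeas.stronglyMeasurable.norm.integral_prod_left'.aestronglyMeasurable
    (ae_of_all _ fun w => ?_)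
  rw [Real.norm_of_nonneg (integral_nonneg fun _ => norm_nonneg _)]
  exact integral_norm_log_norm_circleMap_sub_le hr w

lemma isRadialLaw (hν : IsAdmissibleBackground ν) : IsRadialLaw (modulusLaw ν) where
  isProbabilityMeasure := inferInstance
  Iic_zero := by
    rw [modulusLaw, Measure.map_apply (by fun_prop) measurableSet_Iic, ← hν.no_atom_zero]
    congr 1
    ext z
    simp
  integrable_log := by
    rw [modulusLaw, integrable_map_measure Real.measurable_log.aestronglyMeasurable
      (by fun_prop)]
    exact hν.integrable_log

/- By rotation invariance the potential at `z` equals its mean over the circle through `z`, which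
Jensen's formula computes. -/
theorem logPotential_eq (hν : IsAdmissibleBackground ν) (z : ℂ) :
    logPotential ν z
      = radialPotential (modulusLaw ν) ‖z‖ + ∫ s, Real.log s ∂(modulusLaw ν) := by
  rw [radialPotential, integral_modulusLaw ν measurable_posLog_div.of_uncurry_left,
    integral_modulusLaw ν Real.measurable_log]
  rcases eq_or_ne z 0 with rfl | hz
  · simp [logPotential]
  have hr : 0 < ‖z‖ := norm_pos_iff.mpr hz
  have hconst : ∀ θ : ℝ, logPotential ν (circleMap 0 ‖z‖ θ) = logPotential ν z := fun θ => by
    have hunit : ‖circleMap 0 ‖z‖ θ / z‖ = 1 := by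
      rw [norm_div, norm_circleMap_zero, abs_of_pos hr, div_self hr.ne']
    rw [← hν.logPotential_mul hunit z, div_mul_cancel₀ _ hz]
  have hmean : ∫ θ in Set.Ioc (0 : ℝ) (2 * Real.pi), ∫ w, Real.log ‖circleMap 0 ‖z‖ θ - w‖ ∂ν
      = 2 * Real.pi * logPotential ν z := by
    simp only [logPotential] at hconst ⊢
    simp_rw [hconst]
    rw [setIntegral_const, smul_eq_mul, Real.volume_real_Ioc_of_le Real.two_pi_pos.le, sub_zero]
  have hint : Integrable (fun w : ℂ => Real.posLog (‖z‖ / ‖w‖)) ν := by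
    have := hν.isRadialLaw.integrable_posLog hr
    rwa [modulusLaw, integrable_map_measure
      measurable_posLog_div.of_uncurry_left.aestronglyMeasurable (by fun_prop)] at this
  have hjensen :
      ∫ w, (∫ θ in Set.Ioc (0 : ℝ) (2 * Real.pi), Real.log ‖circleMap 0 ‖z‖ θ - w‖) ∂ν
        = 2 * Real.pi * (∫ w, Real.posLog (‖z‖ / ‖w‖) ∂ν + ∫ w, Real.log ‖w‖ ∂ν) := by
    rw [← integral_add hint hν.integrable_log, ← integral_const_mul]
    refine integral_congr_ae ?_
    filter_upwards [hν.ae_ne_zero] with w hw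
    rw [integral_log_norm_circleMap_sub hr.ne',
      log_add_posLog_inv_mul hr.ne' (norm_ne_zero_iff.mpr hw), add_comm]
  have hswap := integral_integral_swap (hν.integrable_log_norm_circleMap_sub hr)
  rw [hmean, hjensen] at hswap
  exact mul_left_cancel₀ Real.two_pi_pos.ne' hswap

lemma re_weightedInner_X_pow (hν : IsAdmissibleBackground ν) (n k : ℕ) :
    (weightedInner ν n (Polynomial.X ^ k) (Polynomial.X ^ k)).re
      = Real.exp (-2 * (n : ℝ) * ∫ s, Real.log s ∂(modulusLaw ν))
        * radialMoment (modulusLaw ν) k n := by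
  have := measurable_radialPotential (modulusLaw ν)
  have hmeas : Measurable fun r : ℝ =>
      r ^ (2 * k) * Real.exp (-2 * (n : ℝ) * radialPotential (modulusLaw ν) r) := by fun_prop
  rw [radialMoment, integral_modulusLaw ν hmeas, ← integral_const_mul, weightedInner]
  have hintegrand : ∀ z : ℂ, (Polynomial.X ^ k : Polynomial ℂ).eval z
      * (starRingEnd ℂ) ((Polynomial.X ^ k : Polynomial ℂ).eval z)
      * (Real.exp (-2 * (n : ℝ) * logPotential ν z) : ℂ)
      = ((Real.exp (-2 * (n : ℝ) * ∫ s, Real.log s ∂(modulusLaw ν)) * (‖z‖ ^ (2 * k) *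
        Real.exp (-2 * (n : ℝ) * radialPotential (modulusLaw ν) ‖z‖)) : ℝ) : ℂ) := fun z => by
    rw [Complex.mul_conj', hν.logPotential_eq, Polynomial.eval_pow, Polynomial.eval_X, norm_pow,
      ← Complex.ofReal_pow, ← Complex.ofReal_mul, ← pow_mul, mul_comm k 2, mul_add, Real.exp_add]
    congr 1
    ring
  simp_rw [hintegrand]
  rw [integral_complex_ofReal, Complex.ofReal_re]

end IsAdmissibleBackground

/-! ### Inversion of the law of the modulus -/

namespace IsRadialLaw

variable {m : Measure ℝ}

lemma map_inv (hm : IsRadialLaw m) : IsRadialLaw (m.map fun r => r⁻¹) := by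
  have := hm.isProbabilityMeasure
  refine ⟨Measure.isProbabilityMeasure_map (by fun_prop), ?_, ?_⟩
  · rw [Measure.map_apply (by fun_prop) measurableSet_Iic, ← hm.Iic_zero]
    congr 1
    ext r
    simp
  · rw [integrable_map_measure Real.measurable_log.aestronglyMeasurable (by fun_prop)]
    exact hm.integrable_log.neg.congr (ae_of_all _ fun r => (Real.log_inv r).symm)

lemma radialPotential_map_inv (hm : IsRadialLaw m) {r : ℝ} (hr : 0 < r) :
    radialPotential (m.map fun r => r⁻¹) r⁻¹
      = radialPotential m r - Real.log r + ∫ s, Real.log s ∂m := by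
  have := hm.isProbabilityMeasure
  have hposLog : ∀ᵐ s ∂m, Real.posLog (r⁻¹ / s⁻¹)
      = (Real.posLog (r / s) - Real.log r) + Real.log s := by
    filter_upwards [hm.ae_pos] with s hs
    rw [div_inv_eq_mul]
    linarith [log_add_posLog_inv_mul hr.ne' hs.ne']
  have hint := hm.integrable_posLog hr
  have hsub : Integrable (fun s => Real.posLog (r / s) - Real.log r) m :=
    hint.sub (integrable_const _)
  rw [radialPotential,
    integral_map (by fun_prop) measurable_posLog_div.of_uncurry_left.aestronglyMeasurable,
    integral_congr_ae hposLog, integral_add hsub hm.integrable_log,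
    integral_sub hint (integrable_const _), radialPotential]
  simp

lemma radialMoment_sub (hm : IsRadialLaw m) {j n : ℕ} (hj : j ≤ n) :
    radialMoment m (n - j) n
      = Real.exp (2 * (n : ℝ) * ∫ s, Real.log s ∂m)
        * radialMoment (m.map fun r => r⁻¹) j n := by
  have := hm.map_inv.isProbabilityMeasure
  have := measurable_radialPotential (m.map fun r => r⁻¹)
  have hmeas : Measurable fun r : ℝ => r ^ (2 * j) *
      Real.exp (-2 * (n : ℝ) * radialPotential (m.map fun r => r⁻¹) r) := by fun_prop
  rw [radialMoment, radialMoment, integral_map (by fun_prop) hmeas.aestronglyMeasurable,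
    ← integral_const_mul]
  refine integral_congr_ae ?_
  filter_upwards [hm.ae_pos] with r hr
  have hpow : r ^ (2 * (n - j)) = r⁻¹ ^ (2 * j) * Real.exp (2 * (n : ℝ) * Real.log r) := by
    have hexp : Real.exp (2 * (n : ℝ) * Real.log r) = r ^ (2 * n) := by
      rw [← Real.rpow_natCast, Real.rpow_def_of_pos hr]
      push_cast
      ring_nf
    rw [hexp, inv_pow, show 2 * n = 2 * j + 2 * (n - j) by omega, pow_add]
    field_simp
  rw [hm.radialPotential_map_inv hr, hpow, mul_assoc, ← Real.exp_add, mul_left_comm (Real.exp _),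
    ← Real.exp_add]
  congr 2
  ring

end IsRadialLaw

lemma cdf_modulusLaw (ν : Measure ℂ) [IsProbabilityMeasure ν] (r : ℝ) :
    cdf (modulusLaw ν) r = ν.real (Metric.closedBall 0 r) := by
  rw [cdf_eq_real, modulusLaw, map_measureReal_apply (by fun_prop) measurableSet_Iic]
  congr 1
  ext z
  simp

/- Sandwich the closed ball of radius `r` between the open balls of radii `r` and `r + r ^ 2`. -/
theorem tendsto_cdf_modulusLaw (ν : Measure ℂ) [IsProbabilityMeasure ν] {α lam : ℝ}
    (h : Tendsto (fun r : ℝ => ν.real (Metric.ball 0 r) / r ^ α) (𝓝[>] 0) (𝓝 lam)) :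
    Tendsto (fun r : ℝ => cdf (modulusLaw ν) r / r ^ α) (𝓝[>] 0) (𝓝 lam) := by
  have hradius : Tendsto (fun r : ℝ => r + r ^ 2) (𝓝[>] 0) (𝓝[>] 0) := by
    refine tendsto_nhdsWithin_iff.mpr ⟨?_, ?_⟩
    · exact ((by fun_prop : Continuous fun r : ℝ => r + r ^ 2).tendsto' 0 0
        (by simp)).mono_left nhdsWithin_le_nhds
    · filter_upwards [self_mem_nhdsWithin] with r (hr : 0 < r)
      exact Set.mem_Ioi.mpr (by positivity)
  have hone : Tendsto (fun r : ℝ => (1 + r) ^ α) (𝓝[>] 0) (𝓝 1) := by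
    have hcont : ContinuousAt (fun r : ℝ => (1 + r) ^ α) 0 :=
      (continuousAt_const.add continuousAt_id).rpow_const (Or.inl (by simp))
    simpa using hcont.tendsto.mono_left nhdsWithin_le_nhds
  have hupper := (h.comp hradius).mul hone
  rw [mul_one] at hupper
  refine tendsto_of_tendsto_of_tendsto_of_le_of_le' h hupper ?_ ?_
  · filter_upwards [self_mem_nhdsWithin] with r (hr : 0 < r)
    rw [cdf_modulusLaw]
    exact div_le_div_of_nonneg_right (measureReal_mono Metric.ball_subset_closedBall)
      (by positivity)
  · filter_upwards [self_mem_nhdsWithin] with r (hr : 0 < r)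
    have hr1 : 0 < (1 + r) ^ α := Real.rpow_pos_of_pos (by positivity) α
    have hfactor : (r + r ^ 2) ^ α = r ^ α * (1 + r) ^ α := by
      rw [← Real.mul_rpow hr.le (by positivity)]
      ring_nf
    rw [cdf_modulusLaw, Function.comp_apply, hfactor, div_mul_eq_mul_div,
      mul_div_mul_right _ _ hr1.ne']
    exact div_le_div_of_nonneg_right
      (measureReal_mono (Metric.closedBall_subset_ball (by nlinarith))) (by positivity)

theorem IsAdmissibleBackground.tendsto_cdf_map_inv_modulusLaw {ν : Measure ℂ}
    [IsProbabilityMeasure ν] (hν : IsAdmissibleBackground ν) {α lam : ℝ}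
    (h : Tendsto (fun r : ℝ => r ^ α * ν.real (Metric.ball 0 r)ᶜ) atTop (𝓝 lam)) :
    Tendsto (fun r : ℝ => cdf ((modulusLaw ν).map fun r => r⁻¹) r / r ^ α) (𝓝[>] 0)
      (𝓝 lam) := by
  have := hν.isRadialLaw.map_inv.isProbabilityMeasure
  refine (h.comp tendsto_inv_nhdsGT_zero).congr' ?_
  filter_upwards [self_mem_nhdsWithin] with r (hr : 0 < r)
  rw [cdf_eq_real, map_measureReal_apply (by fun_prop) measurableSet_Iic, modulusLaw,
    map_measureReal_apply (by fun_prop) (measurable_inv measurableSet_Iic), Function.comp_apply,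
    Real.inv_rpow hr.le, div_eq_inv_mul]
  congr 1
  refine measureReal_congr ?_
  filter_upwards [hν.ae_ne_zero] with w hw
  have hiff : w ∈ (Metric.ball 0 r⁻¹)ᶜ ↔ ‖w‖⁻¹ ≤ r := by
    simpa using inv_le_comm₀ hr (norm_pos_iff.mpr hw)
  exact propext hiff

/-! ### Power series with random coefficients -/

lemma tendstoLocallyUniformly_of_tendsto_prod {ι : Type*} {l : Filter ι} {F : ι → ℂ → ℂ}
    {f : ℂ → ℂ} (hf : Continuous f)
    (h : ∀ x, Tendsto (fun q : ι × ℂ => F q.1 q.2) (l ×ˢ 𝓝 x) (𝓝 (f x))) :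
    TendstoLocallyUniformly F f l :=
  tendstoLocallyUniformly_iff_forall_tendsto.mpr fun x =>
    (((hf.tendsto x).comp tendsto_snd).prodMk_nhds (h x)).mono_right (nhds_le_uniformity (f x))

/-- The sequence `u` decays faster than every geometric sequence, so that `∑ u k * z ^ k` is an
entire function of `z`. -/
def HasSuperexpDecay {E : Type*} [Norm E] (u : ℕ → E) : Prop :=
  ∀ R : ℝ, 0 < R → ∃ C, ∀ k, ‖u k‖ ≤ C / R ^ k

lemma norm_mul_pow_le_geometric {C R : ℝ} {w z : ℂ} {k : ℕ} (hR : 0 < R)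
    (hw : ‖w‖ ≤ C / (2 * R) ^ k) (hz : ‖z‖ ≤ R) : ‖w * z ^ k‖ ≤ C * (1 / 2) ^ k := by
  calc ‖w * z ^ k‖ = ‖w‖ * ‖z‖ ^ k := by rw [norm_mul, norm_pow]
    _ ≤ C / (2 * R) ^ k * R ^ k := by gcongr; exact (norm_nonneg _).trans hw
    _ = C * (1 / 2) ^ k := by rw [mul_pow, one_div, inv_pow]; field_simp

lemma summable_const_mul_half_pow (C : ℝ) : Summable fun k => C * (1 / 2 : ℝ) ^ k :=
  (summable_geometric_of_lt_one (by norm_num) (by norm_num)).mul_left C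

lemma HasSuperexpDecay.summable {v : ℕ → ℂ} (hv : HasSuperexpDecay v) (z : ℂ) :
    Summable fun k => v k * z ^ k := by
  obtain ⟨C, hC⟩ := hv (2 * (‖z‖ + 1)) (by positivity)
  exact .of_norm_bounded (summable_const_mul_half_pow C) fun k =>
    norm_mul_pow_le_geometric (by positivity) (hC k) (by linarith)

lemma HasSuperexpDecay.differentiable_tsum {v : ℕ → ℂ} (hv : HasSuperexpDecay v) :
    Differentiable ℂ fun z => ∑' k, v k * z ^ k := by
  intro z
  obtain ⟨C, hC⟩ := hv (2 * (‖z‖ + 1)) (by positivity)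
  have hball : DifferentiableOn ℂ (fun z => ∑' k, v k * z ^ k) (Metric.ball 0 (‖z‖ + 1)) :=
    Complex.differentiableOn_tsum_of_summable_norm (summable_const_mul_half_pow C)
      (fun k => by fun_prop) Metric.isOpen_ball fun k w hw =>
        norm_mul_pow_le_geometric (by positivity) (hC k) (mem_ball_zero_iff.mp hw).le
  exact hball.differentiableAt (Metric.isOpen_ball.mem_nhds (by simp))

lemma tendstoLocallyUniformly_tsum_mul_pow {ι : Type*} {l : Filter ι} {u : ι → ℕ → ℂ}
    {v : ℕ → ℂ} (huv : ∀ k, Tendsto (fun i => u i k) l (𝓝 (v k)))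
    (hu : ∀ R : ℝ, 0 < R → ∃ C, ∀ᶠ i in l, ∀ k, ‖u i k‖ ≤ C / R ^ k)
    (hv : HasSuperexpDecay v) :
    TendstoLocallyUniformly (fun i z => ∑' k, u i k * z ^ k) (fun z => ∑' k, v k * z ^ k) l := by
  refine tendstoLocallyUniformly_of_tendsto_prod hv.differentiable_tsum.continuous fun x => ?_
  obtain ⟨C, hC⟩ := hu (2 * (‖x‖ + 1)) (by positivity)
  refine tendsto_tsum_of_dominated_convergence (summable_const_mul_half_pow C)
    (fun k => ((huv k).comp tendsto_fst).mul (tendsto_snd.pow k)) ?_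
  have hball : ∀ᶠ z in 𝓝 x, ‖z‖ ≤ ‖x‖ + 1 :=
    (continuous_norm.tendsto x).eventually_le_const (by linarith)
  filter_upwards [hC.prod_mk hball] with q hq k
  exact norm_mul_pow_le_geometric (by positivity) (hq.1 k) hq.2

lemma tsum_mul_zero_pow (v : ℕ → ℂ) : ∑' k, v k * (0 : ℂ) ^ k = v 0 := by
  rw [tsum_eq_single 0 fun k hk => by simp [hk]]
  simp

/-! ### Weighted polynomials and their entire limits -/

/-- The polynomial `∑_{k ≤ n} a_k d_{k,n} z^k`. -/
noncomputable def weightedPoly (d : ℕ → ℕ → ℝ) (n : ℕ) (a : ℕ → ℂ) : Polynomial ℂ :=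
  ∑ k ∈ Finset.range (n + 1), Polynomial.monomial k (a k * d k n)

lemma coeff_weightedPoly (d : ℕ → ℕ → ℝ) (n : ℕ) (a : ℕ → ℂ) (k : ℕ) :
    (weightedPoly d n a).coeff k = if k ≤ n then a k * d k n else 0 := by
  simp [weightedPoly, Polynomial.finsetSum_coeff, Polynomial.coeff_monomial]

lemma eval_weightedPoly (d : ℕ → ℕ → ℝ) (n : ℕ) (a : ℕ → ℂ) (z : ℂ) :
    (weightedPoly d n a).eval z = ∑ k ∈ Finset.range (n + 1), a k * d k n * z ^ k := by
  simp [weightedPoly, Polynomial.eval_finsetSum]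

lemma eval_zero_weightedPoly (d : ℕ → ℕ → ℝ) (n : ℕ) (a : ℕ → ℂ) :
    (weightedPoly d n a).eval 0 = a 0 * d 0 n := by
  simp [← Polynomial.coeff_zero_eq_eval_zero, coeff_weightedPoly]

lemma eval_weightedPoly_eq_tsum (d : ℕ → ℕ → ℝ) (n : ℕ) (a : ℕ → ℂ) (z : ℂ) :
    (weightedPoly d n a).eval z = ∑' k, (weightedPoly d n a).coeff k * z ^ k := by
  rw [Polynomial.eval_eq_sum, Polynomial.sum_def, tsum_eq_sum fun k hk => ?_]
  rw [Polynomial.notMem_support_iff.mp hk, zero_mul]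

lemma tendstoLocallyUniformly_eval_weightedPoly (d : ℕ → ℕ → ℝ) (n : ℕ) (a : ℕ → ℂ) :
    TendstoLocallyUniformly (fun v z => (weightedPoly d n v).eval z)
      (fun z => (weightedPoly d n a).eval z) (𝓝 a) := by
  refine tendstoLocallyUniformly_of_tendsto_prod (Polynomial.continuous _) fun x => ?_
  simp only [eval_weightedPoly]
  have hcont : Continuous fun q : (ℕ → ℂ) × ℂ =>
      ∑ k ∈ Finset.range (n + 1), q.1 k * d k n * q.2 ^ k := by fun_prop
  rw [← nhds_prod_eq]
  exact hcont.tendsto (a, x)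

/-- At most exponential growth of the coefficients; the base `e` is the one provided by
`E log (1 + |a_0|) < ∞`. -/
def HasExpGrowth (a : ℕ → ℂ) : Prop := ∃ C, ∀ k : ℕ, ‖a k‖ ≤ C * Real.exp 1 ^ k

lemma norm_mul_ofReal_le_div_pow {C C' R x : ℝ} {w : ℂ} {k : ℕ}
    (hw : ‖w‖ ≤ C' * Real.exp 1 ^ k) (hx : ‖x‖ ≤ C / (Real.exp 1 * R) ^ k) :
    ‖w * (x : ℂ)‖ ≤ C' * C / R ^ k := by
  calc ‖w * (x : ℂ)‖ = ‖w‖ * ‖x‖ := by rw [norm_mul, Complex.norm_real]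
    _ ≤ C' * Real.exp 1 ^ k * (C / (Real.exp 1 * R) ^ k) :=
        mul_le_mul hw hx (norm_nonneg _) ((norm_nonneg _).trans hw)
    _ = C' * C / R ^ k := by
        have := Real.exp_pos 1
        rw [mul_pow]
        field_simp

lemma HasExpGrowth.mul_ofReal {a : ℕ → ℂ} {c : ℕ → ℝ} (ha : HasExpGrowth a)
    (hc : HasSuperexpDecay c) : HasSuperexpDecay fun k => a k * (c k : ℂ) := by
  intro R hR
  obtain ⟨C', hC'⟩ := ha
  obtain ⟨C, hC⟩ := hc (Real.exp 1 * R) (by positivity)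
  exact ⟨C' * C, fun k => norm_mul_ofReal_le_div_pow (hC' k) (hC k)⟩

/-- A triangular array `d k n`, `k ≤ n`, of positive weights which converges to `c` as `n → ∞` and
is eventually dominated by every geometric sequence. -/
structure IsWeightArray (d : ℕ → ℕ → ℝ) (c : ℕ → ℝ) : Prop where
  pos : ∀ k n, 0 < n → k ≤ n → 0 < d k n
  tendsto : ∀ k, Tendsto (d k) atTop (𝓝 (c k))
  bound : ∀ R, 0 < R → ∃ C, ∀ᶠ n in atTop, ∀ k ≤ n, d k n ≤ C / R ^ k

namespace IsWeightArray

variable {d : ℕ → ℕ → ℝ} {c : ℕ → ℝ} {a : ℕ → ℂ}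

lemma norm_bound (h : IsWeightArray d c) {R : ℝ} (hR : 0 < R) :
    ∃ C, ∀ᶠ n in atTop, ∀ k ≤ n, ‖d k n‖ ≤ C / R ^ k := by
  obtain ⟨C, hC⟩ := h.bound R hR
  refine ⟨C, ?_⟩
  filter_upwards [hC, eventually_gt_atTop 0] with n hn hn0 k hk
  rw [Real.norm_of_nonneg (h.pos k n hn0 hk).le]
  exact hn k hk

lemma hasSuperexpDecay_limit (h : IsWeightArray d c) : HasSuperexpDecay c := by
  intro R hR
  obtain ⟨C, hC⟩ := h.norm_bound hR
  refine ⟨C, fun k => le_of_tendsto (h.tendsto k).norm ?_⟩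
  filter_upwards [hC, eventually_ge_atTop k] with n hn hkn using hn k hkn

lemma tendstoLocallyUniformly (h : IsWeightArray d c) (ha : HasExpGrowth a) :
    TendstoLocallyUniformly (fun n z => (weightedPoly d n a).eval z)
      (fun z => ∑' k, a k * c k * z ^ k) atTop := by
  simp only [eval_weightedPoly_eq_tsum]
  refine tendstoLocallyUniformly_tsum_mul_pow (fun k => ?_) (fun R hR => ?_)
    (ha.mul_ofReal h.hasSuperexpDecay_limit)
  · refine (((Complex.continuous_ofReal.tendsto _).comp (h.tendsto k)).const_mul (a k)).congr' ?_
    filter_upwards [eventually_ge_atTop k] with n hkn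
    rw [coeff_weightedPoly, if_pos hkn, Function.comp_apply]
  · obtain ⟨C', hC'⟩ := ha
    obtain ⟨C, hC⟩ := h.norm_bound (R := Real.exp 1 * R) (by positivity)
    refine ⟨C' * C, ?_⟩
    filter_upwards [hC] with n hn k
    have hnonneg : 0 ≤ C' * C / R ^ k := by
      have h0 := norm_mul_ofReal_le_div_pow (hC' 0) (hn 0 n.zero_le)
      have h1 : 0 ≤ C' * C := by simpa using (norm_nonneg _).trans h0
      positivity
    rw [coeff_weightedPoly]
    split_ifs with hk
    · exact norm_mul_ofReal_le_div_pow (hC' k) (hn k hk)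
    · rwa [norm_zero]

end IsWeightArray
/-! ### Mittag-Leffler weights -/

/-- The weights `(2λ/α)^{k/α} / Γ(1 + 2k/α)^{1/2}` of the random function `f_{α,λ}`. -/
noncomputable def mittagLefflerWeight (α lam : ℝ) (k : ℕ) : ℝ :=
  (2 * lam / α) ^ ((k : ℝ) / α) / √(Real.Gamma (1 + 2 * (k : ℝ) / α))

section MittagLeffler

variable {α lam : ℝ}

lemma mittagLefflerTerm_eq (α lam : ℝ) (a : ℕ → ℂ) (z : ℂ) (k : ℕ) :
    mittagLefflerTerm α lam a z k = a k * (mittagLefflerWeight α lam k : ℂ) * z ^ k := by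
  rw [mittagLefflerTerm, mittagLefflerWeight]
  push_cast
  ring

lemma mittagLefflerFun_eq (α lam : ℝ) (a : ℕ → ℂ) :
    mittagLefflerFun α lam a = fun z => ∑' k, a k * mittagLefflerWeight α lam k * z ^ k := by
  funext z
  simp only [mittagLefflerFun, mittagLefflerTerm_eq]

-- `Γ(1 + x) = ∫ t ^ x * exp (-t)` over `t > 0`; keep only `t > T`.
lemma rpow_mul_exp_neg_le_Gamma {x T : ℝ} (hx : 0 ≤ x) (hT : 0 < T) :
    T ^ x * Real.exp (-T) ≤ Real.Gamma (1 + x) := by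
  have hint := Real.GammaIntegral_convergent (s := 1 + x) (by linarith)
  have hsub : Set.Ioi T ⊆ Set.Ioi 0 := Set.Ioi_subset_Ioi hT.le
  calc T ^ x * Real.exp (-T) = ∫ t in Set.Ioi T, T ^ x * Real.exp (-t) := by
        rw [integral_const_mul, integral_exp_neg_Ioi]
    _ ≤ ∫ t in Set.Ioi T, Real.exp (-t) * t ^ (1 + x - 1) := by
        refine setIntegral_mono_on ((integrableOn_exp_neg_Ioi T).const_mul _)
          (hint.mono_set hsub) measurableSet_Ioi fun t ht => ?_
        rw [mul_comm, add_sub_cancel_left]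
        have hTt : T ≤ t := le_of_lt ht
        gcongr
    _ ≤ ∫ t in Set.Ioi 0, Real.exp (-t) * t ^ (1 + x - 1) :=
        setIntegral_mono_set hint ((ae_restrict_mem measurableSet_Ioi).mono fun t ht =>
          mul_nonneg (Real.exp_pos _).le (Real.rpow_nonneg (le_of_lt ht) _)) hsub.eventuallyLE
    _ = Real.Gamma (1 + x) := (Real.Gamma_eq_integral (by linarith)).symm

lemma Gamma_one_add_pos (hα : 0 < α) (k : ℕ) : 0 < Real.Gamma (1 + 2 * (k : ℝ) / α) :=
  Real.Gamma_pos_of_pos (by positivity)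

lemma mittagLefflerWeight_pos (hα : 0 < α) (hlam : 0 < lam) (k : ℕ) :
    0 < mittagLefflerWeight α lam k :=
  div_pos (by positivity) (Real.sqrt_pos.mpr (Gamma_one_add_pos hα k))

lemma pow_mul_exp_neg_le_sqrt_Gamma (hα : 0 < α) {S : ℝ} (hS : 0 < S) (k : ℕ) :
    S ^ k * Real.exp (-(S ^ α / 2)) ≤ √(Real.Gamma (1 + 2 * (k : ℝ) / α)) := by
  refine Real.le_sqrt_of_sq_le ?_
  calc (S ^ k * Real.exp (-(S ^ α / 2))) ^ 2
      = (S ^ α) ^ (2 * (k : ℝ) / α) * Real.exp (-S ^ α) := by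
        rw [mul_pow, ← Real.exp_nat_mul, ← Real.rpow_mul hS.le, ← pow_mul, ← Real.rpow_natCast]
        congr 2 <;> push_cast <;> field_simp
    _ ≤ Real.Gamma (1 + 2 * (k : ℝ) / α) :=
        rpow_mul_exp_neg_le_Gamma (by positivity) (by positivity)

lemma mittagLefflerWeight_le (hα : 0 < α) (hlam : 0 < lam) {R : ℝ} (hR : 0 < R) (k : ℕ) :
    mittagLefflerWeight α lam k ≤ Real.exp (((2 * lam / α) ^ (1 / α) * R) ^ α / 2) / R ^ k := by
  have hX : 0 < 2 * lam / α := by positivity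
  set A := (2 * lam / α) ^ (1 / α) with hA
  have hXk : (2 * lam / α) ^ ((k : ℝ) / α) = A ^ k := by
    rw [hA, ← Real.rpow_natCast, ← Real.rpow_mul hX.le, one_div_mul_eq_div]
  have hGamma := pow_mul_exp_neg_le_sqrt_Gamma hα (S := A * R) (by positivity) k
  rw [mittagLefflerWeight, hXk, div_le_div_iff₀ (Real.sqrt_pos.mpr (Gamma_one_add_pos hα k))
    (by positivity), ← mul_pow]
  rwa [Real.exp_neg, ← div_eq_mul_inv, div_le_iff₀' (Real.exp_pos _)] at hGamma

lemma hasSuperexpDecay_mittagLefflerWeight (hα : 0 < α) (hlam : 0 < lam) :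
    HasSuperexpDecay (mittagLefflerWeight α lam) := fun R hR => by
  refine ⟨Real.exp (((2 * lam / α) ^ (1 / α) * R) ^ α / 2), fun k => ?_⟩
  rw [Real.norm_of_nonneg (mittagLefflerWeight_pos hα hlam k).le]
  exact mittagLefflerWeight_le hα hlam hR k

lemma isWeightArray_mittagLefflerWeight (hα : 0 < α) (hlam : 0 < lam) :
    IsWeightArray (fun k _ => mittagLefflerWeight α lam k) (mittagLefflerWeight α lam) where
  pos k _ _ _ := mittagLefflerWeight_pos hα hlam k
  tendsto _ := tendsto_const_nhds
  bound _ hR := ⟨_, .of_forall fun _ k _ => mittagLefflerWeight_le hα hlam hR k⟩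

lemma norm_tsum_mul_pow_le {C R : ℝ} {v : ℕ → ℂ} {z : ℂ} (hR : 0 < R)
    (hv : ∀ k, ‖v k‖ ≤ C / (2 * R) ^ k) (hz : ‖z‖ ≤ R) : ‖∑' k, v k * z ^ k‖ ≤ C * 2 :=
  tsum_of_norm_bounded (hasSum_geometric_two.mul_left C) fun k =>
    norm_mul_pow_le_geometric hR (hv k) hz

namespace HasExpGrowth

variable {a : ℕ → ℂ}

lemma summable_mittagLefflerTerm (ha : HasExpGrowth a) (hα : 0 < α) (hlam : 0 < lam) (z : ℂ) :
    Summable (mittagLefflerTerm α lam a z) := by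
  rw [show mittagLefflerTerm α lam a z = _ from funext (mittagLefflerTerm_eq α lam a z)]
  exact (ha.mul_ofReal (hasSuperexpDecay_mittagLefflerWeight hα hlam)).summable z

lemma differentiable_mittagLefflerFun (ha : HasExpGrowth a) (hα : 0 < α) (hlam : 0 < lam) :
    Differentiable ℂ (mittagLefflerFun α lam a) := by
  rw [mittagLefflerFun_eq]
  exact (ha.mul_ofReal (hasSuperexpDecay_mittagLefflerWeight hα hlam)).differentiable_tsum

lemma norm_mittagLefflerFun_le (ha : HasExpGrowth a) (hα : 0 < α) (hlam : 0 < lam) :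
    ∃ C D : ℝ, 0 < D ∧
      ∀ R : ℝ, 0 < R → ∀ z, ‖z‖ ≤ R → ‖mittagLefflerFun α lam a z‖ ≤ C * Real.exp (D * R ^ α) := by
  obtain ⟨C, hC⟩ := ha
  set A := (2 * lam / α) ^ (1 / α)
  refine ⟨C * 2, (A * (Real.exp 1 * 2)) ^ α / 2, by positivity, fun R hR z hz => ?_⟩
  have hcoeff (k : ℕ) : ‖a k * (mittagLefflerWeight α lam k : ℂ)‖
      ≤ C * Real.exp ((A * (Real.exp 1 * 2)) ^ α / 2 * R ^ α) / (2 * R) ^ k := by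
    refine norm_mul_ofReal_le_div_pow (hC k) ?_
    rw [Real.norm_of_nonneg (mittagLefflerWeight_pos hα hlam k).le]
    have hR' : 0 < Real.exp 1 * (2 * R) := by positivity
    refine (mittagLefflerWeight_le hα hlam hR' k).trans_eq ?_
    rw [div_mul_eq_mul_div, ← Real.mul_rpow (by positivity) hR.le, mul_assoc A, mul_assoc _ 2 R]
  rw [mittagLefflerFun_eq]
  exact (norm_tsum_mul_pow_le hR hcoeff hz).trans_eq (by ring)

end HasExpGrowth

end MittagLeffler

/-! ### Rescaled weights of the random polynomials -/

/-- The weights of the random polynomial in the variable `n^{1/α} z`, normalised so as to converge: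
see `IsRadialLaw.isWeightArray`. -/
noncomputable def rescaledWeight (m : Measure ℝ) (α : ℝ) (k n : ℕ) : ℝ :=
  √(α / 2 / ((n : ℝ) ^ (1 + 2 * (k : ℝ) / α) * radialMoment m k n))

section RescaledWeight

variable {m : Measure ℝ} {α lam : ℝ}

lemma momentLimit_pos (hα : 0 < α) (hlam : 0 < lam) (k : ℕ) : 0 < momentLimit α lam k := by
  have := Gamma_one_add_pos hα k
  rw [momentLimit]
  positivity

lemma sqrt_div_momentLimit (hα : 0 < α) (hlam : 0 < lam) (k : ℕ) :
    √(α / 2 / momentLimit α lam k) = mittagLefflerWeight α lam k := by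
  have hX : 0 < 2 * lam / α := by positivity
  have hquot : α / 2 / momentLimit α lam k
      = (2 * lam / α) ^ (2 * (k : ℝ) / α) / Real.Gamma (1 + 2 * (k : ℝ) / α) := by
    have := Gamma_one_add_pos hα k
    have := Real.rpow_pos_of_pos hX (2 * (k : ℝ) / α)
    rw [momentLimit]
    field_simp
  rw [hquot, Real.sqrt_div (by positivity), mittagLefflerWeight, Real.sqrt_eq_rpow,
    ← Real.rpow_mul hX.le]
  congr 2
  ring

lemma IsRadialLaw.radialMoment_pos (hm : IsRadialLaw m) (hα : 0 < α) (hlam : 0 < lam)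
    (hF : Tendsto (fun r : ℝ => cdf m r / r ^ α) (𝓝[>] 0) (𝓝 lam)) {k n : ℕ} (hkn : k ≤ n) :
    0 < radialMoment m k n := by
  have := hm.isProbabilityMeasure
  rw [radialMoment_eq_profileMoment]
  exact (hm.isRadialProfile hα hlam hF).profileMoment_pos hα hkn

theorem IsRadialLaw.isWeightArray (hm : IsRadialLaw m) (hα : 0 < α) (hlam : 0 < lam)
    (hF : Tendsto (fun r : ℝ => cdf m r / r ^ α) (𝓝[>] 0) (𝓝 lam)) :
    IsWeightArray (rescaledWeight m α) (mittagLefflerWeight α lam) := by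
  have := hm.isProbabilityMeasure
  have hprofile := hm.isRadialProfile hα hlam hF
  refine ⟨fun k n hn hkn => ?_, fun k => ?_, fun R hR => ?_⟩
  · have := hm.radialMoment_pos hα hlam hF hkn
    exact Real.sqrt_pos.mpr (by positivity)
  · rw [← sqrt_div_momentLimit hα hlam]
    refine (Real.continuous_sqrt.tendsto _).comp
      (tendsto_const_nhds.div ?_ (momentLimit_pos hα hlam k).ne')
    simp only [radialMoment_eq_profileMoment]
    exact hprofile.tendsto_profileMoment hα hlam k
  · obtain ⟨δ, hδ, hlower⟩ := hprofile.exists_profileMoment_ge hα hR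
    refine ⟨√(α / 2 / δ), ?_⟩
    filter_upwards [hlower] with n hn k hkn
    have hk := hn k hkn
    rw [← radialMoment_eq_profileMoment] at hk
    calc rescaledWeight m α k n ≤ √(α / 2 / (δ * R ^ (2 * k))) := by
          rw [rescaledWeight]
          gcongr
      _ = √(α / 2 / δ) / R ^ k := by
          rw [← div_div, Real.sqrt_div (by positivity), mul_comm 2 k, pow_mul,
            Real.sqrt_sq (by positivity)]

lemma inv_sqrt_radialMoment {k n : ℕ} (hα : 0 < α) (hn : 0 < n) (hm : 0 < radialMoment m k n) :
    (√(radialMoment m k n))⁻¹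
      = √(n / (α / 2)) * (((n : ℝ) ^ (1 / α)) ^ k * rescaledWeight m α k n) := by
  have hn' : (0 : ℝ) < n := by exact_mod_cast hn
  have hpow : ((n : ℝ) ^ (1 / α)) ^ k = √((n : ℝ) ^ (2 * (k : ℝ) / α)) := by
    rw [← rpow_one_div_pow hn'.le, mul_comm 2 k, pow_mul, Real.sqrt_sq (by positivity)]
  have := Real.rpow_pos_of_pos hn' (2 * (k : ℝ) / α)
  rw [rescaledWeight, hpow, ← Real.sqrt_mul (by positivity), ← Real.sqrt_mul (by positivity),
    ← Real.sqrt_inv, Real.rpow_add hn', Real.rpow_one]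
  congr 1
  field_simp

end RescaledWeight
/-! ### Zero-free entire functions of finite order -/

theorem exists_eq_exp_of_forall_ne_zero {f : ℂ → ℂ} (hf : Differentiable ℂ f)
    (hf0 : ∀ z, f z ≠ 0) : ∃ g, Differentiable ℂ g ∧ f = fun z => Complex.exp (g z) := by
  have hlogDeriv : Differentiable ℂ fun z => deriv f z / f z :=
    (hf.contDiff (n := 2)).differentiable_deriv_two.div hf hf0
  obtain ⟨g, hg0, hg⟩ := hlogDeriv.isExactOn_univ.with_val_at 0 (Complex.log (f 0))
  have hg' (z : ℂ) : HasDerivAt g (deriv f z / f z) z := hg z (Set.mem_univ _)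
  have hquot (z : ℂ) : HasDerivAt (fun z => f z * Complex.exp (-g z)) 0 z := by
    refine ((hf z).hasDerivAt.mul (hg' z).neg.cexp).congr_deriv ?_
    have := hf0 z
    field_simp
    ring
  refine ⟨g, fun z => (hg' z).differentiableAt, funext fun z => ?_⟩
  have hconst : f z * Complex.exp (-g z) = f 0 * Complex.exp (-g 0) :=
    is_const_of_deriv_eq_zero (fun z => (hquot z).differentiableAt) (fun z => (hquot z).deriv) z 0
  rwa [hg0, Complex.exp_neg, Complex.exp_neg, Complex.exp_log (hf0 0), mul_inv_cancel₀ (hf0 0),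
    ← div_eq_mul_inv, div_eq_one_iff_eq (Complex.exp_ne_zero _)] at hconst

lemma norm_iteratedDeriv_zero_le_of_re_le {g : ℂ → ℂ} (hg : Differentiable ℂ g) {M R : ℝ}
    (hM : 0 < M) (hR : 0 < R) (hb : ∀ z, ‖z‖ ≤ R → (g z).re ≤ M) (k : ℕ) :
    ‖iteratedDeriv k g 0‖ ≤ k.factorial * (2 * M + 3 * ‖g 0‖) / (R / 2) ^ k := by
  refine Complex.norm_iteratedDeriv_le_of_forall_mem_sphere_norm_le k (by positivity)
    hg.diffContOnCl fun z hz => ?_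
  have hz' : ‖z‖ = R / 2 := mem_sphere_zero_iff_norm.mp hz
  have hzR : z ∈ Metric.ball (0 : ℂ) R := mem_ball_zero_iff.mpr (by linarith)
  refine (Complex.borelCaratheodory hM hg.differentiableOn
    (fun w hw => hb w (mem_ball_zero_iff.mp hw).le) hR hzR).trans_eq ?_
  rw [hz']
  field_simp
  ring

lemma tendsto_add_mul_rpow_div_pow {α : ℝ} {k : ℕ} (A B : ℝ) (hk0 : 0 < k) (hk : α < k) :
    Tendsto (fun R : ℝ => (A + B * R ^ α) / R ^ k) atTop (𝓝 0) := by
  have hpow : Tendsto (fun R : ℝ => R ^ (-(k : ℝ))) atTop (𝓝 0) :=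
    tendsto_rpow_neg_atTop (by exact_mod_cast hk0)
  have hrpow : Tendsto (fun R : ℝ => R ^ (-((k : ℝ) - α))) atTop (𝓝 0) :=
    tendsto_rpow_neg_atTop (by linarith)
  have hsum := (hpow.const_mul A).add (hrpow.const_mul B)
  simp only [mul_zero, add_zero] at hsum
  refine hsum.congr' ?_
  filter_upwards [eventually_gt_atTop 0] with R hR
  rw [neg_sub, Real.rpow_sub hR, Real.rpow_neg hR.le, Real.rpow_natCast]
  ring

lemma iteratedDeriv_zero_eq_zero_of_re_le {g : ℂ → ℂ} (hg : Differentiable ℂ g) {A D α : ℝ}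
    (hA : 0 < A) (hD : 0 < D) (hb : ∀ R : ℝ, 0 < R → ∀ z, ‖z‖ ≤ R → (g z).re ≤ A + D * R ^ α)
    {k : ℕ} (hk0 : 0 < k) (hk : α < k) : iteratedDeriv k g 0 = 0 := by
  have hlim := (tendsto_add_mul_rpow_div_pow (2 * A + 3 * ‖g 0‖) (2 * D) hk0 hk).const_mul
    (k.factorial * 2 ^ k : ℝ)
  rw [mul_zero] at hlim
  refine norm_le_zero_iff.mp (ge_of_tendsto hlim ?_)
  filter_upwards [eventually_gt_atTop 0] with R hR
  refine (norm_iteratedDeriv_zero_le_of_re_le hg (by positivity) hR (hb R hR) k).trans_eq ?_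
  rw [div_pow]
  field_simp
  ring

theorem exists_deriv_eq_mul_of_forall_ne_zero {f : ℂ → ℂ} (hf : Differentiable ℂ f)
    (hf0 : ∀ z, f z ≠ 0) {C D α : ℝ} (hD : 0 < D)
    (hb : ∀ R : ℝ, 0 < R → ∀ z, ‖z‖ ≤ R → ‖f z‖ ≤ C * Real.exp (D * R ^ α)) :
    ∃ h : ℂ → ℂ, Differentiable ℂ h ∧ deriv f = h * f ∧
      ∀ k : ℕ, α < k → iteratedDeriv k h 0 = 0 := by
  obtain ⟨g, hg, rfl⟩ := exists_eq_exp_of_forall_ne_zero hf hf0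
  refine ⟨deriv g, (hg.contDiff (n := 2)).differentiable_deriv_two, ?_, fun k hk => ?_⟩
  · funext z
    rw [((hg z).hasDerivAt.cexp).deriv, Pi.mul_apply, mul_comm]
  · rw [← iteratedDeriv_succ']
    refine iteratedDeriv_zero_eq_zero_of_re_le hg (A := |Real.log C| + 1) (by positivity) hD
      (α := α) (fun R hR z hz => ?_) k.succ_pos (by push_cast; linarith)
    have hz' := hb R hR z hz
    rw [Complex.norm_exp] at hz'
    have hC : 0 < C := pos_of_mul_pos_left ((Real.exp_pos _).trans_le hz') (Real.exp_pos _).le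
    rw [← Real.le_log_iff_exp_le (by positivity), Real.log_mul hC.ne' (Real.exp_pos _).ne',
      Real.log_exp] at hz'
    linarith [le_abs_self (Real.log C)]

/-! ### Taylor coefficients of the logarithmic derivative -/

/-- The derivatives at `0` of `f' / f`, in terms of the derivatives `b` of `f` at `0`; the recursion
is Leibniz' rule for `f' = (f' / f) * f`. -/
noncomputable def logDerivCoeff (b : ℕ → ℂ) (k : ℕ) : ℂ :=
  (b (k + 1) - ∑ i : Fin k, (k.choose i : ℂ) * logDerivCoeff b i * b (k - i)) / b 0
termination_by k
decreasing_by exact i.2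

lemma logDerivCoeff_congr {b b' : ℕ → ℂ} (k : ℕ) (h : ∀ i ≤ k + 1, b i = b' i) :
    logDerivCoeff b k = logDerivCoeff b' k := by
  induction k using Nat.strong_induction_on with
  | _ k ih =>
    rw [logDerivCoeff, logDerivCoeff, h (k + 1) le_rfl, h 0 (Nat.zero_le _)]
    congr 2
    refine Finset.sum_congr rfl fun i _ => ?_
    rw [ih i i.2 fun j hj => h j (by omega), h (k - i) (by omega)]

lemma logDerivCoeff_eq_zero_iff {b : ℕ → ℂ} (hb : b 0 ≠ 0) (k : ℕ) :
    logDerivCoeff b k = 0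
      ↔ b (k + 1) = ∑ i : Fin k, (k.choose i : ℂ) * logDerivCoeff b i * b (k - i) := by
  rw [logDerivCoeff, div_eq_zero_iff, or_iff_left hb, sub_eq_zero]

lemma measurable_logDerivCoeff (k : ℕ) : Measurable fun b => logDerivCoeff b k := by
  induction k using Nat.strong_induction_on with
  | _ k ih =>
    have hrec : (fun b => logDerivCoeff b k) = fun b : ℕ → ℂ =>
        (b (k + 1) - ∑ i : Fin k, (k.choose i : ℂ) * logDerivCoeff b i * b (k - i)) / b 0 :=
      funext fun b => by rw [logDerivCoeff]
    have hih (i : Fin k) : Measurable fun b => logDerivCoeff b i := ih i i.2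
    rw [hrec]
    fun_prop

lemma iteratedDeriv_eq_logDerivCoeff {f h : ℂ → ℂ} (hf : Differentiable ℂ f)
    (hh : Differentiable ℂ h) (hf0 : f 0 ≠ 0) (hderiv : deriv f = h * f) (k : ℕ) :
    iteratedDeriv k h 0 = logDerivCoeff (fun j => iteratedDeriv j f 0) k := by
  induction k using Nat.strong_induction_on with
  | _ k ih =>
    rw [logDerivCoeff, iteratedDeriv_zero, eq_div_iff hf0, iteratedDeriv_succ', hderiv,
      iteratedDeriv_mul hh.contDiff.contDiffAt hf.contDiff.contDiffAt, Finset.sum_range_succ,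
      ← Fin.sum_univ_eq_sum_range
        (fun i => (k.choose i : ℂ) * iteratedDeriv i h 0 * iteratedDeriv (k - i) f 0)]
    simp only [fun i : Fin k => ih i i.2]
    simp

lemma iteratedDeriv_zero_eq_of_hasSum {f : ℂ → ℂ} {b : ℕ → ℂ}
    (h : ∀ z, HasSum (fun k => b k * z ^ k) (f z)) (k : ℕ) :
    iteratedDeriv k f 0 = k.factorial * b k := by
  have hseries : HasFPowerSeriesAt f (FormalMultilinearSeries.ofScalars ℂ b) 0 := by
    refine hasFPowerSeriesAt_iff.mpr (.of_forall fun z => ?_)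
    simpa [FormalMultilinearSeries.coeff_ofScalars, mul_comm] using h z
  have hunique := hseries.eq_formalMultilinearSeries hseries.analyticAt.hasFPowerSeriesAt
  have hcoeff := congrArg (fun p => p.coeff k) hunique
  simp only [FormalMultilinearSeries.coeff_ofScalars] at hcoeff
  rw [hcoeff, mul_div_cancel₀ _ (by exact_mod_cast k.factorial_ne_zero)]
/-! ### Random power series are not exponentials of polynomials -/

section Coefficients

variable {Ω : Type*} [MeasurableSpace Ω] {μ : Measure Ω}

lemma hasExpGrowth_of_eventually_le {a : ℕ → ℂ}
    (h : ∀ᶠ k in atTop, ‖a k‖ ≤ Real.exp 1 ^ k) : HasExpGrowth a := by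
  obtain ⟨N, hN⟩ := eventually_atTop.mp h
  refine ⟨1 + ∑ k ∈ Finset.range N, ‖a k‖, fun k => ?_⟩
  have hsum : 0 ≤ ∑ k ∈ Finset.range N, ‖a k‖ := Finset.sum_nonneg fun _ _ => norm_nonneg _
  have hexp : 1 ≤ Real.exp 1 ^ k := one_le_pow₀ (Real.one_le_exp zero_le_one)
  rcases le_or_gt N k with hk | hk
  · nlinarith [hN k hk]
  · have hle : ‖a k‖ ≤ ∑ k ∈ Finset.range N, ‖a k‖ :=
      Finset.single_le_sum (f := fun k => ‖a k‖) (fun _ _ => norm_nonneg _)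
        (Finset.mem_range.mpr hk)
    nlinarith

theorem IsAdmissibleCoefficients.ae_hasExpGrowth [IsProbabilityMeasure μ] {a : ℕ → Ω → ℂ}
    (ha : IsAdmissibleCoefficients μ a) : ∀ᵐ ω ∂μ, HasExpGrowth fun k => a k ω := by
  let _ : MeasureSpace Ω := ⟨μ⟩
  have : IsProbabilityMeasure (volume : Measure Ω) := ‹IsProbabilityMeasure μ›
  have hident (j : ℕ) : μ {ω | Real.log (1 + ‖a j ω‖) ∈ Set.Ioi (j : ℝ)}
      = μ {ω | Real.log (1 + ‖a 0 ω‖) ∈ Set.Ioi (j : ℝ)} :=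
    ((ha.identDistrib j).comp (u := fun z : ℂ => Real.log (1 + ‖z‖)) (by fun_prop)).measure_mem_eq
      measurableSet_Ioi
  have hsum : ∑' j : ℕ, μ {ω | Real.log (1 + ‖a j ω‖) ∈ Set.Ioi (j : ℝ)} ≠ ⊤ := by
    simp only [hident]
    exact (tsum_prob_mem_Ioi_lt_top ha.integrable_log fun ω => Real.log_nonneg (by simp)).ne
  filter_upwards [ae_eventually_notMem hsum] with ω hω
  refine hasExpGrowth_of_eventually_le (hω.mono fun k hk => ?_)
  rw [Set.mem_Ioi, not_lt, Real.log_le_iff_le_exp (by positivity),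
    ← mul_one (k : ℝ), Real.exp_nat_mul] at hk
  linarith

lemma measure_eq_and_mem_le {E F : Type*} [MeasurableSpace E] [MeasurableSpace F]
    [MeasurableEq F] [MeasurableSingletonClass F] [IsFiniteMeasure μ] {X : Ω → F} {W : Ω → E}
    (hX : Measurable X) (hW : Measurable W) (hind : IndepFun W X μ) {p : ENNReal}
    (hp : ∀ c, μ {ω | X ω = c} ≤ p) {S : Set E} (hS : MeasurableSet S) {φ : E → F}
    (hφ : Measurable φ) :
    μ {ω | W ω ∈ S ∧ X ω = φ (W ω)} ≤ p * μ {ω | W ω ∈ S} := by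
  set T : Set (E × F) := {q | q.1 ∈ S ∧ q.2 = φ q.1} with hTdef
  have hT : MeasurableSet T :=
    (measurable_fst hS).inter (measurableSet_eq_fun measurable_snd (hφ.comp measurable_fst))
  have hsection (x : E) : (μ.map X) (Prod.mk x ⁻¹' T) ≤ S.indicator (fun _ => p) x := by
    by_cases hx : x ∈ S
    · have hpre : Prod.mk x ⁻¹' T = {φ x} := by ext y; simp [hTdef, hx]
      rw [Set.indicator_of_mem hx, hpre, Measure.map_apply hX (measurableSet_singleton _)]
      exact hp _
    · have hpre : Prod.mk x ⁻¹' T = ∅ := by ext y; simp [hTdef, hx]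
      rw [hpre, measure_empty]
      exact zero_le
  calc μ {ω | W ω ∈ S ∧ X ω = φ (W ω)} = (μ.map fun ω => (W ω, X ω)) T :=
        (Measure.map_apply (hW.prodMk hX) hT).symm
    _ = ∫⁻ x, (μ.map X) (Prod.mk x ⁻¹' T) ∂(μ.map W) := by
        rw [(indepFun_iff_map_prod_eq_prod_map_map hW.aemeasurable hX.aemeasurable).mp hind,
          Measure.prod_apply hT]
    _ ≤ ∫⁻ x, S.indicator (fun _ => p) x ∂(μ.map W) := lintegral_mono hsection
    _ = p * μ {ω | W ω ∈ S} := by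
        rw [lintegral_indicator_const hS, Measure.map_apply hW hS]
        rfl

lemma exists_lt_one_measure_eq_le {F : Type*} [MeasurableSpace F] [MeasurableSingletonClass F]
    [IsProbabilityMeasure μ] {X : Ω → F} (hX : Measurable X) (h : ¬ ∃ c, ∀ᵐ ω ∂μ, X ω = c) :
    ∃ p < (1 : ENNReal), ∀ c, μ {ω | X ω = c} ≤ p := by
  have hmeas (c : F) : MeasurableSet {ω | X ω = c} := hX (measurableSet_singleton c)
  have hlt (c : F) : μ {ω | X ω = c} < 1 :=
    prob_le_one.lt_of_ne fun h1 => h ⟨c, (mem_ae_iff_prob_eq_one (hmeas c)).mpr h1⟩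
  by_cases hatom : ∃ c, (1 / 2 : ENNReal) < μ {ω | X ω = c}
  · obtain ⟨c, hc⟩ := hatom
    refine ⟨_, hlt c, fun c' => ?_⟩
    rcases eq_or_ne c' c with rfl | hne
    · exact le_rfl
    · have hdisj : {ω | X ω = c'} ⊆ {ω | X ω = c}ᶜ := fun ω hω hω' => hne (hω.symm.trans hω')
      calc μ {ω | X ω = c'} ≤ μ {ω | X ω = c}ᶜ := measure_mono hdisj
        _ = 1 - μ {ω | X ω = c} := prob_compl_eq_one_sub (hmeas c)
        _ ≤ 1 - 1 / 2 := tsub_le_tsub_left hc.le 1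
        _ = 1 / 2 := by simp
        _ ≤ μ {ω | X ω = c} := hc.le
  · push Not at hatom
    exact ⟨1 / 2, by simp, hatom⟩

lemma measurableSet_logDerivCoeff_eq_zero (d N : ℕ) :
    MeasurableSet {w : ℕ → ℂ | w 0 ≠ 0 ∧ ∀ k, d ≤ k → k < N → logDerivCoeff w k = 0} := by
  have hcoeff (k : ℕ) : MeasurableSet {w : ℕ → ℂ | logDerivCoeff w k = 0} :=
    measurable_logDerivCoeff k (measurableSet_singleton 0)
  simp only [Set.ofPred_and, Set.ofPred_forall]
  refine MeasurableSet.inter (measurable_pi_apply 0 (measurableSet_singleton 0)).compl ?_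
  exact .iInter fun k => .iInter fun _ => .iInter fun _ => hcoeff k

lemma indepFun_truncate_succ {E : Type*} [MeasurableSpace E] [Zero E] {X : ℕ → Ω → E}
    (h : iIndepFun X μ) (hX : ∀ k, Measurable (X k)) (N : ℕ) :
    IndepFun (fun ω j => if j ≤ N then X j ω else 0) (X (N + 1)) μ := by
  have hfin := h.indepFun_finset (Finset.range (N + 1)) {N + 1} (by simp) hX
  let extend (w : Finset.range (N + 1) → E) (j : ℕ) : E :=
    if hj : j ∈ Finset.range (N + 1) then w ⟨j, hj⟩ else 0
  have hextend : Measurable extend := by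
    refine measurable_pi_lambda _ fun j => ?_
    by_cases hj : j ∈ Finset.range (N + 1)
    · simpa only [extend, hj, dif_pos] using measurable_pi_apply _
    · simpa only [extend, hj, dif_neg, not_false_iff] using measurable_const
  have htrunc : (fun ω j => if j ≤ N then X j ω else 0)
      = extend ∘ fun ω (i : Finset.range (N + 1)) => X i ω := by
    ext ω j
    simp [extend]
  rw [htrunc]
  exact hfin.comp hextend (measurable_pi_apply ⟨N + 1, Finset.mem_singleton_self _⟩)

variable [IsProbabilityMeasure μ]

lemma measure_logDerivCoeff_eq_zero_succ_le {b : ℕ → Ω → ℂ} (hb : ∀ k, Measurable (b k))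
    (hind : iIndepFun b μ) {p : ENNReal} (hp : ∀ k c, μ {ω | b k ω = c} ≤ p) {d N : ℕ}
    (hdN : d ≤ N) :
    μ {ω | b 0 ω ≠ 0 ∧ ∀ k, d ≤ k → k < N + 1 → logDerivCoeff (fun j => b j ω) k = 0}
      ≤ p * μ {ω | b 0 ω ≠ 0 ∧ ∀ k, d ≤ k → k < N → logDerivCoeff (fun j => b j ω) k = 0} := by
  set W : Ω → ℕ → ℂ := fun ω j => if j ≤ N then b j ω else 0 with hWdef
  have hW : Measurable W := measurable_pi_lambda _ fun j => by
    by_cases hj : j ≤ N <;> simp only [hWdef, hj, if_true, if_false]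
    exacts [hb j, measurable_const]
  have hWb {ω : Ω} {j : ℕ} (hj : j ≤ N) : W ω j = b j ω := if_pos hj
  have hcoeff {ω : Ω} {k : ℕ} (hk : k < N) :
      logDerivCoeff (W ω) k = logDerivCoeff (fun j => b j ω) k :=
    logDerivCoeff_congr k fun j hj => hWb (by omega)
  set S := {w : ℕ → ℂ | w 0 ≠ 0 ∧ ∀ k, d ≤ k → k < N → logDerivCoeff w k = 0}
  have hWS (ω : Ω) : W ω ∈ S
      ↔ b 0 ω ≠ 0 ∧ ∀ k, d ≤ k → k < N → logDerivCoeff (fun j => b j ω) k = 0 :=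
    and_congr (by rw [hWb N.zero_le])
      (forall_congr' fun k => forall₂_congr fun _ hk => by rw [hcoeff hk])
  set φ : (ℕ → ℂ) → ℂ := fun w => ∑ i : Fin N, (N.choose i : ℂ) * logDerivCoeff w i * w (N - i)
  have hφ : Measurable φ := by
    have := fun i : Fin N => measurable_logDerivCoeff i
    fun_prop
  have hnext {ω : Ω} (h0 : b 0 ω ≠ 0) (h : logDerivCoeff (fun j => b j ω) N = 0) :
      b (N + 1) ω = φ (W ω) := by
    rw [(logDerivCoeff_eq_zero_iff h0 N).mp h]
    exact Finset.sum_congr rfl fun i _ => by rw [hcoeff i.2, hWb (N.sub_le i)]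
  calc _ ≤ μ {ω | W ω ∈ S ∧ b (N + 1) ω = φ (W ω)} := measure_mono fun ω hω =>
        ⟨(hWS ω).mpr ⟨hω.1, fun k hk hkN => hω.2 k hk (by omega)⟩,
          hnext hω.1 (hω.2 N hdN N.lt_succ_self)⟩
    _ ≤ p * μ {ω | W ω ∈ S} := measure_eq_and_mem_le (hb _) hW
        (indepFun_truncate_succ hind hb N) (hp _) (measurableSet_logDerivCoeff_eq_zero d N) hφ
    _ = _ := by simp only [hWS]

/- Each further coefficient is determined by the previous ones, an event of probability at
most `p < 1` given those. -/
lemma measure_forall_logDerivCoeff_eq_zero {b : ℕ → Ω → ℂ} (hb : ∀ k, Measurable (b k))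
    (hind : iIndepFun b μ) {p : ENNReal} (hp1 : p < 1) (hp : ∀ k c, μ {ω | b k ω = c} ≤ p)
    (d : ℕ) :
    μ {ω | b 0 ω ≠ 0 ∧ ∀ k, d ≤ k → logDerivCoeff (fun j => b j ω) k = 0} = 0 := by
  have hpow (K : ℕ) : μ {ω | b 0 ω ≠ 0 ∧
      ∀ k, d ≤ k → k < d + K → logDerivCoeff (fun j => b j ω) k = 0} ≤ p ^ K := by
    induction K with
    | zero => exact prob_le_one.trans_eq (pow_zero p).symm
    | succ K ih =>
      rw [pow_succ']
      exact (measure_logDerivCoeff_eq_zero_succ_le hb hind hp (Nat.le_add_right d K)).trans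
        (by gcongr)
  refine le_antisymm (ge_of_tendsto' (ENNReal.tendsto_pow_atTop_nhds_zero_of_lt_one hp1) fun K =>
    (measure_mono fun ω hω => ?_).trans (hpow K)) bot_le
  exact ⟨hω.1, fun k hk _ => hω.2 k hk⟩

lemma HasExpGrowth.iteratedDeriv_mittagLefflerFun_zero {a : ℕ → ℂ} (ha : HasExpGrowth a)
    {α lam : ℝ} (hα : 0 < α) (hlam : 0 < lam) (k : ℕ) :
    iteratedDeriv k (mittagLefflerFun α lam a) 0
      = k.factorial * mittagLefflerWeight α lam k * a k := by
  rw [iteratedDeriv_zero_eq_of_hasSum (b := fun j => a j * mittagLefflerWeight α lam j)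
    fun z => ?_]
  · ring
  · simp only [← mittagLefflerTerm_eq]
    exact (ha.summable_mittagLefflerTerm hα hlam z).hasSum

theorem IsAdmissibleCoefficients.ae_exists_mittagLefflerFun_eq_zero {a : ℕ → Ω → ℂ}
    (ha : IsAdmissibleCoefficients μ a) {α lam : ℝ} (hα : 0 < α) (hlam : 0 < lam) :
    ∀ᵐ ω ∂μ, ∃ z, mittagLefflerFun α lam (fun k => a k ω) z = 0 := by
  obtain ⟨d, hd⟩ := exists_nat_gt α
  set w : ℕ → ℂ := fun k => k.factorial * mittagLefflerWeight α lam k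
  have hw (k : ℕ) : w k ≠ 0 := mul_ne_zero (by exact_mod_cast k.factorial_ne_zero)
    (by exact_mod_cast (mittagLefflerWeight_pos hα hlam k).ne')
  obtain ⟨p, hp1, hp⟩ := exists_lt_one_measure_eq_le (ha.measurable 0) ha.not_deterministic
  have hatom (k : ℕ) (c : ℂ) : μ {ω | w k * a k ω = c} ≤ p := by
    simp only [← eq_div_iff_mul_eq (hw k), mul_comm (w k)]
    exact ((ha.identDistrib k).measure_mem_eq (measurableSet_singleton (c / w k))).trans_le (hp _)
  have hnull := measure_forall_logDerivCoeff_eq_zero (fun k => (ha.measurable k).const_mul (w k))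
    (ha.indep.comp (fun k z => w k * z) fun k => measurable_const_mul (w k)) hp1 hatom d
  filter_upwards [ha.ae_hasExpGrowth, ha.ne_zero, measure_eq_zero_iff_ae_notMem.mp hnull]
    with ω hgrowth h0 hω
  by_contra! hzero
  refine hω ⟨mul_ne_zero (hw 0) h0, fun k hk => ?_⟩
  have hf := hgrowth.differentiable_mittagLefflerFun hα hlam
  obtain ⟨C, D, hD, hb⟩ := hgrowth.norm_mittagLefflerFun_le hα hlam
  obtain ⟨h, hh, hderiv, hvanish⟩ := exists_deriv_eq_mul_of_forall_ne_zero hf hzero hD hb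
  rw [← hvanish k (hd.trans_le (by exact_mod_cast hk)),
    iteratedDeriv_eq_logDerivCoeff hf hh (hzero 0) hderiv]
  simp only [hgrowth.iteratedDeriv_mittagLefflerFun_zero hα hlam, w]

end Coefficients

/-! ### Roots of the random polynomials -/

section PolynomialRoots

lemma roots_reverse_X_sub_C {w : ℂ} (hw : w ≠ 0) :
    (Polynomial.X - Polynomial.C w).reverse.roots = {w⁻¹} := by
  have hreverse : (Polynomial.X - Polynomial.C w).reverse
      = Polynomial.C (-w) * Polynomial.X + Polynomial.C 1 := by
    rw [sub_eq_neg_add, ← Polynomial.C_neg, Polynomial.reverse_C_add]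
    simp [add_comm, Polynomial.reverse]
  rw [hreverse, Polynomial.roots_C_mul_X_add_C 1 (neg_ne_zero.mpr hw)]
  simp [inv_neg]

theorem roots_reverse {p : Polynomial ℂ} (hp : p.eval 0 ≠ 0) :
    p.reverse.roots = p.roots.map (·⁻¹) := by
  have hp0 : p ≠ 0 := by rintro rfl; simp at hp
  have hroots : ∀ w ∈ p.roots, w ≠ 0 := by
    rintro _ hw rfl
    exact hp (Polynomial.isRoot_of_mem_roots hw)
  nth_rw 1 [(IsAlgClosed.splits p).eq_prod_roots]
  rw [Polynomial.reverse_mul_of_domain, Polynomial.reverse_C,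
    Polynomial.roots_C_mul _ (Polynomial.leadingCoeff_ne_zero.mpr hp0)]
  generalize p.roots = s at hroots
  induction s using Multiset.induction with
  | empty => simp [Polynomial.reverse]
  | cons w s ih =>
    rw [Multiset.forall_mem_cons] at hroots
    have hmonic : (s.map fun v => Polynomial.X - Polynomial.C v).prod.Monic :=
      Polynomial.monic_multiset_prod_of_monic _ _ fun v _ => Polynomial.monic_X_sub_C v
    rw [Multiset.map_cons, Multiset.prod_cons, Polynomial.reverse_mul_of_domain,
      Polynomial.roots_mul, roots_reverse_X_sub_C hroots.1, ih hroots.2, Multiset.map_cons,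
      Multiset.singleton_add]
    exact mul_ne_zero
      (Polynomial.reverse_eq_zero.not.mpr (Polynomial.X_sub_C_ne_zero w))
      (Polynomial.reverse_eq_zero.not.mpr hmonic.ne_zero)

lemma roots_eq_map_of_C_mul_comp_eq {p q : Polynomial ℂ} {κ c : ℂ} (hκ : κ ≠ 0) (hc : c ≠ 0)
    (h : Polynomial.C κ * q.comp (Polynomial.C c * Polynomial.X) = p) :
    q.roots = p.roots.map (c * ·) := by
  have hcomp := q.map_roots_comp_C_mul_X_add_C c 0 hc.isUnit
  simp only [Polynomial.C_0, add_zero] at hcomp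
  rw [← h, Polynomial.roots_C_mul _ hκ, hcomp]

end PolynomialRoots

section RandomPoly

variable {ν : Measure ℂ} {α lam : ℝ}

lemma coeff_randomPoly (ν : Measure ℂ) (a : ℕ → ℂ) (n k : ℕ) :
    (randomPoly ν a n).coeff k = if k ≤ n then
      a k * ((√(weightedInner ν n (Polynomial.X ^ k) (Polynomial.X ^ k)).re)⁻¹ : ℝ) else 0 := by
  simp [randomPoly, normalizedMonomial, Polynomial.finsetSum_coeff, Polynomial.coeff_X_pow]

lemma natDegree_randomPoly_le (ν : Measure ℂ) (a : ℕ → ℂ) (n : ℕ) :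
    (randomPoly ν a n).natDegree ≤ n := by
  refine Polynomial.natDegree_le_iff_coeff_eq_zero.mpr fun k hk => ?_
  rw [coeff_randomPoly, if_neg hk.not_ge]

lemma roots_randomPoly_zero (ν : Measure ℂ) (a : ℕ → ℂ) : (randomPoly ν a 0).roots = 0 := by
  rw [Polynomial.eq_C_of_natDegree_le_zero (natDegree_randomPoly_le ν a 0), Polynomial.roots_C]

lemma roots_weightedPoly_zero (d : ℕ → ℕ → ℝ) (a : ℕ → ℂ) : (weightedPoly d 0 a).roots = 0 := by
  rw [weightedPoly, Finset.sum_range_one, Polynomial.monomial_zero_left, Polynomial.roots_C]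

variable [IsProbabilityMeasure ν]

namespace IsAdmissibleBackground

theorem roots_weightedPoly_rescaledWeight (hν : IsAdmissibleBackground ν) (hα : 0 < α)
    (hlam : 0 < lam)
    (hF : Tendsto (fun r : ℝ => cdf (modulusLaw ν) r / r ^ α) (𝓝[>] 0) (𝓝 lam))
    (a : ℕ → ℂ) (n : ℕ) :
    (weightedPoly (rescaledWeight (modulusLaw ν) α) n a).roots
      = (randomPoly ν a n).roots.map ((((n : ℝ) ^ (1 / α) : ℝ) : ℂ) * ·) := by
  rcases n.eq_zero_or_pos with rfl | hn
  · rw [roots_weightedPoly_zero, roots_randomPoly_zero, Multiset.map_zero]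
  have hn' : (0 : ℝ) < n := by exact_mod_cast hn
  set L := Real.exp (-2 * (n : ℝ) * ∫ s, Real.log s ∂(modulusLaw ν)) with hL
  have hL0 : 0 < L := Real.exp_pos _
  refine roots_eq_map_of_C_mul_comp_eq (κ := (((√L)⁻¹ * √(n / (α / 2)) : ℝ) : ℂ))
    (Complex.ofReal_ne_zero.mpr (by positivity))
    (Complex.ofReal_ne_zero.mpr (Real.rpow_pos_of_pos hn' _).ne') ?_
  ext k
  rw [Polynomial.coeff_C_mul, Polynomial.comp_C_mul_X_coeff, coeff_weightedPoly, coeff_randomPoly]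
  split_ifs with hk
  · rw [hν.re_weightedInner_X_pow, ← hL, Real.sqrt_mul hL0.le, mul_inv,
      inv_sqrt_radialMoment hα hn (hν.isRadialLaw.radialMoment_pos hα hlam hF hk)]
    push_cast
    ring
  · simp

lemma re_weightedInner_X_pow_eq_radialMoment_map_inv (hν : IsAdmissibleBackground ν) {n k : ℕ}
    (hk : k ≤ n) : (weightedInner ν n (Polynomial.X ^ k) (Polynomial.X ^ k)).re
      = radialMoment ((modulusLaw ν).map fun r => r⁻¹) (n - k) n := by
  have hsub := hν.isRadialLaw.radialMoment_sub (Nat.sub_le n k)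
  rw [Nat.sub_sub_self hk] at hsub
  rw [hν.re_weightedInner_X_pow, hsub, ← mul_assoc, ← Real.exp_add]
  simp

lemma coeff_randomPoly_ne_zero (hν : IsAdmissibleBackground ν) (hα : 0 < α) (hlam : 0 < lam)
    (hF : Tendsto (fun r : ℝ => cdf ((modulusLaw ν).map fun r => r⁻¹) r / r ^ α) (𝓝[>] 0)
      (𝓝 lam))
    {a : ℕ → ℂ} {n k : ℕ} (hk : k ≤ n) (hak : a k ≠ 0) : (randomPoly ν a n).coeff k ≠ 0 := by
  have hpos := hν.isRadialLaw.map_inv.radialMoment_pos hα hlam hF (Nat.sub_le n k)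
  rw [coeff_randomPoly, if_pos hk, hν.re_weightedInner_X_pow_eq_radialMoment_map_inv hk]
  exact mul_ne_zero hak (Complex.ofReal_ne_zero.mpr (by positivity))

lemma C_mul_weightedPoly_comp_eq_reflect (hν : IsAdmissibleBackground ν) (hα : 0 < α)
    (hlam : 0 < lam)
    (hF : Tendsto (fun r : ℝ => cdf ((modulusLaw ν).map fun r => r⁻¹) r / r ^ α) (𝓝[>] 0)
      (𝓝 lam))
    (a : ℕ → ℂ) {n : ℕ} (hn : 0 < n) :
    Polynomial.C ((√(n / (α / 2)) : ℝ) : ℂ)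
        * (weightedPoly (rescaledWeight ((modulusLaw ν).map fun r => r⁻¹) α) n
          (a ∘ Polynomial.revAt n)).comp
            (Polynomial.C (((n : ℝ) ^ (1 / α) : ℝ) : ℂ) * Polynomial.X)
      = (randomPoly ν a n).reflect n := by
  ext k
  rw [Polynomial.coeff_C_mul, Polynomial.comp_C_mul_X_coeff, coeff_weightedPoly,
    Polynomial.coeff_reflect, coeff_randomPoly]
  rcases le_or_gt k n with hk | hk
  · rw [Polynomial.revAt_le hk, if_pos hk, if_pos (Nat.sub_le n k),
      hν.re_weightedInner_X_pow_eq_radialMoment_map_inv (Nat.sub_le n k), Nat.sub_sub_self hk,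
      inv_sqrt_radialMoment hα hn (hν.isRadialLaw.map_inv.radialMoment_pos hα hlam hF hk),
      Function.comp_apply, Polynomial.revAt_le hk]
    push_cast
    ring
  · rw [Polynomial.revAt_eq_self_of_lt hk, if_neg hk.not_ge, if_neg hk.not_ge, zero_mul, mul_zero]

theorem map_inv_roots_weightedPoly_rescaledWeight (hν : IsAdmissibleBackground ν) (hα : 0 < α)
    (hlam : 0 < lam)
    (hF : Tendsto (fun r : ℝ => cdf ((modulusLaw ν).map fun r => r⁻¹) r / r ^ α) (𝓝[>] 0)
      (𝓝 lam))
    {a : ℕ → ℂ} {n : ℕ} (h0 : a 0 ≠ 0) (hn : a n ≠ 0) :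
    (weightedPoly (rescaledWeight ((modulusLaw ν).map fun r => r⁻¹) α) n
        (a ∘ Polynomial.revAt n)).roots.map (·⁻¹)
      = (randomPoly ν a n).roots.map ((((n : ℝ) ^ (-(1 / α)) : ℝ) : ℂ) * ·) := by
  rcases n.eq_zero_or_pos with rfl | hn0
  · simp only [roots_weightedPoly_zero, roots_randomPoly_zero, Multiset.map_zero]
  have hn' : (0 : ℝ) < n := by exact_mod_cast hn0
  have hreverse : (randomPoly ν a n).reflect n = (randomPoly ν a n).reverse := by
    rw [Polynomial.reverse, le_antisymm (natDegree_randomPoly_le ν a n)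
      (Polynomial.le_natDegree_of_ne_zero (hν.coeff_randomPoly_ne_zero hα hlam hF le_rfl hn))]
  have heval : (randomPoly ν a n).eval 0 ≠ 0 := by
    rw [← Polynomial.coeff_zero_eq_eval_zero]
    exact hν.coeff_randomPoly_ne_zero hα hlam hF n.zero_le h0
  rw [roots_eq_map_of_C_mul_comp_eq (Complex.ofReal_ne_zero.mpr (by positivity))
    (Complex.ofReal_ne_zero.mpr (Real.rpow_pos_of_pos hn' _).ne')
    (hν.C_mul_weightedPoly_comp_eq_reflect hα hlam hF a hn0), hreverse, roots_reverse heval]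
  simp [Multiset.map_map, Real.rpow_neg hn'.le, mul_comm]

end IsAdmissibleBackground

end RandomPoly

/-! ### Functionals of the roots -/

section PointConfigRoots

variable {ι : Type*} {l : Filter ι} {P : ι → Polynomial ℂ} {f : ℂ → ℂ}

lemma eventually_eval_ne_zero (h : TendstoLocallyUniformly (fun i z => (P i).eval z) f l) {z : ℂ}
    (hz : f z ≠ 0) : ∀ᶠ i in l, (P i).eval z ≠ 0 :=
  ((tendstoLocallyUniformlyOn_univ.mpr h).tendsto_at (Set.mem_univ z)).eventually_ne hz

namespace PointConfig

lemma zeros_eval {p : Polynomial ℂ} (hp : p ≠ 0) :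
    zeros (fun z => p.eval z) = ofMultiset p.roots := by
  refine ext ?_
  rw [zeros, dif_pos p.differentiable, ofMultiset]
  exact zeroMeasure_eval hp

theorem tendsto_ofMultiset_roots (h : TendstoLocallyUniformly (fun i z => (P i).eval z) f l)
    (hf : Differentiable ℂ f) (hf0 : f ≠ 0) :
    Tendsto (fun i => ofMultiset (P i).roots) l (𝓝 (zeros f)) := by
  obtain ⟨z, hz⟩ := Function.ne_iff.mp hf0
  refine (tendsto_zeros h (fun i => (P i).differentiable) hf hf0).congr' ?_
  filter_upwards [eventually_eval_ne_zero h hz] with i hi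
  exact zeros_eval fun hP => hi (by rw [hP, Polynomial.eval_zero])

lemma map_inversion_comap_dirac {w : ℂ} (hw : w ≠ 0) :
    ((Measure.dirac w⁻¹).comap (Subtype.val : PuncturedPlane → ℂ)).map PuncturedPlane.inversion
      = (Measure.dirac w).comap Subtype.val := by
  have hval : MeasurableEmbedding (Subtype.val : PuncturedPlane → ℂ) :=
    .subtype_coe (measurableSet_singleton (0 : ℂ)).compl
  have hcomap : ∀ x : PuncturedPlane,
      (Measure.dirac x.1).comap (Subtype.val : PuncturedPlane → ℂ) = Measure.dirac x := fun x => by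
    rw [← Measure.map_dirac' hval.measurable, hval.comap_map]
  rw [hcomap ⟨w, hw⟩, hcomap ⟨w⁻¹, inv_ne_zero hw⟩,
    Measure.map_dirac' PuncturedPlane.inversion.measurable]
  congr 1
  exact Subtype.ext (inv_inv w)

theorem inverted_punctured_ofMultiset {s : Multiset ℂ} (hs : 0 ∉ s) :
    (ofMultiset s).punctured.inverted = (ofMultiset (s.map (·⁻¹))).punctured := by
  have hval : MeasurableEmbedding (Subtype.val : PuncturedPlane → ℂ) :=
    .subtype_coe (measurableSet_singleton (0 : ℂ)).compl
  refine ext ?_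
  change ((multisetMeasure s).comap Subtype.val).map PuncturedPlane.inversion
    = (multisetMeasure (s.map (·⁻¹))).comap Subtype.val
  induction s using Multiset.induction with
  | empty => simp [multisetMeasure]
  | cons w s ih =>
    rw [Multiset.mem_cons, not_or] at hs
    rw [Multiset.map_cons, multisetMeasure_cons, multisetMeasure_cons, hval.comap_add,
      hval.comap_add, Measure.map_add _ _ PuncturedPlane.inversion.measurable, ih hs.2,
      ← map_inversion_comap_dirac (inv_ne_zero (Ne.symm hs.1)), inv_inv]

end PointConfig

theorem tendsto_punctured_ofMultiset_map_inv_roots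
    (h : TendstoLocallyUniformly (fun i z => (P i).eval z) f l) (hf : Differentiable ℂ f)
    (hf0 : f 0 ≠ 0) :
    Tendsto (fun i => (PointConfig.ofMultiset ((P i).roots.map (·⁻¹))).punctured) l
      (𝓝 (PointConfig.zeros f).punctured.inverted) := by
  have hinverted : Continuous fun Q : PointConfig ℂ => Q.punctured.inverted :=
    PointConfig.continuous_inverted.comp PointConfig.continuous_punctured
  refine ((hinverted.tendsto _).comp
    (PointConfig.tendsto_ofMultiset_roots h hf (Function.ne_iff.mpr ⟨0, hf0⟩))).congr' ?_
  filter_upwards [eventually_eval_ne_zero h hf0] with i hi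
  exact PointConfig.inverted_punctured_ofMultiset fun h0 => hi (Polynomial.isRoot_of_mem_roots h0)

end PointConfigRoots

section MaxModulus

variable {ι : Type*} {l : Filter ι} {P : ι → Polynomial ℂ} {f : ℂ → ℂ}

lemma infDist_zeros_pos (hf : Continuous f) (hf0 : f 0 ≠ 0) (hzero : ∃ z, f z = 0) :
    0 < Metric.infDist 0 {z | f z = 0} :=
  ((isClosed_eq hf continuous_const).notMem_iff_infDist_pos hzero).mp hf0

lemma isGreatest_invZeroModuli (hf : Continuous f) (hf0 : f 0 ≠ 0) (hzero : ∃ z, f z = 0) :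
    IsGreatest (invZeroModuli f) (Metric.infDist 0 {z | f z = 0})⁻¹ := by
  obtain ⟨z, hz, hmin⟩ := (isClosed_eq hf continuous_const).exists_infDist_eq_dist hzero 0
  rw [dist_zero_left] at hmin
  refine ⟨⟨z⁻¹, ⟨inv_ne_zero fun h0 => hf0 (h0 ▸ hz), by rwa [inv_inv]⟩, ?_⟩, ?_⟩
  · simp only [norm_inv, hmin]
  · rintro _ ⟨w, ⟨hw, hfw⟩, rfl⟩
    have hle : Metric.infDist 0 {z | f z = 0} ≤ ‖w‖⁻¹ := by
      simpa using Metric.infDist_le_dist_of_mem (x := 0) (show w⁻¹ ∈ {z | f z = 0} from hfw)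
    exact (le_inv_comm₀ (norm_pos_iff.mpr hw) (infDist_zeros_pos hf hf0 hzero)).mpr hle

lemma maxModulus_map_inv_roots {p : Polynomial ℂ} (hp : p.eval 0 ≠ 0) :
    maxModulus (p.roots.map (·⁻¹)) = sSup (invZeroModuli fun z => p.eval z) := by
  have hp0 : p ≠ 0 := by rintro rfl; simp at hp
  rw [maxModulus, invZeroModuli]
  congr 2
  ext z
  have hz : z⁻¹ ∈ p.roots → z ≠ 0 := by
    rintro hroot rfl
    exact hp (by simpa using Polynomial.isRoot_of_mem_roots hroot)
  simp only [Multiset.mem_map, Set.mem_ofPred_eq, ← Polynomial.IsRoot.def,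
    ← Polynomial.mem_roots hp0]
  constructor
  · rintro ⟨w, hw, rfl⟩
    rw [inv_inv] at hz ⊢
    exact ⟨hz hw, hw⟩
  · exact fun h => ⟨z⁻¹, h.2, inv_inv z⟩

lemma maxModulus_map_mul {c : ℝ} (hc : 0 ≤ c) (s : Multiset ℂ) :
    maxModulus (s.map ((c : ℂ) * ·)) = c * maxModulus s := by
  rw [maxModulus, maxModulus, ← smul_eq_mul, ← Real.sSup_smul_of_nonneg hc]
  congr 1
  ext r
  simp [Set.mem_smul_set, abs_of_nonneg hc]

theorem tendsto_maxModulus_map_inv_roots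
    (h : TendstoLocallyUniformly (fun i z => (P i).eval z) f l) (hf : Differentiable ℂ f)
    (hf0 : f 0 ≠ 0) (hzero : ∃ z, f z = 0) :
    Tendsto (fun i => maxModulus ((P i).roots.map (·⁻¹))) l (𝓝 (sSup (invZeroModuli f))) := by
  rw [(isGreatest_invZeroModuli hf.continuous hf0 hzero).csSup_eq]
  have hinfDist := tendsto_infDist_zeros h (fun i => (P i).differentiable) hf
    (Function.ne_iff.mpr ⟨0, hf0⟩) hzero 0
  have hpos := infDist_zeros_pos hf.continuous hf0 hzero
  refine (hinfDist.inv₀ hpos.ne').congr' ?_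
  filter_upwards [eventually_eval_ne_zero h hf0, hinfDist.eventually_ne hpos.ne']
    with i hi hne
  have hnonempty : ∃ z, (P i).eval z = 0 := by
    by_contra! hempty
    simp [hempty] at hne
  rw [maxModulus_map_inv_roots hi,
    (isGreatest_invZeroModuli (P i).continuous hi hnonempty).csSup_eq]

end MaxModulus

/-! ### Measurability of functionals of the coefficients -/

namespace IsAdmissibleCoefficients

variable {Ω : Type*} [MeasurableSpace Ω] {μ : Measure Ω} {a : ℕ → Ω → ℂ}

lemma measurable_seq (ha : IsAdmissibleCoefficients μ a) : Measurable fun ω k => a k ω :=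
  measurable_pi_lambda _ ha.measurable

lemma ae_ne_zero (ha : IsAdmissibleCoefficients μ a) (k : ℕ) : ∀ᵐ ω ∂μ, a k ω ≠ 0 :=
  (ha.identDistrib k).symm.ae_snd (measurableSet_singleton (0 : ℂ)).compl ha.ne_zero

lemma identDistrib_comp_revAt (ha : IsAdmissibleCoefficients μ a) (n : ℕ) :
    IdentDistrib (fun ω => (fun k => a k ω) ∘ Polynomial.revAt n) (fun ω k => a k ω) μ μ where
  aemeasurable_fst := (measurable_pi_lambda _ fun _ => ha.measurable _).aemeasurable
  aemeasurable_snd := ha.measurable_seq.aemeasurable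
  map_eq := by
    have hrev := (ha.indep.precomp (Polynomial.revAt n).injective).map_fun_eq_infinitePi_map
      fun k => ha.measurable _
    have hlaw : (fun k => μ.map (a (Polynomial.revAt n k))) = fun k => μ.map (a k) := by
      ext1 k
      rw [(ha.identDistrib _).map_eq, (ha.identDistrib k).map_eq]
    rw [ha.indep.map_fun_eq_infinitePi_map ha.measurable, ← hlaw, ← hrev]
    rfl

variable {E : Type*} [TopologicalSpace E] [MeasurableSpace E] [BorelSpace E]

lemma aemeasurable_of_continuousAt (ha : IsAdmissibleCoefficients μ a) {T : (ℕ → ℂ) → E} {n : ℕ}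
    (hT : ∀ v, v 0 ≠ 0 → v n ≠ 0 → ContinuousAt T v) :
    AEMeasurable T (μ.map fun ω k => a k ω) := by
  have hS : MeasurableSet {v : ℕ → ℂ | v 0 ≠ 0 ∧ v n ≠ 0} :=
    (measurableSet_eq_fun (measurable_pi_apply 0) measurable_const).compl.inter
      (measurableSet_eq_fun (measurable_pi_apply n) measurable_const).compl
  have hrestrict := ContinuousOn.aemeasurable (μ := μ.map fun ω k => a k ω)
    (fun v hv => (hT v hv.1 hv.2).continuousWithinAt) hS
  rwa [Measure.restrict_eq_self_of_ae_mem] at hrestrict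
  refine (ae_map_iff ha.measurable_seq.aemeasurable hS).mpr ?_
  filter_upwards [ha.ae_ne_zero 0, ha.ae_ne_zero n] with ω h0 hn using ⟨h0, hn⟩

end IsAdmissibleCoefficients

lemma tendstoInDistribution_of_identDistrib {ι Ω'' E : Type*} {Ω Ω' : ι → Type*}
    [∀ i, MeasurableSpace (Ω i)] [∀ i, MeasurableSpace (Ω' i)] [MeasurableSpace Ω'']
    {μ : ∀ i, Measure (Ω i)} [∀ i, IsProbabilityMeasure (μ i)]
    {μ' : ∀ i, Measure (Ω' i)} [∀ i, IsProbabilityMeasure (μ' i)]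
    {μ'' : Measure Ω''} [IsProbabilityMeasure μ'']
    [TopologicalSpace E] [MeasurableSpace E] [OpensMeasurableSpace E] {l : Filter ι}
    {X : ∀ i, Ω i → E} {Y : ∀ i, Ω' i → E} {Z : Ω'' → E}
    (hX : TendstoInDistribution X l Z μ μ'') (hXY : ∀ i, IdentDistrib (X i) (Y i) (μ i) (μ' i)) :
    TendstoInDistribution Y l Z μ' μ'' where
  forall_aemeasurable i := (hXY i).aemeasurable_snd
  aemeasurable_limit := hX.aemeasurable_limit
  tendsto := hX.tendsto.congr fun i => Subtype.ext (hXY i).map_eq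

namespace IsWeightArray

variable {d : ℕ → ℕ → ℝ} {c : ℕ → ℝ} {v : ℕ → ℂ} {n : ℕ}

lemma eval_zero_weightedPoly_ne_zero (h : IsWeightArray d c) (hn : 0 < n) (hv : v 0 ≠ 0) :
    (weightedPoly d n v).eval 0 ≠ 0 := by
  rw [eval_zero_weightedPoly]
  exact mul_ne_zero hv (by exact_mod_cast (h.pos 0 n hn n.zero_le).ne')

lemma continuousAt_ofMultiset_roots (h : IsWeightArray d c) (hv : v 0 ≠ 0) :
    ContinuousAt (fun v => PointConfig.ofMultiset (weightedPoly d n v).roots) v := by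
  rcases n.eq_zero_or_pos with rfl | hn
  · simpa only [roots_weightedPoly_zero] using continuousAt_const
  · have hne : weightedPoly d n v ≠ 0 := fun h0 =>
      h.eval_zero_weightedPoly_ne_zero hn hv (by rw [h0, Polynomial.eval_zero])
    rw [ContinuousAt, ← PointConfig.zeros_eval hne]
    exact PointConfig.tendsto_ofMultiset_roots (tendstoLocallyUniformly_eval_weightedPoly d n v)
      (Polynomial.differentiable _)
      (Function.ne_iff.mpr ⟨0, h.eval_zero_weightedPoly_ne_zero hn hv⟩)

lemma continuousAt_punctured_ofMultiset_map_inv_roots (h : IsWeightArray d c) (hv : v 0 ≠ 0) :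
    ContinuousAt
      (fun v => (PointConfig.ofMultiset ((weightedPoly d n v).roots.map (·⁻¹))).punctured) v := by
  rcases n.eq_zero_or_pos with rfl | hn
  · simpa only [roots_weightedPoly_zero] using continuousAt_const
  · have heval := h.eval_zero_weightedPoly_ne_zero hn hv
    have hne : weightedPoly d n v ≠ 0 := fun h0 => heval (by rw [h0, Polynomial.eval_zero])
    rw [ContinuousAt, ← PointConfig.inverted_punctured_ofMultiset
      fun h0 => heval (Polynomial.isRoot_of_mem_roots h0), ← PointConfig.zeros_eval hne]
    exact tendsto_punctured_ofMultiset_map_inv_roots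
      (tendstoLocallyUniformly_eval_weightedPoly d n v) (Polynomial.differentiable _) heval

lemma exists_eval_weightedPoly_eq_zero (h : IsWeightArray d c) (hn : 0 < n) (hvn : v n ≠ 0) :
    ∃ z, (weightedPoly d n v).eval z = 0 := by
  refine IsAlgClosed.exists_root _ fun hdeg => hn.ne' ?_
  have hcoeff : (weightedPoly d n v).coeff n ≠ 0 := by
    rw [coeff_weightedPoly, if_pos le_rfl]
    exact mul_ne_zero hvn (by exact_mod_cast (h.pos n n hn le_rfl).ne')
  exact Nat.le_zero.mp ((Polynomial.le_natDegree_of_ne_zero hcoeff).trans_eq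
    (Polynomial.natDegree_eq_of_degree_eq_some hdeg))

lemma continuousAt_maxModulus_map_inv_roots (h : IsWeightArray d c) (hv : v 0 ≠ 0)
    (hvn : v n ≠ 0) :
    ContinuousAt (fun v => maxModulus ((weightedPoly d n v).roots.map (·⁻¹))) v := by
  rcases n.eq_zero_or_pos with rfl | hn
  · simpa only [roots_weightedPoly_zero] using continuousAt_const
  · have heval := h.eval_zero_weightedPoly_ne_zero hn hv
    rw [ContinuousAt, maxModulus_map_inv_roots heval]
    exact tendsto_maxModulus_map_inv_roots (tendstoLocallyUniformly_eval_weightedPoly d n v)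
      (Polynomial.differentiable _) heval (h.exists_eval_weightedPoly_eq_zero hn hvn)

end IsWeightArray

/-! ### Convergence of the zeros -/

lemma mittagLefflerFun_zero_ne_zero {α lam : ℝ} (hα : 0 < α) (hlam : 0 < lam) {v : ℕ → ℂ}
    (hv : v 0 ≠ 0) : mittagLefflerFun α lam v 0 ≠ 0 := by
  rw [mittagLefflerFun_eq]
  dsimp only
  rw [tsum_mul_zero_pow]
  exact mul_ne_zero hv (by exact_mod_cast (mittagLefflerWeight_pos hα hlam 0).ne')

lemma IsWeightArray.tendsto_ofMultiset_roots {d : ℕ → ℕ → ℝ} {α lam : ℝ}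
    (hα : 0 < α) (hlam : 0 < lam) (h : IsWeightArray d (mittagLefflerWeight α lam))
    {v : ℕ → ℂ} (hv : HasExpGrowth v) (h0 : v 0 ≠ 0) :
    Tendsto (fun n => PointConfig.ofMultiset (weightedPoly d n v).roots) atTop
      (𝓝 (PointConfig.zeros (mittagLefflerFun α lam v))) := by
  have htlu := h.tendstoLocallyUniformly hv
  rw [← mittagLefflerFun_eq] at htlu
  exact PointConfig.tendsto_ofMultiset_roots htlu (hv.differentiable_mittagLefflerFun hα hlam)
    (Function.ne_iff.mpr ⟨0, mittagLefflerFun_zero_ne_zero hα hlam h0⟩)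

section Limits

variable {Ω : Type*} [MeasurableSpace Ω] {μ : Measure Ω} {a : ℕ → Ω → ℂ}
  {ν : Measure ℂ} [IsProbabilityMeasure ν] {α lam : ℝ}

theorem IsAdmissibleBackground.aemeasurable_ofMultiset_scaled_roots
    (hν : IsAdmissibleBackground ν) (ha : IsAdmissibleCoefficients μ a) (hα : 0 < α)
    (hlam : 0 < lam)
    (hF : Tendsto (fun r : ℝ => cdf (modulusLaw ν) r / r ^ α) (𝓝[>] 0) (𝓝 lam)) (n : ℕ) :
    AEMeasurable (fun ω => PointConfig.ofMultiset ((randomPoly ν (fun k => a k ω) n).roots.map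
      fun z => (((n : ℝ) ^ (1 / α) : ℝ) : ℂ) * z)) μ := by
  simp_rw [← hν.roots_weightedPoly_rescaledWeight hα hlam hF]
  exact (ha.aemeasurable_of_continuousAt (n := n) fun v hv _ =>
    (hν.isRadialLaw.isWeightArray hα hlam hF).continuousAt_ofMultiset_roots hv).comp_measurable
      ha.measurable_seq

theorem IsAdmissibleBackground.tendsto_ofMultiset_scaled_roots
    (hν : IsAdmissibleBackground ν) (hα : 0 < α) (hlam : 0 < lam)
    (hF : Tendsto (fun r : ℝ => cdf (modulusLaw ν) r / r ^ α) (𝓝[>] 0) (𝓝 lam)) {v : ℕ → ℂ}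
    (hv : HasExpGrowth v) (h0 : v 0 ≠ 0) :
    Tendsto (fun n : ℕ => PointConfig.ofMultiset ((randomPoly ν v n).roots.map
        fun z => (((n : ℝ) ^ (1 / α) : ℝ) : ℂ) * z)) atTop
      (𝓝 (PointConfig.zeros (mittagLefflerFun α lam v))) := by
  simp_rw [← hν.roots_weightedPoly_rescaledWeight hα hlam hF]
  exact (hν.isRadialLaw.isWeightArray hα hlam hF).tendsto_ofMultiset_roots hα hlam hv h0

variable [IsProbabilityMeasure μ]

theorem IsAdmissibleCoefficients.aemeasurable_zeros_mittagLefflerFun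
    (ha : IsAdmissibleCoefficients μ a) (hα : 0 < α) (hlam : 0 < lam) :
    AEMeasurable (fun ω => PointConfig.zeros (mittagLefflerFun α lam fun k => a k ω)) μ := by
  have hw := isWeightArray_mittagLefflerWeight hα hlam
  refine aemeasurable_of_tendsto_metrizable_ae atTop (fun n =>
    (ha.aemeasurable_of_continuousAt (n := n) fun v hv _ =>
      hw.continuousAt_ofMultiset_roots (n := n) hv).comp_measurable ha.measurable_seq) ?_
  filter_upwards [ha.ae_hasExpGrowth, ha.ne_zero] with ω hgrowth h0
  exact hw.tendsto_ofMultiset_roots hα hlam hgrowth h0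

theorem IsAdmissibleBackground.tendstoInDistribution_scaled_roots
    (hν : IsAdmissibleBackground ν) (ha : IsAdmissibleCoefficients μ a) (hα : 0 < α)
    (hlam : 0 < lam)
    (hF : Tendsto (fun r : ℝ => cdf ((modulusLaw ν).map fun r => r⁻¹) r / r ^ α) (𝓝[>] 0)
      (𝓝 lam))
    {E : Type*} [TopologicalSpace E] [TopologicalSpace.PseudoMetrizableSpace E]
    [MeasurableSpace E] [BorelSpace E] {Φ : Multiset ℂ → E} {Z : Ω → E}
    (hcont : ∀ n (v : ℕ → ℂ), v 0 ≠ 0 → v n ≠ 0 → ContinuousAt (fun v => Φ ((weightedPoly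
      (rescaledWeight ((modulusLaw ν).map fun r => r⁻¹) α) n v).roots.map (·⁻¹))) v)
    (hlim : ∀ᵐ ω ∂μ, Tendsto (fun n => Φ ((weightedPoly
      (rescaledWeight ((modulusLaw ν).map fun r => r⁻¹) α) n fun k => a k ω).roots.map (·⁻¹)))
      atTop (𝓝 (Z ω))) :
    TendstoInDistribution (fun (n : ℕ) ω => Φ ((randomPoly ν (fun k => a k ω) n).roots.map
      fun z => (((n : ℝ) ^ (-(1 / α)) : ℝ) : ℂ) * z)) atTop Z (fun _ => μ) μ := by
  set S : ℕ → (ℕ → ℂ) → E := fun n v => Φ ((weightedPoly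
    (rescaledWeight ((modulusLaw ν).map fun r => r⁻¹) α) n v).roots.map (·⁻¹))
  have hS (n : ℕ) : AEMeasurable (S n) (μ.map fun ω k => a k ω) :=
    ha.aemeasurable_of_continuousAt (hcont n)
  have hSa (n : ℕ) : AEMeasurable (fun ω => S n fun k => a k ω) μ :=
    (hS n).comp_measurable ha.measurable_seq
  refine tendstoInDistribution_of_identDistrib (tendstoInDistribution_of_ae_tendsto hSa
    (aemeasurable_of_tendsto_metrizable_ae atTop hSa hlim) hlim) fun n => ?_
  have hident := (ha.identDistrib_comp_revAt n).symm.comp_of_aemeasurable (hS n)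
  refine hident.trans (.of_ae_eq hident.aemeasurable_snd ?_)
  filter_upwards [ha.ae_ne_zero 0, ha.ae_ne_zero n] with ω h0 hn
  exact congrArg Φ (hν.map_inv_roots_weightedPoly_rescaledWeight hα hlam hF h0 hn)

theorem IsAdmissibleBackground.tendstoInDistribution_punctured_scaled_roots
    (hν : IsAdmissibleBackground ν) (ha : IsAdmissibleCoefficients μ a) (hα : 0 < α)
    (hlam : 0 < lam)
    (hF : Tendsto (fun r : ℝ => cdf ((modulusLaw ν).map fun r => r⁻¹) r / r ^ α) (𝓝[>] 0)
      (𝓝 lam)) :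
    TendstoInDistribution
      (fun (n : ℕ) ω => (PointConfig.ofMultiset ((randomPoly ν (fun k => a k ω) n).roots.map
        fun z => (((n : ℝ) ^ (-(1 / α)) : ℝ) : ℂ) * z)).punctured) atTop
      (fun ω => (PointConfig.zeros (mittagLefflerFun α lam fun k => a k ω)).punctured.inverted)
      (fun _ => μ) μ := by
  have : LocallyCompactSpace PuncturedPlane := isOpen_ne.locallyCompactSpace
  have hw := hν.isRadialLaw.map_inv.isWeightArray hα hlam hF
  refine hν.tendstoInDistribution_scaled_roots ha hα hlam hF
    (Φ := fun s => (PointConfig.ofMultiset s).punctured)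
    (fun _ _ hv _ => hw.continuousAt_punctured_ofMultiset_map_inv_roots hv) ?_
  filter_upwards [ha.ae_hasExpGrowth, ha.ne_zero] with ω hgrowth h0
  have htlu := hw.tendstoLocallyUniformly hgrowth
  rw [← mittagLefflerFun_eq] at htlu
  exact tendsto_punctured_ofMultiset_map_inv_roots htlu
    (hgrowth.differentiable_mittagLefflerFun hα hlam) (mittagLefflerFun_zero_ne_zero hα hlam h0)

theorem IsAdmissibleBackground.tendstoInDistribution_scaled_maxModulus
    (hν : IsAdmissibleBackground ν) (ha : IsAdmissibleCoefficients μ a) (hα : 0 < α)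
    (hlam : 0 < lam)
    (hF : Tendsto (fun r : ℝ => cdf ((modulusLaw ν).map fun r => r⁻¹) r / r ^ α) (𝓝[>] 0)
      (𝓝 lam)) :
    TendstoInDistribution
      (fun (n : ℕ) ω =>
        (n : ℝ) ^ (-(1 / α)) * maxModulus (randomPoly ν (fun k => a k ω) n).roots) atTop
      (fun ω => sSup (invZeroModuli (mittagLefflerFun α lam fun k => a k ω)))
      (fun _ => μ) μ := by
  have hw := hν.isRadialLaw.map_inv.isWeightArray hα hlam hF
  have hscale (n : ℕ) : 0 ≤ (n : ℝ) ^ (-(1 / α)) := by positivity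
  simp_rw [← maxModulus_map_mul (hscale _)]
  refine hν.tendstoInDistribution_scaled_roots ha hα hlam hF
    (fun _ _ hv hvn => hw.continuousAt_maxModulus_map_inv_roots hv hvn) ?_
  filter_upwards [ha.ae_hasExpGrowth, ha.ne_zero,
    ha.ae_exists_mittagLefflerFun_eq_zero hα hlam] with ω hgrowth h0 hzero
  have htlu := hw.tendstoLocallyUniformly hgrowth
  rw [← mittagLefflerFun_eq] at htlu
  exact tendsto_maxModulus_map_inv_roots htlu (hgrowth.differentiable_mittagLefflerFun hα hlam)
    (mittagLefflerFun_zero_ne_zero hα hlam h0) hzero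

theorem IsAdmissibleCoefficients.ae_isGreatest_invZeroModuli
    (ha : IsAdmissibleCoefficients μ a) (hα : 0 < α) (hlam : 0 < lam) :
    ∀ᵐ ω ∂μ, IsGreatest (invZeroModuli (mittagLefflerFun α lam fun k => a k ω))
      (sSup (invZeroModuli (mittagLefflerFun α lam fun k => a k ω))) := by
  filter_upwards [ha.ae_hasExpGrowth, ha.ne_zero,
    ha.ae_exists_mittagLefflerFun_eq_zero hα hlam] with ω hgrowth h0 hzero
  have hmax := isGreatest_invZeroModuli
    (hgrowth.differentiable_mittagLefflerFun hα hlam).continuous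
    (mittagLefflerFun_zero_ne_zero hα hlam h0) hzero
  rwa [hmax.csSup_eq]

end Limits

theorem theorem4 {Ω : Type*} [MeasurableSpace Ω] (μ : Measure Ω) [IsProbabilityMeasure μ]
    (ν : Measure ℂ) [IsProbabilityMeasure ν] (hν : IsAdmissibleBackground ν)
    (a : ℕ → Ω → ℂ) (ha : IsAdmissibleCoefficients μ a)
    (α lam : ℝ) (hα : 0 < α) (hlam : 0 < lam) :
    -- the limiting random series is almost surely entire
    (∀ᵐ ω ∂μ, ∀ z : ℂ, Summable (mittagLefflerTerm α lam (fun k => a k ω) z)) ∧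
    -- at the origin
    (Tendsto (fun r : ℝ => ν.real (Metric.ball 0 r) / r ^ α) (𝓝[>] 0) (𝓝 lam) →
      (∀ n : ℕ, AEMeasurable (fun ω => PointConfig.ofMultiset
        ((randomPoly ν (fun k => a k ω) n).roots.map
          (fun z => (((n : ℝ) ^ (1 / α) : ℝ) : ℂ) * z))) μ) ∧
      AEMeasurable
        (fun ω => PointConfig.zeros (mittagLefflerFun α lam (fun k => a k ω))) μ ∧
      ∀ᵐ ω ∂μ, Tendsto
        (fun n : ℕ => PointConfig.ofMultiset
          ((randomPoly ν (fun k => a k ω) n).roots.map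
            (fun z => (((n : ℝ) ^ (1 / α) : ℝ) : ℂ) * z)))
        atTop
        (𝓝 (PointConfig.zeros (mittagLefflerFun α lam (fun k => a k ω))))) ∧
    -- at infinity
    (Tendsto (fun r : ℝ => r ^ α * ν.real (Metric.ball 0 r)ᶜ) atTop (𝓝 lam) →
      TendstoInDistribution
        (fun (n : ℕ) ω => (PointConfig.ofMultiset
          ((randomPoly ν (fun k => a k ω) n).roots.map
            (fun z => (((n : ℝ) ^ (-(1 / α)) : ℝ) : ℂ) * z))).punctured)
        atTop
        (fun ω =>
          (PointConfig.zeros (mittagLefflerFun α lam (fun k => a k ω))).punctured.inverted)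
        (fun _ => μ) μ ∧
      -- convergence of the maximum
      (∀ᵐ ω ∂μ,
        IsGreatest (invZeroModuli (mittagLefflerFun α lam (fun k => a k ω)))
          (sSup (invZeroModuli (mittagLefflerFun α lam (fun k => a k ω))))) ∧
      TendstoInDistribution
        (fun (n : ℕ) ω =>
          (n : ℝ) ^ (-(1 / α)) * maxModulus (randomPoly ν (fun k => a k ω) n).roots)
        atTop
        (fun ω => sSup (invZeroModuli (mittagLefflerFun α lam (fun k => a k ω))))
        (fun _ => μ) μ) := by
  refine ⟨?_, fun h => ⟨?_, ha.aemeasurable_zeros_mittagLefflerFun hα hlam, ?_⟩,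
    fun h => ⟨?_, ha.ae_isGreatest_invZeroModuli hα hlam, ?_⟩⟩
  · filter_upwards [ha.ae_hasExpGrowth] with ω hgrowth z
    exact hgrowth.summable_mittagLefflerTerm hα hlam z
  · exact hν.aemeasurable_ofMultiset_scaled_roots ha hα hlam (tendsto_cdf_modulusLaw ν h)
  · filter_upwards [ha.ae_hasExpGrowth, ha.ne_zero] with ω hgrowth h0
    exact hν.tendsto_ofMultiset_scaled_roots hα hlam (tendsto_cdf_modulusLaw ν h) hgrowth h0
  · exact hν.tendstoInDistribution_punctured_scaled_roots ha hα hlam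
      (hν.tendsto_cdf_map_inv_modulusLaw h)
  · exact hν.tendstoInDistribution_scaled_maxModulus ha hα hlam
      (hν.tendsto_cdf_map_inv_modulusLaw h)
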